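/- **Lemma (propagation of the gauge).** Let $x=(x^0,x^1,x^2,x^3)$ be coordinates on an open set $U\subseteq\mathbb{R}^4$, and consider the spacetime region $\mathcal{M}=\{x\in U: x^0\ge 0,\ x^1\ge 0\}$ with initial hypersurface $\mathcal{S}_\star=\mathcal{M}\cap\{x^0=0\}$, conformal boundary $\mathscr{I}=\mathcal{M}\cap\{x^1=0\}$ and corner $\partial\mathcal{S}_\star=\mathcal{S}_\star\cap\mathscr{I}$. Let $g_{\mu\nu}$, $\Phi_{\mu\nu}$ and the gauge source functions $\mathcal{R}(x)$, $\mathcal{F}^\mu(x)$ be smooth up to the boundary of $\mathcal{M}$ (they extend smoothly to $U$), where on $\mathcal{M}$ $g$ is a Lorentzian metric of signature $(-,+,+,+)$, $\mathcal{S}_\star$ is spacelike, and $\Phi_{\mu\nu}$ is symmetric with $g^{\mu\nu}\Phi_{\mu\nu}=0$. Let $\nabla$, $R^\sigma{}_{\mu\lambda\nu}$, $R_{\mu\nu}=R^\sigma{}_{\mu\sigma\nu}$, $R$, $C_{\mu\nu\lambda\rho}$, $\Gamma^\nu{}_{\mu\lambda}$ be the Levi-Civita connection, Riemann, Ricci,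 scalar and Weyl curvature and Christoffel symbols of $g$, with $\nabla_c\nabla_du^a-\nabla_d\nabla_cu^a=R^a{}_{bcd}u^b$; let $\Gamma^\nu=g^{\mu\lambda}\Gamma^\nu{}_{\mu\lambda}$ and write $\nabla_\mu V^\sigma=\partial_\mu V^\sigma+\Gamma^\sigma{}_{\mu\lambda}V^\lambda$ also for $V^\sigma=\Gamma^\sigma,\mathcal{F}^\sigma$. Let $\Xi$ be the conformal factor and $d_{\mu\nu\lambda\rho}$ the rescaled Weyl tensor, $\Xi\,d_{\mu\nu\lambda\rho}=C_{\mu\nu\lambda\rho}$. Assume that on $\mathcal{M}$ the gauge-reduced equations hold: $$R_{\mu\nu}-g_{\sigma(\mu}\nabla_{\nu)}\Gamma^\sigma+g_{\sigma(\mu}\nabla_{\nu)}\mathcal{F}^\sigma=2\Phi_{\mu\nu}+\tfrac14\mathcal{R}\,g_{\mu\nu},$$ $$\blacksquare\Phi_{\mu\nu}=4\Phi_\mu{}^\lambda\Phi_{\nu\lambda}-g_{\mu\nu}\Phi_{\lambda\rho}\Phi^{\lambda\rho}-2\,\Xi\, d_{\mu\lambda\nu\rho}\Phi^{\lambda\rho}+\tfrac13\mathcal{R}\,\Phi_{\mu\nu}-\tfrac1{24}g_{\mu\nu}\square\mathcal{R}+\tfrac16\nabla_\mu\nabla_\nu\mathcal{R},$$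 where $\square=g^{\mu\nu}\nabla_\mu\nabla_\nu$ and $\blacksquare\Phi_{\mu\nu}=\square\Phi_{\mu\nu}+A_{\tau\mu}\Phi^\tau{}_\nu+A_{\tau\nu}\Phi_\mu{}^\tau$ with $A_{\tau\lambda}=2\Phi_{\tau\lambda}+\tfrac14\mathcal{R}g_{\tau\lambda}-R_{\tau\lambda}-g_{\sigma\tau}\nabla_\lambda(\mathcal{F}^\sigma-\Gamma^\sigma)$. Define $$Q=R-\mathcal{R}(x),\qquad Q^\mu=\Gamma^\mu-\mathcal{F}^\mu(x),\qquad Q_\mu=g_{\mu\nu}Q^\nu,\qquad Q_{\mu\nu}=R_{\mu\nu}-2\Phi_{\mu\nu}-\tfrac14\mathcal{R}(x)g_{\mu\nu}.$$ *On $\mathscr{I}$.* For $\gamma,\delta\in\{0,2,3\}$ let $\not\!\alpha=(g^{11})^{-1/2}$, $\not\!\beta^\gamma=-g^{1\gamma}/g^{11}$ and $\ell_{\gamma\delta}=g_{\gamma\delta}$ be the lapse, shift and intrinsic metric of the level sets of $x^1$, $\gamma^\delta$ the contracted Christoffel symbols of $\ell_{\gamma\delta}$, $\not\!n$ the unit normal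 of these level sets with $\not\!n^1>0$, and $\ell_\mu{}^\nu=\delta_\mu{}^\nu-\not\!n_\mu\not\!n^\nu$. Assume the Gaussian gauge $\not\!\alpha=1$, $\not\!\beta^\gamma=0$ on $\mathscr{I}$, and that the extrinsic curvature of $\mathscr{I}$ is $\not\!K_{ij}=\varkappa\,\ell_{ij}$ for a function $\varkappa$. With $\hat q=\not\!n^\nu Q_\nu$ and $\hat q_\mu=\ell_\mu{}^\nu Q_\nu$, and with $\not\!\!D$ the normal derivative (the Lie derivative along $\not\!n$), suppose that on $\mathscr{I}$ $$\partial_1\!\not\!\alpha=3\varkappa+\mathcal{F}^1,\qquad \partial_1\!\not\!\beta^\delta=\mathcal{F}^\delta-\gamma^\delta,\tag{QGauge1}$$ $$\not\!\!D\hat q=0,\qquad \not\!\!D^2\hat q=0,\qquad \not\!\!D^2\hat q_\mu+\varkappa\not\!\!D\hat q_\mu=0.\tag{QGauge2}$$ *On $\mathcal{S}_\star$.* Let $n$ be the unit normal of the level sets of $x^0$ with $n^0>0$, $q=n^\nu Q_\nu$, $q_\mu=Q_\mu+n_\mu n^\nu Q_\nu$, and $D^{(k)}$ the $k$-fold Lie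 derivative along $n$. Suppose that on $\mathcal{S}_\star$ $$q=0,\quad q_\mu=0,\quad D^{(k)}q=0,\quad D^{(k)}q_\mu=0,\quad k=1,2,3.\tag{QGauge3}$$ Then there is a neighbourhood of the corner $\partial\mathcal{S}_\star$ in $\mathcal{M}$ on which $Q$, $Q_\mu$ and $Q_{\mu\nu}$ vanish identically. -/

import Mathlib

open scoped ContDiff

noncomputable section

namespace AdSGauge

/-- Points of the coordinate patch; the coordinates are `(x⁰, x¹, x², x³)`. -/
abbrev Pt : Type := Fin 4 → ℝ

/-- Component functions of scalar fields and of tensor fields of rank 1 to 4. -/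
abbrev Scalar : Type := Pt → ℝ
abbrev Tensor1 : Type := Fin 4 → Pt → ℝ
abbrev Tensor2 : Type := Fin 4 → Fin 4 → Pt → ℝ
abbrev Tensor4 : Type := Fin 4 → Fin 4 → Fin 4 → Fin 4 → Pt → ℝ

/-! ### The patch: spacetime region, initial surface, boundary, corner -/

/-- The spacetime region `{x⁰ ≥ 0, x¹ ≥ 0}` inside the patch `U`. -/
def region (U : Set Pt) : Set Pt := {x | x ∈ U ∧ 0 ≤ x 0 ∧ 0 ≤ x 1}

/-- The initial hypersurface `{x⁰ = 0}` of the region. -/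
def initialSurface (U : Set Pt) : Set Pt := {x | x ∈ region U ∧ x 0 = 0}

/-- The conformal boundary `{x¹ = 0}` of the region. -/
def scri (U : Set Pt) : Set Pt := {x | x ∈ region U ∧ x 1 = 0}

/-- The corner `{x⁰ = 0, x¹ = 0}`. -/
def corner (U : Set Pt) : Set Pt := {x | x ∈ U ∧ x 0 = 0 ∧ x 1 = 0}

/-- Partial derivative `∂_μ f`. -/
def pd (μ : Fin 4) (f : Scalar) : Scalar := fun x => fderiv ℝ f x (Pi.single μ 1)

/-! ### Metric, connection and curvature -/

/-- The inverse of a matrix of component functions, pointwise. -/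
def inverse {ι : Type} [Fintype ι] [DecidableEq ι] (h : ι → ι → Scalar) (i j : ι) : Scalar :=
  fun x => (Matrix.of fun a b => h a b x)⁻¹ i j

/-- Christoffel symbols `Γ^ν_{μλ}` of a metric `h` with index set `ι`, where the index `i : ι` refers
to the coordinate `x^{c i}`. -/
def christoffelOn {ι : Type} [Fintype ι] [DecidableEq ι] (c : ι → Fin 4) (h : ι → ι → Scalar)
    (ν μ l : ι) : Scalar :=
  fun x => (1 / 2) * ∑ ρ, inverse h ν ρ x *
    (pd (c μ) (h ρ l) x + pd (c l) (h μ ρ) x - pd (c ρ) (h μ l) x)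

/-- Contracted Christoffel symbols `Γ^ν = h^{μλ} Γ^ν_{μλ}`. -/
def contractedChristoffelOn {ι : Type} [Fintype ι] [DecidableEq ι] (c : ι → Fin 4)
    (h : ι → ι → Scalar) (ν : ι) : Scalar :=
  fun x => ∑ μ, ∑ l, inverse h μ l x * christoffelOn c h ν μ l x

/-- Spacetime Christoffel symbols `Γ^ν_{μλ}`. -/
def christoffel (g : Tensor2) (ν μ l : Fin 4) : Scalar := christoffelOn id g ν μ l

/-- The contracted Christoffel symbols `Γ^ν` of the spacetime metric. -/
def contractedChristoffel (g : Tensor2) (ν : Fin 4) : Scalar := contractedChristoffelOn id g ν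

/-- `∇_μ V^σ = ∂_μ V^σ + Γ^σ_{μλ} V^λ` (also applied formally to quantities such as `Γ^σ`). -/
def covVec (g : Tensor2) (V : Tensor1) (μ σ : Fin 4) : Scalar :=
  fun x => pd μ (V σ) x + ∑ l, christoffel g σ μ l x * V l x

/-- `∇_μ w_ν`. -/
def cov1 (g : Tensor2) (w : Tensor1) (μ ν : Fin 4) : Scalar :=
  fun x => pd μ (w ν) x - ∑ l, christoffel g l μ ν x * w l x

/-- `∇_λ T_{μν}`. -/
def cov2 (g : Tensor2) (T : Tensor2) (l μ ν : Fin 4) : Scalar :=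
  fun x => pd l (T μ ν) x - ∑ τ, christoffel g τ l μ x * T τ ν x
    - ∑ τ, christoffel g τ l ν x * T μ τ x

/-- `∇_κ ∇_λ T_{μν}`. -/
def covCov2 (g : Tensor2) (T : Tensor2) (k l μ ν : Fin 4) : Scalar :=
  fun x => pd k (cov2 g T l μ ν) x - ∑ τ, christoffel g τ k l x * cov2 g T τ μ ν x
    - ∑ τ, christoffel g τ k μ x * cov2 g T l τ ν x
    - ∑ τ, christoffel g τ k ν x * cov2 g T l μ τ x

/-- The Hessian `∇_μ ∇_ν f` of a scalar. -/
def hessian (g : Tensor2) (f : Scalar) (μ ν : Fin 4) : Scalar :=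
  cov1 g (fun l => pd l f) μ ν

/-- `□ f` on scalars. -/
def box0 (g : Tensor2) (f : Scalar) : Scalar :=
  fun x => ∑ μ, ∑ ν, inverse g μ ν x * hessian g f μ ν x

/-- `□ T_{μν}` on covariant 2-tensors. -/
def box2 (g : Tensor2) (T : Tensor2) (μ ν : Fin 4) : Scalar :=
  fun x => ∑ k, ∑ l, inverse g k l x * covCov2 g T k l μ ν x

/-- Riemann tensor
`R^σ_{μλν} = ∂_λ Γ^σ_{νμ} - ∂_ν Γ^σ_{λμ} + Γ^σ_{λτ} Γ^τ_{νμ} - Γ^σ_{ντ} Γ^τ_{λμ}`. -/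
def riemann (g : Tensor2) (σ μ l ν : Fin 4) : Scalar :=
  fun x => pd l (christoffel g σ ν μ) x - pd ν (christoffel g σ l μ) x
    + ∑ τ, christoffel g σ l τ x * christoffel g τ ν μ x
    - ∑ τ, christoffel g σ ν τ x * christoffel g τ l μ x

/-- `R_{σμλν}`. -/
def riemannLow (g : Tensor2) : Tensor4 :=
  fun σ μ l ν x => ∑ ρ, g σ ρ x * riemann g ρ μ l ν x

/-- Ricci tensor `R_{μν} = R^σ_{μσν}`. -/
def ricci (g : Tensor2) : Tensor2 := fun μ ν x => ∑ σ, riemann g σ μ σ ν x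

/-- Ricci scalar. -/
def scalarCurv (g : Tensor2) : Scalar := fun x => ∑ μ, ∑ ν, inverse g μ ν x * ricci g μ ν x

/-- Schouten tensor `L_{ab} = (R_{ab} - R g_{ab} / 6) / 2`. -/
def schouten (g : Tensor2) : Tensor2 :=
  fun μ ν x => (1 / 2) * (ricci g μ ν x - (1 / 6) * scalarCurv g x * g μ ν x)

/-- Weyl tensor `C_{abcd} = R_{abcd} - (g_{ac} L_{bd} - g_{ad} L_{bc} - g_{bc} L_{ad} + g_{bd} L_{ac})`. -/
def weyl (g : Tensor2) : Tensor4 := fun a b c d x =>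
  riemannLow g a b c d x - (g a c x * schouten g b d x - g a d x * schouten g b c x
    - g b c x * schouten g a d x + g b d x * schouten g a c x)

/-- The matrix of the metric is symmetric of signature `(-,+,+,+)`. -/
def IsLorentzianAt (g : Tensor2) (x : Pt) : Prop :=
  (∀ μ ν, g μ ν x = g ν μ x) ∧
  ∃ P : Matrix (Fin 4) (Fin 4) ℝ, IsUnit P.det ∧
    P.transpose * (Matrix.of fun a b => g a b x) * P = Matrix.diagonal ![-1, 1, 1, 1]

/-- The level set of `x⁰` through `x` is spacelike at `x`. -/
def IsSpacelikeAt (g : Tensor2) (x : Pt) : Prop :=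
  ∀ v : Fin 4 → ℝ, v 0 = 0 → v ≠ 0 → 0 < ∑ μ, ∑ ν, g μ ν x * v μ * v ν

/-! ### Gauge zero-quantities and the reduced equations

`R` is the conformal gauge source function, `F` the coordinate gauge source functions. -/

/-- `Q = R[g] - 𝓡(x)`. -/
def QScalar (g : Tensor2) (R : Scalar) : Scalar := fun x => scalarCurv g x - R x

/-- `Q^μ = Γ^μ - 𝓕^μ(x)`. -/
def QUp (g : Tensor2) (F : Tensor1) : Tensor1 := fun μ x => contractedChristoffel g μ x - F μ x

/-- `Q_μ = g_{μν} Q^ν`. -/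
def QDown (g : Tensor2) (F : Tensor1) : Tensor1 := fun μ x => ∑ ν, g μ ν x * QUp g F ν x

/-- `Q_{μν} = R_{μν} - 2 Φ_{μν} - 𝓡(x) g_{μν} / 4`. -/
def QTensor (g Φ : Tensor2) (R : Scalar) : Tensor2 :=
  fun μ ν x => ricci g μ ν x - 2 * Φ μ ν x - (1 / 4) * R x * g μ ν x

/-- `g_{σ(μ} ∇_{ν)} V^σ`. -/
def symGrad (g : Tensor2) (V : Tensor1) : Tensor2 := fun μ ν x =>
  (1 / 2) * ∑ σ, (g σ μ x * covVec g V ν σ x + g σ ν x * covVec g V μ σ x)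

/-- The reduced Ricci operator `R_{μν} - g_{σ(μ} ∇_{ν)} Γ^σ + g_{σ(μ} ∇_{ν)} 𝓕^σ`. -/
def reducedRicci (g : Tensor2) (F : Tensor1) : Tensor2 := fun μ ν x =>
  ricci g μ ν x - symGrad g (contractedChristoffel g) μ ν x + symGrad g F μ ν x

/-- `(2 Φ_{τλ} + 𝓡 g_{τλ} / 4 - R_{τλ}) - g_{στ} ∇_λ (𝓕^σ - Γ^σ)`. -/
def reductionCoeff (g Φ : Tensor2) (R : Scalar) (F : Tensor1) (τ l : Fin 4) : Scalar := fun x =>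
  (2 * Φ τ l x + (1 / 4) * R x * g τ l x - ricci g τ l x)
    - ∑ σ, g σ τ x * covVec g (fun ρ y => F ρ y - contractedChristoffel g ρ y) l σ x

/-- The reduced wave operator acting on a covariant 2-tensor `T`. -/
def reducedBox2 (g Φ : Tensor2) (R : Scalar) (F : Tensor1) (T : Tensor2) : Tensor2 :=
  fun μ ν x => box2 g T μ ν x
    + ∑ τ, reductionCoeff g Φ R F τ μ x * ∑ ρ, inverse g τ ρ x * T ρ ν x
    + ∑ τ, reductionCoeff g Φ R F τ ν x * ∑ ρ, inverse g τ ρ x * T μ ρ x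

/-- `Φ_{λρ} Φ^{λρ}`. -/
def normSq (g Φ : Tensor2) : Scalar := fun x =>
  ∑ a, ∑ b, ∑ c, ∑ d, inverse g a c x * inverse g b d x * Φ a b x * Φ c d x

/-- The right-hand side of the wave equation for `Φ_{μν}`:
`4 Φ_μ^λ Φ_{νλ} - g_{μν} Φ_{λρ} Φ^{λρ} - 2 Ξ d_{μλνρ} Φ^{λρ} + 𝓡 Φ_{μν} / 3
  - g_{μν} □𝓡 / 24 + ∇_μ ∇_ν 𝓡 / 6`. -/
def waveSource (g Φ : Tensor2) (R Ξ : Scalar) (d : Tensor4) : Tensor2 := fun μ ν x =>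
  4 * (∑ l, ∑ ρ, inverse g l ρ x * Φ μ ρ x * Φ ν l x)
    - g μ ν x * normSq g Φ x
    - 2 * Ξ x * (∑ l, ∑ ρ, ∑ a, ∑ b,
        d μ l ν ρ x * inverse g l a x * inverse g ρ b x * Φ a b x)
    + (1 / 3) * R x * Φ μ ν x
    - (1 / 24) * g μ ν x * box0 g R x
    + (1 / 6) * hessian g R μ ν x

/-- `(g, Φ)` solves the gauge-reduced equations for the metric and the tracefree Ricci field on
`D`; `d` is the rescaled Weyl tensor, that is `Ξ d = C[g]`. -/
structure IsReducedSolution (D : Set Pt) (g Φ : Tensor2) (R : Scalar) (F : Tensor1)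
    (Ξ : Scalar) (d : Tensor4) : Prop where
  symm : ∀ x ∈ D, ∀ μ ν, Φ μ ν x = Φ ν μ x
  tracefree : ∀ x ∈ D, ∑ μ, ∑ ν, inverse g μ ν x * Φ μ ν x = 0
  rescaledWeyl : ∀ x ∈ D, ∀ a b c e, Ξ x * d a b c e x = weyl g a b c e x
  metricEq : ∀ x ∈ D, ∀ μ ν,
    reducedRicci g F μ ν x = 2 * Φ μ ν x + (1 / 4) * R x * g μ ν x
  waveEq : ∀ x ∈ D, ∀ μ ν, reducedBox2 g Φ R F Φ μ ν x = waveSource g Φ R Ξ d μ ν x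

/-! ### Unit normals of the level sets of a coordinate `xⁱ`

`ε = -1` for spacelike level sets (`i = 0`), `ε = 1` for timelike ones (`i = 1`). -/

/-- The lapse `(ε g^{ii})^{-1/2}`. -/
def lapse (ε : ℝ) (i : Fin 4) (g : Tensor2) : Scalar :=
  fun x => (Real.sqrt (ε * inverse g i i x))⁻¹

/-- The unit conormal `n_μ = ε N δ_μ^i`; the vector `n^μ` satisfies `n^i > 0`. -/
def conormal (ε : ℝ) (i : Fin 4) (g : Tensor2) : Tensor1 :=
  fun μ x => if μ = i then ε * lapse ε i g x else 0

/-- The unit normal vector `n^μ`. -/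
def normal (ε : ℝ) (i : Fin 4) (g : Tensor2) : Tensor1 :=
  fun μ x => ∑ ν, inverse g μ ν x * conormal ε i g ν x

/-- The projector `δ_μ^ν - ε n_μ n^ν`. -/
def projector (ε : ℝ) (i : Fin 4) (g : Tensor2) (μ ν : Fin 4) : Scalar :=
  fun x => (if μ = ν then 1 else 0) - ε * conormal ε i g μ x * normal ε i g ν x

/-- The induced metric `g_{μν} - ε n_μ n_ν`. -/
def inducedMetric (ε : ℝ) (i : Fin 4) (g : Tensor2) : Tensor2 :=
  fun μ ν x => g μ ν x - ε * conormal ε i g μ x * conormal ε i g ν x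

/-- The extrinsic curvature: projection of `∇_σ n_τ`. -/
def extrinsicCurv (ε : ℝ) (i : Fin 4) (g : Tensor2) : Tensor2 := fun μ ν x =>
  ∑ σ, ∑ τ, projector ε i g μ σ x * projector ε i g ν τ x * cov1 g (conormal ε i g) σ τ x

/-- Normal component `n^ν w_ν`. -/
def normalPart (ε : ℝ) (i : Fin 4) (g : Tensor2) (w : Tensor1) : Scalar :=
  fun x => ∑ ν, normal ε i g ν x * w ν x

/-- Intrinsic part, the projection of `w_ν`. -/
def tangentialPart (ε : ℝ) (i : Fin 4) (g : Tensor2) (w : Tensor1) : Tensor1 :=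
  fun μ x => ∑ ν, projector ε i g μ ν x * w ν x

/-- The normal derivative of a scalar, `n^λ ∂_λ f`. -/
def normalDeriv0 (ε : ℝ) (i : Fin 4) (g : Tensor2) (f : Scalar) : Scalar :=
  fun x => ∑ l, normal ε i g l x * pd l f x

/-- The normal derivative of a covector: its Lie derivative along the unit normal,
`n^λ ∂_λ w_μ + w_λ ∂_μ n^λ`. -/
def normalDeriv1 (ε : ℝ) (i : Fin 4) (g : Tensor2) (w : Tensor1) : Tensor1 := fun μ x =>
  ∑ l, (normal ε i g l x * pd l (w μ) x + w l x * pd μ (normal ε i g l) x)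

/-! ### Conditions on the conformal boundary -/

/-- Indices of the coordinates `x⁰, x², x³` on the conformal boundary. -/
abbrev ScriIdx : Type := {i : Fin 4 // i ≠ 1}

/-- The intrinsic components `ℓ_{γδ}`, `γ, δ ∈ {0, 2, 3}`. -/
def scriMetric (g : Tensor2) (γ δ : ScriIdx) : Scalar := g γ.1 δ.1

/-- The shift `β^γ = - g^{1γ} / g^{11}`. -/
def scriShift (g : Tensor2) (γ : ScriIdx) : Scalar :=
  fun x => - inverse g 1 γ.1 x / inverse g 1 1 x

/-- Gaussian gauge on the boundary: unit lapse and vanishing shift. -/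
def GaussianOnScri (U : Set Pt) (g : Tensor2) : Prop :=
  ∀ x ∈ scri U, lapse 1 1 g x = 1 ∧ ∀ γ, scriShift g γ x = 0

/-- The boundary is umbilic with extrinsic curvature `ϰ ℓ_{ij}`. -/
def UmbilicScri (U : Set Pt) (g : Tensor2) (κ : Scalar) : Prop :=
  ∀ x ∈ scri U, ∀ μ ν, extrinsicCurv 1 1 g μ ν x = κ x * inducedMetric 1 1 g μ ν x

/-- First boundary condition, `∂_1 α = 3 ϰ + 𝓕^1` and `∂_1 β^δ = 𝓕^δ - γ^δ`, where `γ^δ` are the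
contracted Christoffel symbols of `ℓ`. -/
def QGauge1 (U : Set Pt) (g : Tensor2) (F : Tensor1) (κ : Scalar) : Prop :=
  ∀ x ∈ scri U,
    pd 1 (lapse 1 1 g) x = 3 * κ x + F 1 x ∧
    ∀ δ : ScriIdx, pd 1 (scriShift g δ) x =
      F δ.1 x - contractedChristoffelOn Subtype.val (scriMetric g) δ x

/-- Second boundary condition: with `q̂ = n^ν Q_ν`, `q̂_μ` the intrinsic part of `Q_μ` and `D` the
normal derivative, `D q̂ = 0`, `D² q̂ = 0`, `D² q̂_μ + ϰ D q̂_μ = 0`. -/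
def QGauge2 (U : Set Pt) (g : Tensor2) (F : Tensor1) (κ : Scalar) : Prop :=
  ∀ x ∈ scri U,
    normalDeriv0 1 1 g (normalPart 1 1 g (QDown g F)) x = 0 ∧
    normalDeriv0 1 1 g (normalDeriv0 1 1 g (normalPart 1 1 g (QDown g F))) x = 0 ∧
    ∀ μ, normalDeriv1 1 1 g (normalDeriv1 1 1 g (tangentialPart 1 1 g (QDown g F))) μ x
      + κ x * normalDeriv1 1 1 g (tangentialPart 1 1 g (QDown g F)) μ x = 0

/-! ### Conditions on the initial surface -/

/-- `q = n^ν Q_ν`, the intrinsic part `q_μ`, and their normal derivatives of orders `1, 2, 3`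
vanish on the initial surface. -/
def QGauge3 (U : Set Pt) (g : Tensor2) (F : Tensor1) : Prop :=
  ∀ x ∈ initialSurface U, ∀ n : ℕ, n ≤ 3 →
    ((normalDeriv0 (-1) 0 g)^[n] (normalPart (-1) 0 g (QDown g F))) x = 0 ∧
    ∀ μ, ((normalDeriv1 (-1) 0 g)^[n] (tangentialPart (-1) 0 g (QDown g F))) μ x = 0

end AdSGauge

end

open AdSGauge

/-! ### Levi-Civita calculus over a ring with four commuting derivations -/

noncomputable section

namespace AdSGauge

/-! The gauge covector `Q_μ` is part of a homogeneous linear system of wave equations with vanishing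
Cauchy data and vanishing Dirichlet data, so an energy estimate kills it near the corner. The metric
equation and its trace express `Q_{μν}` and `Q` through `∇Q`, so these vanish as well.

The equations. Write `r` for the conformal source function. The metric equation reads `4 R_{μν} = 8
Φ_{μν} + r g_{μν} + 2(∇_μ Q_ν + ∇_ν Q_μ)`. Its divergence and the contracted Bianchi identity give
`2 □Q_ν + 2 R_ν^μ Q_μ = -Y_ν` with the defect `Y_ν = 8 ∇^μ Φ_{μν} - ∇_ν r` (`MetricEq.box1_Q`).
Taking the divergence of the wave equation for `Φ` and commuting derivatives (`div2_boxT'`), every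
term free of gauge quantities cancels, and `□Y` is linear in `Q`, `Y` and their derivatives, with up
to two derivatives on `Q` (`box1_divDefect_mem`). To have at most first derivatives on the right,
the `∂_i Q` become unknowns too, but only for `i ≠ 1`: the derivative `∂_1 Q` satisfies no Dirichlet
condition. The missing `∂_1 ∂_1 Q` is solved for algebraically in the wave equation for `Q`, since
`g^{11}` is invertible (`waveSymbol_gaugeSystem_mem`).

The data. On the conformal boundary the first gauge condition and umbilicity say `Γ^μ = 𝓕^μ`, hence
`Q` and its tangential derivatives vanish; then `Y = -2 □Q`, and the second gauge condition is
exactly `□Q = 0` there (`eval_box1_eq_zero`). On the initial surface `Q` vanishes to third order;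
`Y` costs two derivatives of `Q`, so all unknowns vanish to first order (`gaugeSystem_mem_jet`).

Uniqueness (`wave_uniqueness`). The multiplier is `h^{0b} ∂_b u`. Its energy form is positive
because the initial surface is spacelike, and its flux through `x¹ = 0` vanishes because `g^{01} =
0` there and `u` has zero boundary values. A weight supported in a small lens at the corner point
makes the estimate close without a Gronwall argument.

The tensor calculus is done over an abstract ring, and "linear in the unknowns" is stated as
membership in an ideal. The ring is then taken to be the functions on a patch of the quadrant which
extend smoothly (`smoothRing`), so that equations known only on the region are ring identities. The
ideals become the functions dominated by the root of the energy density, or those vanishing on a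
hypersurface. -/

/-- A metric over a commutative ring with four commuting derivations. -/
structure MetricAlgebra (S : Type*) [CommRing S] [Algebra ℝ S] where
  d : Fin 4 → Derivation ℝ S S
  d_comm : ∀ i j f, d i (d j f) = d j (d i f)
  g : Fin 4 → Fin 4 → S
  gi : Fin 4 → Fin 4 → S
  g_symm : ∀ a b, g a b = g b a
  gi_symm : ∀ a b, gi a b = gi b a
  gi_g : ∀ a c, ∑ b, gi a b * g b c = if a = c then 1 else 0

namespace MetricAlgebra

variable {S : Type*} [CommRing S] [Algebra ℝ S] (G : MetricAlgebra S)

/-- The ring has no division; fractions come from the real scalars. -/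
def half (S : Type*) [CommRing S] [Algebra ℝ S] : S := algebraMap ℝ S (1 / 2)

lemma half_add_half : half S + half S = 1 := by
  rw [half, ← map_add]; norm_num

lemma two_mul_half : 2 * half S = 1 := by rw [two_mul, half_add_half]

/-- Christoffel symbols `Γ^ν_{μl}`. -/
def Γ (ν μ l : Fin 4) : S :=
  half S * ∑ ρ, G.gi ν ρ * (G.d μ (G.g ρ l) + G.d l (G.g μ ρ) - G.d ρ (G.g μ l))

lemma Γ_symm (ν μ l : Fin 4) : G.Γ ν μ l = G.Γ ν l μ := by
  unfold Γ
  congr 1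
  refine Finset.sum_congr rfl fun ρ _ => ?_
  rw [G.g_symm ρ l, G.g_symm μ ρ, G.g_symm μ l]
  ring

/-! Matrix notation. -/

def gMat : Matrix (Fin 4) (Fin 4) S := Matrix.of G.g
def giMat : Matrix (Fin 4) (Fin 4) S := Matrix.of G.gi
def ΓMat (k : Fin 4) : Matrix (Fin 4) (Fin 4) S := Matrix.of fun σ a => G.Γ σ k a
def dMat (k : Fin 4) (X : Matrix (Fin 4) (Fin 4) S) : Matrix (Fin 4) (Fin 4) S := X.map (G.d k)

lemma giMat_mul_gMat : G.giMat * G.gMat = 1 := by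
  ext a c
  rw [Matrix.mul_apply, Matrix.one_apply]
  exact G.gi_g a c

lemma gMat_mul_giMat : G.gMat * G.giMat = 1 := mul_eq_one_comm.mp G.giMat_mul_gMat

lemma g_gi (a c : Fin 4) : ∑ b, G.g a b * G.gi b c = if a = c then 1 else 0 := by
  have := congrFun (congrFun G.gMat_mul_giMat a) c
  rwa [Matrix.mul_apply, Matrix.one_apply] at this

lemma dMat_add (k : Fin 4) (X Y) : G.dMat k (X + Y) = G.dMat k X + G.dMat k Y := by
  ext; simp [dMat]

lemma dMat_sub (k : Fin 4) (X Y) : G.dMat k (X - Y) = G.dMat k X - G.dMat k Y := by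
  ext; simp [dMat]

lemma dMat_mul (k : Fin 4) (X Y) : G.dMat k (X * Y) = G.dMat k X * Y + X * G.dMat k Y := by
  ext
  simp [dMat, Matrix.mul_apply, map_sum, Finset.sum_add_distrib, mul_comm, add_comm]

lemma dMat_one (k : Fin 4) : G.dMat k 1 = 0 := by
  ext i j
  by_cases h : i = j <;> simp [dMat, h]

lemma dMat_comm (k l : Fin 4) (X) : G.dMat k (G.dMat l X) = G.dMat l (G.dMat k X) := by
  ext; simp [dMat, G.d_comm k l]

lemma sum_g_Γ (b μ l : Fin 4) : ∑ τ, G.g b τ * G.Γ τ μ l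
    = half S * (G.d μ (G.g b l) + G.d l (G.g μ b) - G.d b (G.g μ l)) := by
  have h1 : ∀ τ, G.g b τ * G.Γ τ μ l = ∑ ρ, half S * ((G.g b τ * G.gi τ ρ) *
      (G.d μ (G.g ρ l) + G.d l (G.g μ ρ) - G.d ρ (G.g μ l))) := by
    intro τ
    rw [Γ, Finset.mul_sum, Finset.mul_sum]
    exact Finset.sum_congr rfl fun ρ _ => by ring
  rw [Finset.sum_congr rfl fun τ _ => h1 τ, Finset.sum_comm]
  simp only [← Finset.mul_sum, ← Finset.sum_mul, G.g_gi]
  simp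

/-- Metric compatibility: in the sum of two Christoffel symbols of the first kind all but one
derivative of the metric cancel in pairs. -/
lemma d_g (k a b : Fin 4) :
    G.d k (G.g a b) = ∑ τ, G.Γ τ k a * G.g τ b + ∑ τ, G.Γ τ k b * G.g a τ := by
  have h1 := G.sum_g_Γ b k a
  have h2 := G.sum_g_Γ a k b
  have e1 : ∑ τ, G.Γ τ k a * G.g τ b = ∑ τ, G.g b τ * G.Γ τ k a :=
    Finset.sum_congr rfl fun τ _ => by rw [G.g_symm τ b, mul_comm]
  have e2 : ∑ τ, G.Γ τ k b * G.g a τ = ∑ τ, G.g a τ * G.Γ τ k b :=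
    Finset.sum_congr rfl fun τ _ => by rw [mul_comm]
  rw [e1, e2, h1, h2, G.g_symm b a, G.g_symm k b, G.g_symm k a]
  linear_combination (-(G.d k (G.g a b))) * half_add_half (S := S)

lemma dMat_gMat (k : Fin 4) :
    G.dMat k G.gMat = (G.ΓMat k).transpose * G.gMat + G.gMat * G.ΓMat k := by
  ext a b
  simp only [dMat, gMat, ΓMat, Matrix.map_apply, Matrix.of_apply, Matrix.add_apply,
    Matrix.mul_apply, Matrix.transpose_apply, G.d_g]
  congr 1
  exact Finset.sum_congr rfl fun τ _ => mul_comm _ _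

/-- Obtained by differentiating `giMat * gMat = 1` and multiplying by the inverse from the right. -/
lemma dMat_giMat (k : Fin 4) :
    G.dMat k G.giMat = -(G.giMat * (G.ΓMat k).transpose + G.ΓMat k * G.giMat) := by
  have h : G.dMat k (G.giMat * G.gMat) = 0 := by rw [giMat_mul_gMat, dMat_one]
  rw [dMat_mul, dMat_gMat] at h
  have h2 := congrArg (· * G.giMat) h
  simp only [add_mul, mul_add, zero_mul] at h2
  have e1 : G.dMat k G.giMat * G.gMat * G.giMat = G.dMat k G.giMat := by
    rw [mul_assoc, gMat_mul_giMat, mul_one]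
  have e2 : G.giMat * ((G.ΓMat k).transpose * G.gMat) * G.giMat
      = G.giMat * (G.ΓMat k).transpose := by
    rw [mul_assoc, mul_assoc, gMat_mul_giMat, mul_one]
  have e3 : G.giMat * (G.gMat * G.ΓMat k) * G.giMat = G.ΓMat k * G.giMat := by
    rw [← mul_assoc, giMat_mul_gMat, one_mul]
  rw [e1, e2, e3] at h2
  exact eq_neg_of_add_eq_zero_left h2

lemma d_gi (k a b : Fin 4) :
    G.d k (G.gi a b) = -(∑ τ, G.Γ a k τ * G.gi τ b + ∑ τ, G.Γ b k τ * G.gi a τ) := by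
  have := congrFun (congrFun (G.dMat_giMat k) a) b
  simp only [dMat, giMat, ΓMat, Matrix.map_apply, Matrix.of_apply, Matrix.add_apply,
    Matrix.neg_apply, Matrix.mul_apply, Matrix.transpose_apply] at this
  rw [this, add_comm]
  congr 2
  exact Finset.sum_congr rfl fun τ _ => mul_comm _ _

/-! ### Covariant derivatives of covariant tensors -/

/-- A connection on an `S`-module. -/
structure IsConn {M : Type*} [AddCommGroup M] [Module S M] (D : Fin 4 → M → M) : Prop where
  add : ∀ k m n, D k (m + n) = D k m + D k n
  smul : ∀ k (f : S) m, D k (f • m) = G.d k f • m + f • D k m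

/-- The connection on `M`-valued covectors, acting as the Levi-Civita connection on the index. -/
def cov {M : Type*} [AddCommGroup M] [Module S M] (D : Fin 4 → M → M) :
    Fin 4 → (Fin 4 → M) → (Fin 4 → M) :=
  fun k T a => D k (T a) - ∑ τ, G.Γ τ k a • T τ

/-- Riemann tensor `R^σ_{μlν}`. -/
def riem (σ μ l ν : Fin 4) : S :=
  G.d l (G.Γ σ ν μ) - G.d ν (G.Γ σ l μ) + ∑ τ, G.Γ σ l τ * G.Γ τ ν μ
    - ∑ τ, G.Γ σ ν τ * G.Γ τ l μ

variable {G} {M : Type*} [AddCommGroup M] [Module S M] {D : Fin 4 → M → M}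

namespace IsConn

variable (hD : G.IsConn D)
include hD

lemma zero (k : Fin 4) : D k 0 = 0 := by
  have := hD.add k 0 0
  rw [add_zero] at this
  exact left_eq_add.mp this

lemma neg (k : Fin 4) (m : M) : D k (-m) = - D k m := by
  have := hD.add k m (-m)
  rw [add_neg_cancel, hD.zero] at this
  exact (neg_eq_of_add_eq_zero_right this.symm).symm

lemma sub (k : Fin 4) (m n : M) : D k (m - n) = D k m - D k n := by
  rw [sub_eq_add_neg, hD.add, hD.neg, sub_eq_add_neg]

lemma sum {α : Type*} (s : Finset α) (k : Fin 4) (m : α → M) :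
    D k (∑ i ∈ s, m i) = ∑ i ∈ s, D k (m i) := by
  classical
  induction s using Finset.induction_on with
  | empty => simp [hD.zero]
  | insert a s ha ih => rw [Finset.sum_insert ha, hD.add, ih, Finset.sum_insert ha]

/-- This makes the construction iterable: a covariant tensor is a nested function, and each
application of `cov` corrects one further index, starting from the derivations on scalars. -/
lemma cov : G.IsConn (G.cov D) where
  add k m n := by
    funext a
    simp only [MetricAlgebra.cov, Pi.add_apply, hD.add, smul_add, Finset.sum_add_distrib]
    abel
  smul k f m := by
    funext a
    simp only [MetricAlgebra.cov, Pi.add_apply, Pi.smul_apply, hD.smul, smul_sub, Finset.smul_sum]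
    simp only [smul_smul, mul_comm f]
    abel

end IsConn

variable (G) in
lemma isConn_d : G.IsConn (M := S) (fun k f => G.d k f) where
  add k m n := map_add _ _ _
  smul k f m := by simp [add_comm, mul_comm]

/-- The commutator of covariant derivatives. -/
def comm (D : Fin 4 → M → M) (k l : Fin 4) (m : M) : M := D k (D l m) - D l (D k m)

lemma comm_d (k l : Fin 4) (f : S) : comm (fun k f => G.d k f) k l f = 0 := by
  simp [comm, G.d_comm k l]

/-- The terms with one Christoffel symbol and one derivative of `T` are symmetric in `k` and `l` and
drop out. Each additional index thus costs one Riemann term, which gives the Ricci identity in every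
rank by iteration. -/
lemma comm_cov (hD : G.IsConn D) (k l a : Fin 4) (T : Fin 4 → M) :
    comm (G.cov D) k l T a = comm D k l (T a) - ∑ σ, G.riem σ a k l • T σ := by
  have key : ∀ k l : Fin 4, G.cov D k (G.cov D l T) a = D k (D l (T a))
      - ∑ σ, (G.d k (G.Γ σ l a) • T σ) - ∑ σ, G.Γ σ l a • D k (T σ)
      - ∑ σ, G.Γ σ k a • D l (T σ) + ∑ σ, (∑ τ, G.Γ σ l τ * G.Γ τ k a) • T σ := by
    intro k l
    simp only [cov, hD.sub, hD.sum, hD.smul, smul_sub, Finset.sum_add_distrib,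
      Finset.sum_sub_distrib, Finset.smul_sum, Finset.sum_smul, smul_smul]
    rw [Finset.sum_comm (f := fun x y => (G.Γ x k a * G.Γ y l x) • T y)]
    simp only [mul_comm (G.Γ _ k a)]
    abel
  rw [comm, Pi.sub_apply, key, key]
  simp only [comm, riem, sub_smul, add_smul, Finset.sum_add_distrib, Finset.sum_sub_distrib]
  abel

end MetricAlgebra
end AdSGauge

/-! ### Contraction, symmetries of the curvature, Bianchi identities -/

namespace AdSGauge
namespace MetricAlgebra

variable {S : Type*} [CommRing S] [Algebra ℝ S] {G : MetricAlgebra S}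
variable {M : Type*} [AddCommGroup M] [Module S M] {D : Fin 4 → M → M}

/-! ### Contraction -/

variable (G) in
/-- Contraction of the first two indices with the inverse metric. -/
def tr (T : Fin 4 → Fin 4 → M) : M := ∑ a, ∑ b, G.gi a b • T a b

lemma tr_add (T T' : Fin 4 → Fin 4 → M) :
    G.tr (fun a b => T a b + T' a b) = G.tr T + G.tr T' := by
  simp [tr, Finset.sum_add_distrib]

lemma tr_sub (T T' : Fin 4 → Fin 4 → M) :
    G.tr (fun a b => T a b - T' a b) = G.tr T - G.tr T' := by
  simp [tr, Finset.sum_sub_distrib, smul_sub]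

lemma tr_neg (T : Fin 4 → Fin 4 → M) : G.tr (fun a b => - T a b) = - G.tr T := by
  simp [tr]

lemma tr_sum {α : Type*} (s : Finset α) (T : α → Fin 4 → Fin 4 → M) :
    G.tr (fun a b => ∑ i ∈ s, T i a b) = ∑ i ∈ s, G.tr (T i) := by
  simp only [tr, Finset.smul_sum]
  rw [Finset.sum_comm]
  conv_rhs => rw [Finset.sum_comm]
  rw [Finset.sum_comm]
  exact Finset.sum_congr rfl fun a _ => by
    rw [Finset.sum_comm]

lemma tr_smul (f : S) (T : Fin 4 → Fin 4 → M) :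
    G.tr (fun a b => f • T a b) = f • G.tr T := by
  simp only [tr, Finset.smul_sum, smul_smul, mul_comm]

lemma tr_mul_left (f : S) (T : Fin 4 → Fin 4 → S) :
    G.tr (fun a b => f * T a b) = f * G.tr T := tr_smul f T

lemma tr_mul_right (f : S) (T : Fin 4 → Fin 4 → S) :
    G.tr (fun a b => T a b * f) = G.tr T * f := by
  simp only [mul_comm _ f, tr_mul_left]

lemma tr_swap (T : Fin 4 → Fin 4 → M) : G.tr (fun a b => T b a) = G.tr T := by
  simp only [tr]
  rw [Finset.sum_comm]
  simp only [G.gi_symm]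

lemma tr_comm (T : Fin 4 → Fin 4 → Fin 4 → Fin 4 → M) :
    G.tr (fun a b => G.tr (fun c e => T a b c e)) = G.tr (fun c e => G.tr (fun a b => T a b c e)) := by
  conv_lhs => rw [tr]
  change _ = G.tr (fun c e => ∑ a, ∑ b, G.gi a b • T a b c e)
  rw [tr_sum]
  refine Finset.sum_congr rfl fun a _ => ?_
  rw [tr_sum]
  exact Finset.sum_congr rfl fun b _ => by rw [tr_smul]

lemma tr_apply {ι : Type*} (T : Fin 4 → Fin 4 → ι → M) (i : ι) :
    G.tr T i = G.tr fun a b => T a b i := by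
  simp [tr, Finset.sum_apply]

lemma tr_g (c : Fin 4) (X : Fin 4 → M) : G.tr (fun a b => G.g c a • X b) = X c := by
  simp only [tr, smul_smul]
  rw [Finset.sum_comm]
  simp only [← Finset.sum_smul, mul_comm (G.gi _ _), G.g_gi]
  simp

/-- Metric compatibility: contraction commutes with the covariant derivative. -/
lemma cov_tr (hD : G.IsConn D) (k : Fin 4) (T : Fin 4 → Fin 4 → M) :
    D k (G.tr T) = G.tr (G.cov (G.cov D) k T) := by
  have h1 : ∑ a, ∑ b, (∑ τ, G.Γ a k τ * G.gi τ b) • T a b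
      = ∑ a, ∑ b, G.gi a b • ∑ τ, G.Γ τ k a • T τ b := by
    simp only [Finset.sum_smul, Finset.smul_sum, smul_smul]
    rw [Finset.sum_congr rfl fun a _ => Finset.sum_comm, Finset.sum_comm]
    refine Finset.sum_congr rfl fun a _ => ?_
    rw [Finset.sum_comm]
    exact Finset.sum_congr rfl fun b _ => Finset.sum_congr rfl fun c _ => by rw [mul_comm]
  have h2 : ∑ a, ∑ b, (∑ τ, G.Γ b k τ * G.gi a τ) • T a b
      = ∑ a, ∑ b, G.gi a b • ∑ τ, G.Γ τ k b • T a τ := by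
    simp only [Finset.sum_smul, Finset.smul_sum, smul_smul]
    refine Finset.sum_congr rfl fun a _ => ?_
    rw [Finset.sum_comm]
    exact Finset.sum_congr rfl fun b _ => Finset.sum_congr rfl fun c _ => by rw [mul_comm]
  have h3 : D k (G.tr T) = ∑ a, ∑ b, G.gi a b • D k (T a b)
      - ∑ a, ∑ b, (∑ τ, G.Γ a k τ * G.gi τ b) • T a b
      - ∑ a, ∑ b, (∑ τ, G.Γ b k τ * G.gi a τ) • T a b := by
    simp only [tr, hD.sum, hD.smul, G.d_gi, neg_smul, add_smul, Finset.sum_add_distrib,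
      Finset.sum_neg_distrib]
    abel
  rw [h3, h1, h2]
  simp only [tr, cov, Pi.sub_apply, Finset.sum_apply, Pi.smul_apply, smul_sub,
    Finset.sum_sub_distrib]
  abel

/-- The inner version of `cov_tr`, with one index in front. -/
lemma cov_tr_one (hD : G.IsConn D) (k l : Fin 4) (T : Fin 4 → Fin 4 → Fin 4 → M) :
    G.cov D k (fun l => G.tr (T l)) l = G.tr (G.cov (G.cov (G.cov D)) k T l) := by
  change D k (G.tr (T l)) - ∑ τ, G.Γ τ k l • G.tr (T τ)
    = G.tr (G.cov (G.cov D) k (T l) - ∑ τ, G.Γ τ k l • T τ)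
  rw [cov_tr hD]
  have : ∑ τ, G.Γ τ k l • G.tr (T τ) = G.tr (∑ τ, G.Γ τ k l • T τ) := by
    have := tr_sum (G := G) Finset.univ fun τ a b => G.Γ τ k l • T τ a b
    simp only [tr_smul] at this
    rw [← this]
    exact congrArg G.tr (by funext a b; simp only [Finset.sum_apply, Pi.smul_apply])
  rw [this]
  exact (tr_sub _ _).symm

/-! ### Covariant derivatives of scalar-valued tensors -/

variable (G)

abbrev D0 : Fin 4 → S → S := fun k f => G.d k f
abbrev D1 : Fin 4 → (Fin 4 → S) → (Fin 4 → S) := G.cov G.D0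
abbrev D2 : Fin 4 → (Fin 4 → Fin 4 → S) → (Fin 4 → Fin 4 → S) := G.cov G.D1
abbrev D3 : Fin 4 → (Fin 4 → Fin 4 → Fin 4 → S) → (Fin 4 → Fin 4 → Fin 4 → S) := G.cov G.D2
abbrev D4 : Fin 4 → (Fin 4 → Fin 4 → Fin 4 → Fin 4 → S) →
    (Fin 4 → Fin 4 → Fin 4 → Fin 4 → S) := G.cov G.D3

lemma isConn_D1 : G.IsConn G.D1 := G.isConn_d.cov
lemma isConn_D2 : G.IsConn G.D2 := G.isConn_D1.cov
lemma isConn_D3 : G.IsConn G.D3 := G.isConn_D2.cov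
lemma isConn_D4 : G.IsConn G.D4 := G.isConn_D3.cov

lemma D1_apply (k a : Fin 4) (T) : G.D1 k T a = G.d k (T a) - ∑ τ, G.Γ τ k a * T τ := rfl

lemma D2_apply (k a b : Fin 4) (T) : G.D2 k T a b = G.d k (T a b)
    - ∑ τ, G.Γ τ k b * T a τ - ∑ τ, G.Γ τ k a * T τ b := by
  simp [cov]

lemma D3_apply (k a b c : Fin 4) (T) : G.D3 k T a b c = G.d k (T a b c)
    - ∑ τ, G.Γ τ k c * T a b τ - ∑ τ, G.Γ τ k b * T a τ c - ∑ τ, G.Γ τ k a * T τ b c := by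
  simp [cov]

lemma D4_apply (k a b c e : Fin 4) (T) : G.D4 k T a b c e = G.d k (T a b c e)
    - ∑ τ, G.Γ τ k e * T a b c τ - ∑ τ, G.Γ τ k c * T a b τ e
    - ∑ τ, G.Γ τ k b * T a τ c e - ∑ τ, G.Γ τ k a * T τ b c e := by
  simp [cov]

lemma D2_g (k : Fin 4) : G.D2 k G.g = 0 := by
  funext a b
  rw [D2_apply, d_g]
  simp

/-! ### Curvature -/

/-- `R_{σμλν}`. -/
def RL (σ μ l ν : Fin 4) : S := ∑ ρ, G.g σ ρ * G.riem ρ μ l ν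

def Ric (μ ν : Fin 4) : S := ∑ σ, G.riem σ μ σ ν

def Rs : S := G.tr G.Ric

lemma riem_antisymm (σ μ l ν : Fin 4) : G.riem σ μ l ν = - G.riem σ μ ν l := by
  unfold riem; ring

lemma RL_antisymm_right (σ μ l ν : Fin 4) : G.RL σ μ l ν = - G.RL σ μ ν l := by
  simp only [RL, G.riem_antisymm _ _ l ν, mul_neg, Finset.sum_neg_distrib]

lemma sum_riem_smul (a k l : Fin 4) (T : Fin 4 → M) :
    ∑ σ, G.riem σ a k l • T σ = G.tr fun ρ σ => G.RL ρ a k l • T σ := by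
  simp only [tr, RL, smul_smul]
  rw [Finset.sum_comm]
  refine Finset.sum_congr rfl fun σ _ => ?_
  rw [← Finset.sum_smul]
  congr 1
  simp only [Finset.mul_sum, ← mul_assoc]
  rw [Finset.sum_comm]
  simp only [← Finset.sum_mul, G.gi_symm _ σ, G.gi_g]
  simp

lemma Ric_eq_tr (μ ν : Fin 4) : G.Ric μ ν = G.tr fun σ l => G.RL σ μ l ν := by
  simp only [Ric, tr, RL, smul_eq_mul]
  rw [Finset.sum_comm]
  refine Finset.sum_congr rfl fun l _ => ?_
  simp only [Finset.mul_sum, ← mul_assoc]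
  rw [Finset.sum_comm]
  simp only [← Finset.sum_mul, G.gi_symm _ l, G.gi_g]
  simp

/-- The Ricci identity applied to the metric, which is parallel. -/
lemma RL_antisymm_left (σ μ l ν : Fin 4) : G.RL σ μ l ν = - G.RL μ σ l ν := by
  have h := congrFun (congrFun (show comm G.D2 l ν G.g = 0 by
    simp [comm, D2_g, G.isConn_D2.zero]) σ) μ
  rw [comm_cov G.isConn_D1, Pi.sub_apply, comm_cov G.isConn_d, comm_d] at h
  simp only [Finset.sum_apply, Pi.smul_apply, smul_eq_mul, Pi.zero_apply] at h
  have e1 : G.RL σ μ l ν = ∑ x, G.riem x μ l ν * G.g σ x :=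
    Finset.sum_congr rfl fun x _ => mul_comm _ _
  have e2 : G.RL μ σ l ν = ∑ x, G.riem x σ l ν * G.g x μ :=
    Finset.sum_congr rfl fun x _ => by rw [mul_comm, G.g_symm]
  rw [e1, e2]
  linear_combination -h

lemma riem_cyclic (σ a b c : Fin 4) :
    G.riem σ a b c + G.riem σ b c a + G.riem σ c a b = 0 := by
  simp only [riem, G.Γ_symm σ b a, G.Γ_symm σ c a, G.Γ_symm σ c b, G.Γ_symm _ b a,
    G.Γ_symm _ c a, G.Γ_symm _ c b]
  ring

lemma RL_cyclic (σ a b c : Fin 4) : G.RL σ a b c + G.RL σ b c a + G.RL σ c a b = 0 := by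
  simp only [RL, ← Finset.sum_add_distrib, ← mul_add, riem_cyclic]
  simp

/-- The usual combination of four cyclic identities with the two antisymmetries; the factor 2 is
then divided out. -/
lemma RL_pair (a b c e : Fin 4) : G.RL a b c e = G.RL c e a b := by
  have h : 2 * G.RL a b c e = 2 * G.RL c e a b := by
    have h1 := G.RL_cyclic a b c e
    have h2 := G.RL_cyclic b c e a
    have h3 := G.RL_cyclic c e a b
    have h4 := G.RL_cyclic e a b c
    have r1 := G.RL_antisymm_left b a c e
    have r2 := G.RL_antisymm_left b c e a
    have r3 := G.RL_antisymm_left b e a c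
    have r4 := G.RL_antisymm_left c a e b
    have r5 := G.RL_antisymm_left e a b c
    have r6 := G.RL_antisymm_left e c a b
    have s1 := G.RL_antisymm_right a b c e
    have s2 := G.RL_antisymm_right a c e b
    have s3 := G.RL_antisymm_right a e b c
    have s4 := G.RL_antisymm_right c e a b
    have s5 := G.RL_antisymm_right c b e a
    have s6 := G.RL_antisymm_right e b c a
    have s7 := G.RL_antisymm_right b c e a
    have s8 := G.RL_antisymm_right b e a c
    have s9 := G.RL_antisymm_right b a c e
    have t1 := G.RL_antisymm_left c b e a
    have t2 := G.RL_antisymm_left e b c a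
    have t3 := G.RL_antisymm_left e b a c
    have t4 := G.RL_antisymm_right c a b e
    have t5 := G.RL_antisymm_right e c a b
    have t6 := G.RL_antisymm_right e a b c
    have t7 := G.RL_antisymm_left c b a e
    have t8 := G.RL_antisymm_left c a b e
    have t9 := G.RL_antisymm_right c b a e
    grind
  have := congrArg (half S * ·) h
  simp only [← mul_assoc, mul_comm (half S) 2, two_mul_half, one_mul] at this
  exact this

lemma Ric_symm (μ ν : Fin 4) : G.Ric μ ν = G.Ric ν μ := by
  rw [Ric_eq_tr, Ric_eq_tr, ← tr_swap]
  congr 1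
  funext a b
  rw [RL_pair, RL_antisymm_left, RL_antisymm_right, neg_neg]

/-! ### Bianchi identity -/

/-- The curvature 2-form as a matrix, `dΓ + Γ ∧ Γ`, for which the second Bianchi identity is purely
algebraic. -/
def FMat (b c : Fin 4) : Matrix (Fin 4) (Fin 4) S :=
  G.dMat b (G.ΓMat c) - G.dMat c (G.ΓMat b) + G.ΓMat b * G.ΓMat c - G.ΓMat c * G.ΓMat b

lemma FMat_apply (b c σ a : Fin 4) : G.FMat b c σ a = G.riem σ a b c := by
  simp [FMat, dMat, ΓMat, riem, Matrix.mul_apply]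

lemma FMat_bianchi (a b c : Fin 4) :
    (G.dMat a (G.FMat b c) + G.ΓMat a * G.FMat b c - G.FMat b c * G.ΓMat a)
    + (G.dMat b (G.FMat c a) + G.ΓMat b * G.FMat c a - G.FMat c a * G.ΓMat b)
    + (G.dMat c (G.FMat a b) + G.ΓMat c * G.FMat a b - G.FMat a b * G.ΓMat c) = 0 := by
  simp only [FMat, dMat_add, dMat_sub, dMat_mul, G.dMat_comm b a, G.dMat_comm c a,
    G.dMat_comm c b]
  noncomm_ring

lemma RL_mat (b c σ a : Fin 4) : (G.gMat * G.FMat b c) σ a = G.RL σ a b c := by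
  simp [Matrix.mul_apply, gMat, RL, FMat_apply]

/-- Covariant derivative of the curvature form `R_{σ a b c}` in its first two indices. -/
lemma dform_RL (k b c σ a : Fin 4) :
    G.d k (G.RL σ a b c) - ∑ τ, G.Γ τ k a * G.RL σ τ b c - ∑ τ, G.Γ τ k σ * G.RL τ a b c
    = (G.gMat * (G.dMat k (G.FMat b c) + G.ΓMat k * G.FMat b c - G.FMat b c * G.ΓMat k)) σ a := by
  have h : G.gMat * (G.dMat k (G.FMat b c) + G.ΓMat k * G.FMat b c - G.FMat b c * G.ΓMat k)
      = G.dMat k (G.gMat * G.FMat b c) - (G.gMat * G.FMat b c) * G.ΓMat k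
        - (G.ΓMat k).transpose * (G.gMat * G.FMat b c) := by
    rw [dMat_mul, dMat_gMat]
    noncomm_ring
  rw [h]
  simp only [Matrix.sub_apply, dMat, Matrix.map_apply, RL_mat,
    Matrix.mul_apply (M := G.gMat * G.FMat b c), Matrix.mul_apply (M := (G.ΓMat k).transpose),
    Matrix.transpose_apply]
  simp only [ΓMat, Matrix.of_apply, mul_comm]

/-- The matrix identity accounts for the Christoffel terms on the first two indices. Those on the
2-form indices cancel in the cyclic sum because the connection is torsion-free. -/
lemma RL_bianchi (k b c σ a : Fin 4) :
    G.D4 k G.RL σ a b c + G.D4 b G.RL σ a c k + G.D4 c G.RL σ a k b = 0 := by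
  have h := congrArg (fun X : Matrix (Fin 4) (Fin 4) S => (G.gMat * X : Matrix _ _ S) σ a)
    (G.FMat_bianchi k b c)
  beta_reduce at h
  rw [Matrix.mul_add, Matrix.mul_add, Matrix.add_apply, Matrix.add_apply, ← dform_RL, ← dform_RL,
    ← dform_RL, Matrix.mul_zero, Matrix.zero_apply] at h
  simp only [D4_apply]
  have e1 : ∀ k b c, ∑ τ, G.Γ τ k c * G.RL σ a b τ = - ∑ τ, G.Γ τ k c * G.RL σ a τ b := by
    intro k b c
    simp only [G.RL_antisymm_right σ a b, mul_neg, Finset.sum_neg_distrib]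
  rw [e1 k b c, e1 b c k, e1 c k b]
  simp only [G.Γ_symm _ b k, G.Γ_symm _ c b, G.Γ_symm _ c k] at h ⊢
  linear_combination h

lemma D2_Ric (k a c : Fin 4) : G.D2 k G.Ric a c = G.tr fun σ l => G.D4 k G.RL σ a l c := by
  have h1 : G.Ric = G.tr fun σ l a c => G.RL σ a l c := by
    funext a c
    rw [Ric_eq_tr, tr_apply, tr_apply]
  rw [h1, cov_tr G.isConn_D2, tr_apply, tr_apply]
  congr 1
  funext σ l
  simp only [D4_apply]
  ring

/-- One contraction of the Bianchi identity. -/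
lemma div_RL (a b c : Fin 4) :
    (G.tr fun k σ => G.D4 k G.RL σ a b c) = G.D2 b G.Ric a c - G.D2 c G.Ric a b := by
  have h : (fun k σ => G.D4 k G.RL σ a b c)
      = fun k σ => G.D4 b G.RL σ a k c - G.D4 c G.RL σ a k b := by
    funext k σ
    have h1 := G.RL_bianchi k b c σ a
    have h2 : G.D4 b G.RL σ a c k = - G.D4 b G.RL σ a k c := by
      simp only [D4_apply, G.RL_antisymm_right _ _ c, G.RL_antisymm_right _ _ _ k, mul_neg,
        Finset.sum_neg_distrib, map_neg]
      ring
    linear_combination h1 - h2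
  rw [h, tr_sub, D2_Ric, D2_Ric, ← tr_swap, ← tr_swap (fun k σ => G.D4 c G.RL σ a k b)]

/-- A second contraction: the left side of `div_RL` itself becomes a divergence of the Ricci tensor.
-/
lemma two_div_Ric (b : Fin 4) : 2 * (G.tr fun k a => G.D2 k G.Ric a b) = G.d b G.Rs := by
  have h1 : (G.tr fun a c => G.tr fun k σ => G.D4 k G.RL σ a b c)
      = G.tr fun k a => G.D2 k G.Ric a b := by
    rw [tr_comm]
    congr 1
    funext k σ
    have : G.Ric = fun σ b => G.tr fun a c => G.RL σ a b c := by
      funext σ b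
      rw [Ric_eq_tr]
      congr 1
      funext a c
      rw [RL_antisymm_left, RL_antisymm_right, neg_neg]
    have h2 := congrFun (cov_tr_one G.isConn_D1 k σ fun σ a c b => G.RL σ a b c) b
    have h3 : (fun l => G.tr fun a c b => G.RL l a b c) = G.Ric := by
      rw [this]; funext σ b; rw [tr_apply]
    rw [h3, tr_apply] at h2
    refine Eq.trans ?_ h2.symm
    congr 1
    funext a c
    simp only [D4_apply]
    ring
  have h4 : G.d b G.Rs = G.tr fun a c => G.D2 b G.Ric a c := cov_tr G.isConn_d b G.Ric
  have h5 : (G.tr fun a c => G.D2 c G.Ric a b) = G.tr fun k a => G.D2 k G.Ric a b :=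
    tr_swap fun k a => G.D2 k G.Ric a b
  simp only [div_RL, tr_sub] at h1
  rw [h4]
  linear_combination -h1 - h5

end MetricAlgebra
end AdSGauge

/-! ### Commuting the divergence with the wave operator -/

namespace AdSGauge
namespace MetricAlgebra

variable {S : Type*} [CommRing S] [Algebra ℝ S] (G : MetricAlgebra S)

/-! ### Second derivatives, divergences and their commutation -/

/-- `□ w_ν`. -/
def box1 (w : Fin 4 → S) (ν : Fin 4) : S := G.tr fun k l => G.D2 k (fun l => G.D1 l w) l ν

/-- `∇^μ T_{μν}`. -/
def div2 (T : Fin 4 → Fin 4 → S) (ν : Fin 4) : S := G.tr fun m μ => G.D2 m T μ ν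

/-- `□ T_{μν}`. -/
def boxT (T : Fin 4 → Fin 4 → S) (μ ν : Fin 4) : S :=
  G.tr fun k l => G.D3 k (fun l => G.D2 l T) l μ ν

lemma comm_D1 (k l a : Fin 4) (w) :
    comm G.D1 k l w a = - G.tr fun ρ σ => G.RL ρ a k l * w σ := by
  rw [comm_cov G.isConn_d, comm_d, sum_riem_smul]
  simp

lemma comm_D2 (k l a b : Fin 4) (T) : comm G.D2 k l T a b
    = (- G.tr fun ρ σ => G.RL ρ a k l * T σ b) - G.tr fun ρ σ => G.RL ρ b k l * T a σ := by
  rw [comm_cov G.isConn_D1, Pi.sub_apply, comm_D1, sum_riem_smul, tr_apply]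
  simp only [Pi.smul_apply, smul_eq_mul]
  ring

lemma comm_D3 (k l a b c : Fin 4) (T) : comm G.D3 k l T a b c
    = (- G.tr fun ρ σ => G.RL ρ a k l * T σ b c) - (G.tr fun ρ σ => G.RL ρ b k l * T a σ c)
      - G.tr fun ρ σ => G.RL ρ c k l * T a b σ := by
  rw [comm_cov G.isConn_D2, Pi.sub_apply, Pi.sub_apply, comm_D2, sum_riem_smul, tr_apply, tr_apply]
  simp only [Pi.smul_apply, smul_eq_mul]
  ring

/-- The second covariant derivatives commute up to curvature. -/
lemma cov_cov_sub {M : Type*} [AddCommGroup M] [Module S M] (D : Fin 4 → M → M) (m : M)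
    (k l : Fin 4) : G.cov D k (fun l => D l m) l = G.cov D l (fun l => D l m) k + comm D k l m := by
  simp only [cov, comm, G.Γ_symm _ k l]
  abel

variable {G} in
lemma tr_congr {M : Type*} [AddCommGroup M] [Module S M] {T T' : Fin 4 → Fin 4 → M}
    (h : ∀ a b, T a b = T' a b) : G.tr T = G.tr T' :=
  congrArg G.tr (funext fun a => funext fun b => h a b)

lemma D2_symm (T : Fin 4 → Fin 4 → S) (h : ∀ a b, T a b = T b a) (k a b : Fin 4) :
    G.D2 k T a b = G.D2 k T b a := by
  have e1 : ∑ τ, G.Γ τ k b * T a τ = ∑ τ, G.Γ τ k b * T τ a :=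
    Finset.sum_congr rfl fun τ _ => by rw [h a τ]
  have e2 : ∑ τ, G.Γ τ k a * T τ b = ∑ τ, G.Γ τ k a * T b τ :=
    Finset.sum_congr rfl fun τ _ => by rw [h τ b]
  rw [D2_apply, D2_apply, h a b, e1, e2]
  ring

lemma tr_RL_mid (a b : Fin 4) : (G.tr fun m μ => G.RL a μ m b) = - G.Ric a b := by
  rw [Ric_eq_tr, ← tr_neg, ← tr_swap]
  congr 1
  funext σ l
  rw [RL_antisymm_left]

lemma tr_RL_outer (a b : Fin 4) : (G.tr fun k l => G.RL a l b k) = G.Ric a b := by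
  rw [Ric_eq_tr, ← tr_swap]
  congr 1
  funext σ l
  rw [RL_antisymm_left, RL_antisymm_right, neg_neg]

/-- `∇^μ ∇_ν w_μ = ∇_ν ∇^μ w_μ + R_ν^μ w_μ`. -/
lemma div_swap (w : Fin 4 → S) (ν : Fin 4) :
    (G.tr fun m μ => G.D2 m (fun l => G.D1 l w) ν μ)
      = G.d ν (G.tr fun m μ => G.D1 m w μ) + G.tr fun ρ σ => G.Ric ρ ν * w σ := by
  have h : ∀ m μ, G.D2 m (fun l => G.D1 l w) ν μ
      = G.D2 ν (fun l => G.D1 l w) m μ + comm G.D1 m ν w μ := fun m μ =>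
    congrFun (G.cov_cov_sub G.D1 w m ν) μ
  have h1 : (G.tr fun m μ => comm G.D1 m ν w μ) = G.tr fun ρ σ => G.Ric ρ ν * w σ := by
    rw [tr_congr fun m μ => G.comm_D1 m ν μ w, tr_neg, tr_comm, ← tr_neg]
    refine tr_congr fun ρ σ => ?_
    rw [tr_mul_right, tr_RL_mid, neg_mul, neg_neg]
  rw [tr_congr h, tr_add, h1]
  congr 1
  exact (cov_tr G.isConn_d ν fun l => G.D1 l w).symm

lemma D1_grad_symm (f : S) (μ ν : Fin 4) :
    G.D1 μ (fun l => G.d l f) ν = G.D1 ν (fun l => G.d l f) μ := by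
  rw [D1_apply, D1_apply, G.d_comm, Finset.sum_congr rfl fun τ _ => by rw [G.Γ_symm τ μ ν]]

/-- `□ ∇_ν f = ∇_ν □ f + R_ν^μ ∇_μ f`. -/
lemma box1_grad (f : S) (ν : Fin 4) : G.box1 (fun l => G.d l f) ν
    = G.d ν (G.tr fun m μ => G.D1 m (fun l => G.d l f) μ)
      + G.tr fun ρ σ => G.Ric ρ ν * G.d σ f := by
  rw [← div_swap, box1]
  exact tr_congr fun m μ => G.D2_symm _ (G.D1_grad_symm f) m μ ν

/-- The indices about to be contracted are listed first, since `tr` acts on the two outermost ones;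
every index carries its own Christoffel term, so the order is immaterial to the product rule. -/
lemma D4_mul_22 (A B : Fin 4 → Fin 4 → S) (k a b c e : Fin 4) :
    G.D4 k (fun a b c e => A c a * B b e) a b c e
      = G.D2 k A c a * B b e + A c a * G.D2 k B b e := by
  simp only [D4_apply, D2_apply, Derivation.leibniz, smul_eq_mul, sub_mul, mul_sub,
    Finset.sum_mul, Finset.mul_sum, mul_assoc, mul_left_comm (A _ _) (G.Γ _ _ _)]
  ring

lemma D6_mul_42 (A : Fin 4 → Fin 4 → Fin 4 → Fin 4 → S) (B : Fin 4 → Fin 4 → S)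
    (k m μ σ τ l ν : Fin 4) :
    G.cov (G.cov G.D4) k (fun m μ σ τ l ν => A σ ν m l * B μ τ) m μ σ τ l ν
      = G.D4 k A σ ν m l * B μ τ + A σ ν m l * G.D2 k B μ τ := by
  have h : ∀ T, G.cov (G.cov G.D4) k T m μ σ τ l ν = G.d k (T m μ σ τ l ν)
      - ∑ x, G.Γ x k ν * T m μ σ τ l x - ∑ x, G.Γ x k l * T m μ σ τ x ν
      - ∑ x, G.Γ x k τ * T m μ σ x l ν - ∑ x, G.Γ x k σ * T m μ x τ l ν
      - ∑ x, G.Γ x k μ * T m x σ τ l ν - ∑ x, G.Γ x k m * T x μ σ τ l ν := by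
    intro T
    simp [cov]
  simp only [h, D4_apply, D2_apply, Derivation.leibniz, smul_eq_mul, sub_mul, mul_sub,
    Finset.sum_mul, Finset.mul_sum, mul_assoc,
    mul_left_comm (A _ _ _ _) (G.Γ _ _ _)]
  ring

/-- Leibniz rule for `A_l^σ B_{σν}`. -/
lemma D2_contract_22 (A B : Fin 4 → Fin 4 → S) (k l ν : Fin 4) :
    G.D2 k (fun l ν => G.tr fun σ τ => A l σ * B τ ν) l ν
      = (G.tr fun σ τ => G.D2 k A l σ * B τ ν) + G.tr fun σ τ => A l σ * G.D2 k B τ ν := by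
  have h1 : (fun l ν => G.tr fun σ τ => A l σ * B τ ν)
      = G.tr fun σ τ l ν => A l σ * B τ ν := by
    funext l ν
    rw [tr_apply, tr_apply]
  rw [h1, cov_tr G.isConn_D2, tr_apply, tr_apply, ← tr_add]
  congr 1
  funext σ τ
  exact G.D4_mul_22 A B k σ τ l ν

/-- Leibniz rule for `A^σ_ν^μ_l B_{μσ}`. -/
lemma D2_contract_42 (A : Fin 4 → Fin 4 → Fin 4 → Fin 4 → S) (B : Fin 4 → Fin 4 → S)
    (k l ν : Fin 4) :
    G.D2 k (fun l ν => G.tr fun m μ => G.tr fun σ τ => A σ ν m l * B μ τ) l ν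
      = (G.tr fun m μ => G.tr fun σ τ => G.D4 k A σ ν m l * B μ τ)
        + G.tr fun m μ => G.tr fun σ τ => A σ ν m l * G.D2 k B μ τ := by
  have h1 : (fun l ν => G.tr fun m μ => G.tr fun σ τ => A σ ν m l * B μ τ)
      = G.tr fun m μ => G.tr fun σ τ l ν => A σ ν m l * B μ τ := by
    funext l ν
    simp only [tr_apply]
  have h2 : ∀ m μ, G.D4 k (fun m μ => G.tr fun σ τ l ν => A σ ν m l * B μ τ) m μ
      = G.tr (G.cov (G.cov G.D4) k (fun m μ σ τ l ν => A σ ν m l * B μ τ) m μ) := by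
    intro m μ
    have h3 : (fun m μ => G.tr fun σ τ l ν => A σ ν m l * B μ τ)
        = G.tr fun σ τ m μ l ν => A σ ν m l * B μ τ := by
      funext m μ
      rw [tr_apply, tr_apply]
    rw [h3, cov_tr G.isConn_D4, tr_apply, tr_apply]
    congr 1
    funext σ τ l ν
    simp only [cov, Pi.sub_apply, Finset.sum_apply, Pi.smul_apply]
    abel
  rw [h1, cov_tr G.isConn_D2, tr_apply, tr_apply, ← tr_add]
  congr 1
  funext m μ
  refine (congrFun (congrFun (h2 m μ) l) ν).trans ?_
  rw [tr_apply, tr_apply, ← tr_add]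
  congr 1
  funext σ τ
  exact G.D6_mul_42 A B k m μ σ τ l ν

/-- The divergence of `□ T` in terms of `□` of the divergence. -/
lemma div2_boxT (T : Fin 4 → Fin 4 → S) (ν : Fin 4) :
    G.div2 (G.boxT T) ν = G.box1 (G.div2 T) ν
      + (G.tr fun k l => G.D2 k (fun l ν => G.tr fun m μ => comm G.D2 m l T μ ν) l ν)
      + G.tr fun m μ => G.tr fun k l => comm G.D3 m k (fun l => G.D2 l T) l μ ν := by
  have h1 : G.boxT T = G.tr fun k => G.D3 k (fun l => G.D2 l T) := by
    funext μ ν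
    rw [tr_apply, tr_apply]; rfl
  have h2 : ∀ m μ, G.D2 m (G.boxT T) μ ν
      = G.tr fun k l => G.D4 m (fun k => G.D3 k (fun l => G.D2 l T)) k l μ ν := by
    intro m μ
    rw [h1, cov_tr G.isConn_D2, tr_apply, tr_apply]
  -- The outer derivative is moved inwards, past the first derivative here and past the second one
  -- in `h4`; each exchange leaves a commutator.
  have h3 : ∀ m k l μ, G.D4 m (fun k => G.D3 k (fun l => G.D2 l T)) k l μ ν
      = G.D4 k (fun k => G.D3 k (fun l => G.D2 l T)) m l μ ν
        + comm G.D3 m k (fun l => G.D2 l T) l μ ν := fun m k l μ =>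
    congrFun (congrFun (congrFun (G.cov_cov_sub G.D3 (fun l => G.D2 l T) m k) l) μ) ν
  have h4 : (fun m => G.D3 m (fun l => G.D2 l T)) = fun m l => G.D3 l (fun l => G.D2 l T) m
      + comm G.D2 m l T := by
    funext m l
    exact G.cov_cov_sub G.D2 T m l
  have h5 : ∀ k m l μ, G.D4 k (fun k => G.D3 k (fun l => G.D2 l T)) m l μ ν
      = G.D4 k (fun k => G.D3 k (fun l => G.D2 l T)) l m μ ν
        + G.D4 k (fun m l => comm G.D2 m l T) m l μ ν := by
    intro k m l μ
    conv_lhs => rw [h4]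
    simp only [D4_apply, Pi.add_apply, map_add, mul_add, Finset.sum_add_distrib]
    ring
  have h6 : ∀ k l, G.D2 k (fun l => G.D1 l (G.div2 T)) l ν
      = G.tr fun m μ => G.D4 k (fun k => G.D3 k (fun l => G.D2 l T)) l m μ ν := by
    intro k l
    have e1 : G.div2 T = G.tr fun m => G.D2 m T := by
      funext ν; rw [tr_apply]; rfl
    have e2 : (fun l => G.D1 l (G.div2 T)) = fun l => G.tr (G.D3 l (fun m => G.D2 m T)) := by
      funext l; rw [e1, cov_tr G.isConn_D1]
    have e3 := cov_tr_one G.isConn_D1 k l fun l => G.D3 l (fun m => G.D2 m T)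
    rw [e2]
    refine (congrFun e3 ν).trans ?_
    rw [tr_apply]
  have h7 : ∀ k l, G.D2 k (fun l ν => G.tr fun m μ => comm G.D2 m l T μ ν) l ν
      = G.tr fun m μ => G.D4 k (fun m l => comm G.D2 m l T) m l μ ν := by
    intro k l
    have e1 : (fun l ν => G.tr fun m μ => comm G.D2 m l T μ ν)
        = G.tr fun m μ l => comm G.D2 m l T μ := by
      funext l ν; rw [tr_apply, tr_apply]
    rw [e1, cov_tr G.isConn_D2, tr_apply, tr_apply]
    congr 1
    funext m μ
    simp only [D4_apply]
    ring
  rw [div2]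
  have h8 : ∀ m μ, G.D2 m (G.boxT T) μ ν
      = (G.tr fun k l => G.D4 k (fun k => G.D3 k (fun l => G.D2 l T)) m l μ ν)
        + G.tr fun k l => comm G.D3 m k (fun l => G.D2 l T) l μ ν := by
    intro m μ
    rw [h2, tr_congr fun k l => h3 m k l μ, tr_add]
  rw [tr_congr h8, tr_add]
  congr 1
  rw [tr_comm, tr_congr fun k l => tr_congr fun m μ => h5 k m l μ]
  simp only [tr_add]
  congr 1
  · exact (tr_congr h6).symm
  · exact (tr_congr h7).symm

/-- The divergence of the curvature contracted with `T^{μτ}`. -/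
lemma div_RL_contract (T : Fin 4 → Fin 4 → S) (ν : Fin 4) :
  (G.tr fun k l => G.tr fun m μ => G.tr fun σ τ => G.D4 k G.RL σ ν m l * T μ τ)
      = - G.tr fun m μ => G.tr fun σ τ =>
        (G.D2 σ G.Ric m ν - G.D2 ν G.Ric m σ) * T μ τ := by
  rw [tr_comm, ← tr_neg]
  congr 1; funext m μ
  rw [tr_comm, ← tr_neg]
  congr 1; funext σ τ
  rw [tr_mul_right, ← neg_mul, ← G.div_RL m σ ν, ← tr_neg]
  congr 2
  funext k l
  -- Pair symmetry moves the differentiated index into the first slot, where the contracted Bianchi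
  -- identity applies.
  have h : ∀ l m σ ν : Fin 4, G.RL σ ν m l = - G.RL l m σ ν := fun l m σ ν => by
    rw [RL_pair, RL_antisymm_left]
  have h' : ∀ {f f' : Fin 4 → S} (x : Fin 4 → S), (∀ τ, f τ = - f' τ) →
      ∑ τ, x τ * f τ = - ∑ τ, x τ * f' τ := fun x hx => by
    simp only [hx, mul_neg, Finset.sum_neg_distrib]
  rw [D4_apply, D4_apply, h l m σ ν, map_neg, h' _ fun τ => h τ m σ ν,
    h' _ fun τ => h l τ σ ν, h' _ fun τ => h l m σ τ, h' _ fun τ => h l m τ ν]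
  ring

/-- The curvature terms in `div2_boxT`. -/
lemma div2_boxT' (T : Fin 4 → Fin 4 → S) (ν : Fin 4) :
    G.div2 (G.boxT T) ν = G.box1 (G.div2 T) ν
      + (G.tr fun σ τ => G.div2 G.Ric σ * T τ ν)
      + (G.tr fun k l => G.tr fun σ τ => G.Ric l σ * G.D2 k T τ ν)
      + (G.tr fun m μ => G.tr fun σ τ =>
          (G.D2 σ G.Ric m ν - G.D2 ν G.Ric m σ) * T μ τ)
      - 2 * G.tr fun k l => G.tr fun m μ => G.tr fun ρ σ =>
          G.RL ρ ν m l * G.D2 k T μ σ := by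
  have c1 : (fun l ν => G.tr fun m μ => comm G.D2 m l T μ ν)
      = (fun l ν => G.tr fun σ τ => G.Ric l σ * T τ ν)
        - fun l ν => G.tr fun m μ => G.tr fun σ τ => G.RL σ ν m l * T μ τ := by
    funext l ν
    simp only [comm_D2, tr_sub, tr_neg, Pi.sub_apply]
    congr 1
    rw [tr_comm]
    simp only [tr_mul_right, tr_RL_mid]
    rw [← tr_neg]
    simp [G.Ric_symm l]
  have c2 : (G.tr fun m μ => G.tr fun k l => comm G.D3 m k (fun l => G.D2 l T) l μ ν)
      = - G.tr fun k l => G.tr fun m μ => G.tr fun ρ σ =>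
          G.RL ρ ν m l * G.D2 k T μ σ := by
    simp only [comm_D3, tr_sub, tr_neg]
    -- Three curvature terms, one for each index of `∇T`. The first two are Ricci terms of opposite
    -- sign and cancel; only the Riemann term on the free index survives.
    have e1 : (G.tr fun m μ => G.tr fun k l => G.tr fun ρ σ => G.RL ρ l m k * G.D2 σ T μ ν)
        = G.tr fun m μ => G.tr fun ρ σ => G.Ric ρ m * G.D2 σ T μ ν := by
      congr 1; funext m μ
      rw [tr_comm]
      simp only [tr_mul_right, tr_RL_outer]
    have e2 : (G.tr fun m μ => G.tr fun k l => G.tr fun ρ σ => G.RL ρ μ m k * G.D2 l T σ ν)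
        = - G.tr fun m μ => G.tr fun ρ σ => G.Ric ρ m * G.D2 σ T μ ν := by
      rw [tr_comm]
      have : ∀ k l, (G.tr fun m μ => G.tr fun ρ σ => G.RL ρ μ m k * G.D2 l T σ ν)
          = - G.tr fun ρ σ => G.Ric ρ k * G.D2 l T σ ν := by
        intro k l
        rw [tr_comm]
        simp only [tr_mul_right, tr_RL_mid]
        rw [← tr_neg]
        simp
      simp only [this, tr_neg]
      rw [tr_comm]
      exact congrArg _ (tr_congr fun m μ => tr_congr fun ρ σ => by rw [G.Ric_symm])
    have e3 : (G.tr fun m μ => G.tr fun k l => G.tr fun ρ σ => G.RL ρ ν m k * G.D2 l T μ σ)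
        = G.tr fun k l => G.tr fun m μ => G.tr fun ρ σ => G.RL ρ ν m l * G.D2 k T μ σ := by
      rw [tr_comm, ← tr_swap]
    rw [e1, e2, e3]
    ring
  have c4 : ∀ k l, G.D2 k ((fun l ν => G.tr fun σ τ => G.Ric l σ * T τ ν)
        - fun l ν => G.tr fun m μ => G.tr fun σ τ => G.RL σ ν m l * T μ τ) l ν
      = (G.tr fun σ τ => G.D2 k G.Ric l σ * T τ ν) + (G.tr fun σ τ => G.Ric l σ * G.D2 k T τ ν)
       - ((G.tr fun m μ => G.tr fun σ τ => G.D4 k G.RL σ ν m l * T μ τ)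
        + G.tr fun m μ => G.tr fun σ τ => G.RL σ ν m l * G.D2 k T μ τ) := by
    intro k l
    rw [G.isConn_D2.sub, Pi.sub_apply, Pi.sub_apply, D2_contract_22, D2_contract_42]
  have c5 : (G.tr fun k l => G.tr fun σ τ => G.D2 k G.Ric l σ * T τ ν)
      = G.tr fun σ τ => G.div2 G.Ric σ * T τ ν := by
    rw [tr_comm]
    congr 1; funext σ τ
    rw [tr_mul_right, div2]
  rw [div2_boxT, c1, c2]
  simp only [c4, tr_sub, tr_add]
  rw [div_RL_contract, c5]
  ring

end MetricAlgebra
end AdSGauge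

/-! ### The subsidiary wave equations for the gauge covector and the divergence defect -/

namespace AdSGauge
namespace MetricAlgebra

variable {S : Type*} [CommRing S] [Algebra ℝ S] (G : MetricAlgebra S)

lemma natCast_cancel {x y : S} (n : ℕ) (hn : n ≠ 0) (h : (n : S) * x = n * y) : x = y := by
  have h1 : algebraMap ℝ S (n : ℝ)⁻¹ * (n : S) = 1 := by
    rw [← map_natCast (algebraMap ℝ S), ← map_mul, inv_mul_cancel₀ (by exact_mod_cast hn), map_one]
  have := congrArg (algebraMap ℝ S (n : ℝ)⁻¹ * ·) h
  simpa only [← mul_assoc, h1, one_mul] using this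

lemma natCast_mul_mem {J : Ideal S} {x : S} (n : ℕ) (hn : n ≠ 0) (h : (n : S) * x ∈ J) :
    x ∈ J := by
  have h1 : algebraMap ℝ S (n : ℝ)⁻¹ * (n : S) = 1 := by
    rw [← map_natCast (algebraMap ℝ S), ← map_mul, inv_mul_cancel₀ (by exact_mod_cast hn), map_one]
  have := J.mul_mem_left (algebraMap ℝ S (n : ℝ)⁻¹) h
  rwa [← mul_assoc, h1, one_mul] at this

variable {G} in
lemma tr_mem {J : Ideal S} {T : Fin 4 → Fin 4 → S} (h : ∀ a b, T a b ∈ J) : G.tr T ∈ J :=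
  J.sum_mem fun a _ => J.sum_mem fun b _ => J.mul_mem_left _ (h a b)

variable {G} in
-- Two ideals count derivatives: `J₁` holds the admissible quantities, and `J₂` these together with
-- their first derivatives.
lemma D2_mem {J₁ J₂ : Ideal S} (h12 : J₁ ≤ J₂) (hd : ∀ k, ∀ f ∈ J₁, G.d k f ∈ J₂)
    {T : Fin 4 → Fin 4 → S} (h : ∀ a b, T a b ∈ J₁) (k a b : Fin 4) : G.D2 k T a b ∈ J₂ := by
  rw [D2_apply]
  exact J₂.sub_mem (J₂.sub_mem (hd k _ (h a b))
    (J₂.sum_mem fun τ _ => J₂.mul_mem_left _ (h12 (h a τ))))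
    (J₂.sum_mem fun τ _ => J₂.mul_mem_left _ (h12 (h τ b)))

lemma d_ofNat (k : Fin 4) (n : ℕ) [n.AtLeastTwo] : G.d k (OfNat.ofNat n : S) = 0 := by
  rw [← Nat.cast_ofNat]
  exact (G.d k).map_natCast _

lemma tr_mul_g (X : Fin 4 → S) (ν : Fin 4) : (G.tr fun m μ => X m * G.g μ ν) = X ν := by
  rw [← tr_swap]
  have := tr_g (G := G) ν X
  rw [← this]
  exact tr_congr fun a b => by rw [G.g_symm, smul_eq_mul, mul_comm]

/-- `8 ∇^μ Φ_{μν} - ∇_ν r`. -/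
def divDefect (Φ : Fin 4 → Fin 4 → S) (r : S) (ν : Fin 4) : S := 8 * G.div2 Φ ν - G.d ν r

/-- The metric equation of the reduced system. -/
def MetricEq (Φ : Fin 4 → Fin 4 → S) (r : S) (Q : Fin 4 → S) : Prop :=
  ∀ μ ν, 4 * G.Ric μ ν = 8 * Φ μ ν + r * G.g μ ν + 2 * (G.D1 μ Q ν + G.D1 ν Q μ)

section

variable {G} {Φ : Fin 4 → Fin 4 → S} {r : S} {Q : Fin 4 → S} (hmet : G.MetricEq Φ r Q)

include hmet

lemma MetricEq.D2_Ric (k a b : Fin 4) : 4 * G.D2 k G.Ric a b = 8 * G.D2 k Φ a b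
    + G.d k r * G.g a b + 2 * (G.D2 k (fun l => G.D1 l Q) a b + G.D2 k (fun l => G.D1 l Q) b a) := by
  have h1 : (4 : S) • G.Ric = (8 : S) • Φ + r • G.g
      + (2 : S) • ((fun μ ν => G.D1 μ Q ν) + fun μ ν => G.D1 ν Q μ) := by
    funext μ ν
    exact hmet μ ν
  have h2 := congrFun (congrFun (congrArg (G.D2 k) h1) a) b
  have h3 : G.D2 k (fun μ ν => G.D1 ν Q μ) a b = G.D2 k (fun l => G.D1 l Q) b a := by
    simp only [D2_apply]; ring
  simp only [G.isConn_D2.add, G.isConn_D2.smul, D2_g, Pi.add_apply, Pi.smul_apply,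
    smul_eq_mul, Pi.zero_apply, mul_zero, add_zero, h3] at h2
  have d4 : G.d k (4 : S) = 0 := G.d_ofNat k 4
  have d8 : G.d k (8 : S) = 0 := G.d_ofNat k 8
  have d2 : G.d k (2 : S) = 0 := G.d_ofNat k 2
  rw [d4, d8, d2] at h2
  linear_combination h2

lemma MetricEq.Rs_eq (htr : G.tr Φ = 0) : G.Rs = r + G.tr fun m μ => G.D1 m Q μ := by
  have h1 : 4 * G.Rs = 8 * G.tr Φ + r * G.tr G.g
      + 2 * ((G.tr fun m μ => G.D1 m Q μ) + G.tr fun m μ => G.D1 μ Q m) := by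
    rw [Rs, ← tr_mul_left, ← tr_mul_left, ← tr_mul_left, ← tr_add, ← tr_add, ← tr_mul_left,
      ← tr_add]
    exact tr_congr hmet
  have h2 : (G.tr fun m μ => G.D1 μ Q m) = G.tr fun m μ => G.D1 m Q μ :=
    tr_swap fun m μ => G.D1 m Q μ
  have h3 : G.tr G.g = 4 := by
    have : ∀ a, ∑ b, G.gi a b * G.g a b = 1 := fun a => by
      have := G.gi_g a a
      rw [if_pos rfl] at this
      rw [← this]
      exact Finset.sum_congr rfl fun b _ => by rw [G.g_symm]
    simp [tr, this]
  rw [h2, h3, htr] at h1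
  refine natCast_cancel 4 (by norm_num) ?_
  push_cast
  linear_combination h1

/-- The wave equation for the gauge quantity `Q_ν`. -/
lemma MetricEq.box1_Q (htr : G.tr Φ = 0) (ν : Fin 4) :
    2 * G.box1 Q ν + 2 * (G.tr fun ρ σ => G.Ric ρ ν * Q σ) = - G.divDefect Φ r ν := by
  -- In the divergence of the metric equation the term `∇_ν ∇^μ Q_μ` appears once from commuting
  -- derivatives and once, through the Bianchi identity, from the gradient of the scalar curvature.
  -- The two cancel, so only `□Q` is left at second order.
  have h1 : 4 * G.div2 G.Ric ν = 8 * G.div2 Φ ν + G.d ν r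
      + 2 * (G.box1 Q ν + G.tr fun m μ => G.D2 m (fun l => G.D1 l Q) ν μ) := by
    rw [div2, div2, box1, ← tr_mul_left, ← tr_mul_left, ← G.tr_mul_g (fun m => G.d m r) ν,
      ← tr_add, ← tr_add, ← tr_mul_left, ← tr_add]
    exact tr_congr fun m μ => hmet.D2_Ric m μ ν
  have h2 := G.two_div_Ric ν
  have h3 := G.div_swap Q ν
  have h4 := congrArg (G.d ν) (hmet.Rs_eq htr)
  rw [map_add] at h4
  unfold divDefect
  unfold div2 at h1 ⊢
  linear_combination -h1 + 2 * h2 - 2 * h3 + 2 * h4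

end

/-! ### The wave equation for `Φ` -/

def schouten (a b : Fin 4) : S :=
  half S * (G.Ric a b - algebraMap ℝ S (1 / 6) * G.Rs * G.g a b)

def weyl (a b c e : Fin 4) : S :=
  G.RL a b c e - (G.g a c * G.schouten b e - G.g a e * G.schouten b c
    - G.g b c * G.schouten a e + G.g b e * G.schouten a c)

/-- `Φ_{λρ} Φ^{λρ}`. -/
def normSq (Φ : Fin 4 → Fin 4 → S) : S := G.tr fun l a => G.tr fun ρ b => Φ l ρ * Φ a b

def box0 (r : S) : S := G.tr fun m μ => G.D1 m (fun l => G.d l r) μ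

/-- The wave equation of the reduced system with reduction coefficients `A`. -/
def WaveEq (Φ A : Fin 4 → Fin 4 → S) (r : S) : Prop := ∀ μ ν,
  24 * G.boxT Φ μ ν + 24 * (∑ τ, A τ μ * ∑ ρ, G.gi τ ρ * Φ ρ ν)
    + 24 * (∑ τ, A τ ν * ∑ ρ, G.gi τ ρ * Φ μ ρ)
    = 96 * (G.tr fun l ρ => Φ μ ρ * Φ ν l) - 24 * G.g μ ν * G.normSq Φ
      - 48 * (G.tr fun l a => G.tr fun ρ b => G.weyl μ l ν ρ * Φ a b)
      + 8 * r * Φ μ ν - G.g μ ν * G.box0 r + 4 * G.D1 μ (fun l => G.d l r) ν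

/-- The right-hand side of the wave equation up to terms which vanish with the gauge quantities. -/
def waveRhs (Φ : Fin 4 → Fin 4 → S) (r : S) (μ ν : Fin 4) : S :=
  - 48 * (G.tr fun m a => G.tr fun σ τ => G.RL σ ν m μ * Φ a τ) + 24 * G.normSq Φ * G.g μ ν
    + 4 * (r * Φ μ ν) - G.box0 r * G.g μ ν + 4 * G.D1 μ (fun l => G.d l r) ν

section

variable {G} {Φ A : Fin 4 → Fin 4 → S} {r : S} {Q : Fin 4 → S} {J₁ J₂ : Ideal S}
variable (hsymm : ∀ a b, Φ a b = Φ b a) (htr : G.tr Φ = 0) (hmet : G.MetricEq Φ r Q)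
  (hDQ : ∀ k a, G.D1 k Q a ∈ J₁)

/-- This is the Schouten part of the Weyl tensor contracted with `Φ`; the last of the four terms is
a trace of `Φ`. -/
lemma contract_kulkarni (htr : G.tr Φ = 0)
    (X : Fin 4 → Fin 4 → S) (μ ν : Fin 4) :
    (G.tr fun l a => G.tr fun ρ b => (G.g μ ν * X l ρ - G.g μ ρ * X l ν
      - G.g l ν * X μ ρ + G.g l ρ * X μ ν) * Φ a b)
    = G.g μ ν * (G.tr fun l a => G.tr fun ρ b => X l ρ * Φ a b)
      - (G.tr fun l a => X l ν * Φ a μ) - G.tr fun ρ b => X μ ρ * Φ ν b := by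
  have e2 : (G.tr fun l a => G.tr fun ρ b => G.g μ ρ * X l ν * Φ a b)
      = G.tr fun l a => X l ν * Φ a μ := by
    refine tr_congr fun l a => ?_
    rw [← tr_g (G := G) μ fun b => X l ν * Φ a b]
    exact tr_congr fun ρ b => by rw [smul_eq_mul, mul_assoc]
  have e3 : (G.tr fun l a => G.tr fun ρ b => G.g l ν * X μ ρ * Φ a b)
      = G.tr fun ρ b => X μ ρ * Φ ν b := by
    rw [tr_comm]
    refine tr_congr fun ρ b => ?_
    rw [← tr_g (G := G) ν fun a => X μ ρ * Φ a b]
    exact tr_congr fun l a => by rw [smul_eq_mul, mul_assoc, G.g_symm]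
  have e4 : (G.tr fun l a => G.tr fun ρ b => G.g l ρ * X μ ν * Φ a b) = 0 := by
    have : ∀ l a, (G.tr fun ρ b => G.g l ρ * X μ ν * Φ a b) = X μ ν * Φ a l := fun l a => by
      rw [← tr_g (G := G) l fun b => X μ ν * Φ a b]
      exact tr_congr fun ρ b => by rw [smul_eq_mul, mul_assoc]
    rw [tr_congr this, tr_mul_left, tr_swap fun l a => Φ l a, htr, mul_zero]
  have e1 : (G.tr fun l a => G.tr fun ρ b => G.g μ ν * X l ρ * Φ a b)
      = G.g μ ν * (G.tr fun l a => G.tr fun ρ b => X l ρ * Φ a b) := by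
    simp only [mul_assoc, tr_mul_left]
  simp only [add_mul, sub_mul, tr_add, tr_sub, e1, e2, e3, e4, add_zero]

include hsymm htr hmet hDQ in
/-- The wave equation for `Φ` with the Weyl tensor eliminated. -/
lemma WaveEq.sub_waveRhs_mem (hwave : G.WaveEq Φ A r) (hA : ∀ a b, A a b ∈ J₁) (μ ν : Fin 4) :
    24 * G.boxT Φ μ ν - G.waveRhs Φ r μ ν ∈ J₁ := by
  -- The amount by which `24` times the Schouten tensor differs from `24 Φ + r g`: by the metric
  -- equation and its trace it is linear in `∇Q`.
  let e : Fin 4 → Fin 4 → S := fun a b =>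
    6 * (G.D1 a Q b + G.D1 b Q a) - 2 * (G.tr fun m μ => G.D1 m Q μ) * G.g a b
  have he : ∀ a b, e a b ∈ J₁ := fun a b =>
    J₁.sub_mem (J₁.mul_mem_left _ (J₁.add_mem (hDQ a b) (hDQ b a)))
      (J₁.mul_mem_right _ (J₁.mul_mem_left _ (tr_mem fun m μ => hDQ m μ)))
  have h6 : 6 * algebraMap ℝ S (1 / 6) = 1 := by
    have : (6 : S) = algebraMap ℝ S 6 := (map_ofNat _ _).symm
    rw [this, ← map_mul]; norm_num
  have hX : ∀ a b, 24 * G.schouten a b = 24 * Φ a b + r * G.g a b + e a b := by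
    intro a b
    have h1 := hmet a b
    have h2 := hmet.Rs_eq htr
    simp only [schouten, e]
    linear_combination 12 * (G.Ric a b - algebraMap ℝ S (1 / 6) * G.Rs * G.g a b)
      * two_mul_half (S := S) - 2 * G.Rs * G.g a b * h6 + 3 * h1 - 2 * G.g a b * h2
  have hXf : ∀ (a b : Fin 4) (f : S), 24 * (G.schouten a b * f) = 24 * (Φ a b * f)
      + r * (G.g a b * f) + e a b * f := fun a b f => by
    linear_combination f * hX a b
  have k0 : (G.tr fun l a => G.tr fun ρ b => G.weyl μ l ν ρ * Φ a b)
      = (G.tr fun m a => G.tr fun σ τ => G.RL σ ν m μ * Φ a τ)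
       - (G.g μ ν * (G.tr fun l a => G.tr fun ρ b => G.schouten l ρ * Φ a b)
      - (G.tr fun l a => G.schouten l ν * Φ a μ) - G.tr fun ρ b => G.schouten μ ρ * Φ ν b) := by
    rw [← contract_kulkarni htr, ← tr_sub]
    refine tr_congr fun l a => ?_
    rw [← tr_sub]
    refine tr_congr fun ρ b => ?_
    have : G.RL μ l ν ρ = G.RL ρ ν l μ := by
      rw [RL_pair, RL_antisymm_left, RL_antisymm_right, neg_neg]
    rw [weyl, this, sub_mul]
  have k1 : 24 * (G.tr fun l a => G.tr fun ρ b => G.schouten l ρ * Φ a b)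
      = 24 * G.normSq Φ + G.tr fun l a => G.tr fun ρ b => e l ρ * Φ a b := by
    have : (G.tr fun l a => G.tr fun ρ b => G.g l ρ * Φ a b) = 0 := by
      have h : ∀ l a, (G.tr fun ρ b => G.g l ρ * Φ a b) = Φ a l := fun l a =>
        tr_g (G := G) l fun b => Φ a b
      rw [tr_congr h, tr_swap fun l a => Φ l a, htr]
    simp only [← tr_mul_left, hXf, tr_add]
    rw [normSq]
    simp only [tr_mul_left, this]
    ring
  have k2 : 24 * (G.tr fun l a => G.schouten l ν * Φ a μ)
      = 24 * (G.tr fun l ρ => Φ μ ρ * Φ ν l) + r * Φ μ ν + G.tr fun l a => e l ν * Φ a μ := by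
    have h1 : (G.tr fun l a => G.g l ν * Φ a μ) = Φ μ ν := by
      rw [hsymm μ, ← tr_g (G := G) ν fun a => Φ a μ]
      exact tr_congr fun l a => by rw [G.g_symm, smul_eq_mul]
    have h2 : (G.tr fun l ρ => Φ μ ρ * Φ ν l) = G.tr fun l a => Φ l ν * Φ a μ :=
      tr_congr fun l ρ => by rw [hsymm μ, hsymm ν, mul_comm]
    rw [h2, ← tr_mul_left]
    simp only [hXf, tr_add, tr_mul_left, h1]
  have k3 : 24 * (G.tr fun ρ b => G.schouten μ ρ * Φ ν b)
      = 24 * (G.tr fun l ρ => Φ μ ρ * Φ ν l) + r * Φ μ ν + G.tr fun ρ b => e μ ρ * Φ ν b := by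
    have h1 : (G.tr fun ρ b => G.g μ ρ * Φ ν b) = Φ μ ν := by
      rw [hsymm μ, ← tr_g (G := G) μ fun a => Φ ν a]
      rfl
    have h2 : (G.tr fun l ρ => Φ μ ρ * Φ ν l) = G.tr fun l ρ => Φ μ l * Φ ν ρ :=
      tr_swap fun l ρ => Φ μ l * Φ ν ρ
    rw [h2, ← tr_mul_left]
    simp only [hXf, tr_add, tr_mul_left, h1]
  have h := hwave μ ν
  -- The terms quadratic in `Φ` with two free indices cancel against those of the Schouten part, and
  -- the sign of the `normSq` term is reversed.
  have key : 24 * G.boxT Φ μ ν - G.waveRhs Φ r μ ν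
      = 2 * G.g μ ν * (G.tr fun l a => G.tr fun ρ b => e l ρ * Φ a b)
        - 2 * (G.tr fun l a => e l ν * Φ a μ) - 2 * (G.tr fun ρ b => e μ ρ * Φ ν b)
        - 24 * (∑ τ, A τ μ * ∑ ρ, G.gi τ ρ * Φ ρ ν)
        - 24 * (∑ τ, A τ ν * ∑ ρ, G.gi τ ρ * Φ μ ρ) := by
    rw [waveRhs]
    linear_combination h - 48 * k0 + 2 * G.g μ ν * k1 - 2 * k2 - 2 * k3
  rw [key]
  refine J₁.sub_mem (J₁.sub_mem (J₁.sub_mem (J₁.sub_mem ?_ ?_) ?_) ?_) ?_ <;>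
    refine J₁.mul_mem_left _ ?_
  · exact tr_mem fun _ _ => tr_mem fun _ _ => J₁.mul_mem_right _ (he _ _)
  · exact tr_mem fun _ _ => J₁.mul_mem_right _ (he _ _)
  · exact tr_mem fun _ _ => J₁.mul_mem_right _ (he _ _)
  · exact J₁.sum_mem fun _ _ => J₁.mul_mem_right _ (hA _ _)
  · exact J₁.sum_mem fun _ _ => J₁.mul_mem_right _ (hA _ _)

end

/-! ### The wave equation for the divergence defect -/

section

variable {G} {Φ A : Fin 4 → Fin 4 → S} {r : S} {Q : Fin 4 → S} {J₁ J₂ : Ideal S}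

lemma d_normSq (hsymm : ∀ a b, Φ a b = Φ b a) (ν : Fin 4) : G.d ν (G.normSq Φ)
    = 2 * G.tr fun m μ => G.tr fun σ τ => G.D2 ν Φ m σ * Φ μ τ := by
  have h1 : G.normSq Φ = G.tr fun l μ => G.tr fun σ τ => Φ l σ * Φ τ μ :=
    tr_congr fun l μ => tr_congr fun σ τ => by rw [hsymm τ]
  have h2 : G.d ν (G.normSq Φ) = G.tr fun l μ =>
      G.D2 ν (fun l μ => G.tr fun σ τ => Φ l σ * Φ τ μ) l μ := by
    rw [h1]; exact cov_tr G.isConn_d ν _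
  have h3 : (G.tr fun l μ => G.tr fun σ τ => G.D2 ν Φ l σ * Φ τ μ)
      = G.tr fun m μ => G.tr fun σ τ => G.D2 ν Φ m σ * Φ μ τ :=
    tr_congr fun l μ => tr_congr fun σ τ => by rw [hsymm τ]
  have h4 : (G.tr fun l μ => G.tr fun σ τ => Φ l σ * G.D2 ν Φ τ μ)
      = G.tr fun m μ => G.tr fun σ τ => G.D2 ν Φ m σ * Φ μ τ := by
    rw [← tr_swap]
    refine tr_congr fun l μ => ?_
    rw [← tr_swap]
    exact tr_congr fun σ τ => by rw [G.D2_symm Φ hsymm ν σ l, mul_comm]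
  rw [h2, tr_congr fun l μ => G.D2_contract_22 Φ Φ ν l μ, tr_add, h3, h4]
  ring

/-- The curvature term is differentiated by the same Leibniz and Bianchi steps as in `div2_boxT'`,
so that the two results can be compared term by term. -/
lemma div2_waveRhs (hsymm : ∀ a b, Φ a b = Φ b a) (ν : Fin 4) :
    G.div2 (G.waveRhs Φ r) ν
      = -48 * (- (G.tr fun m μ => G.tr fun σ τ =>
            (G.D2 σ G.Ric m ν - G.D2 ν G.Ric m σ) * Φ μ τ)
          + G.tr fun k l => G.tr fun m μ => G.tr fun ρ σ => G.RL ρ ν m l * G.D2 k Φ μ σ)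
        + 48 * (G.tr fun m μ => G.tr fun σ τ => G.D2 ν Φ m σ * Φ μ τ)
        + 4 * ((G.tr fun σ τ => G.d σ r * Φ τ ν) + r * G.div2 Φ ν)
        - G.d ν (G.box0 r) + 4 * G.box1 (fun l => G.d l r) ν := by
  let H : Fin 4 → Fin 4 → S := fun l ν =>
    G.tr fun m μ => G.tr fun σ τ => G.RL σ ν m l * Φ μ τ
  have h0 : G.waveRhs Φ r = (-48 : S) • H + (24 : S) • G.normSq Φ • G.g + (4 : S) • r • Φ
      - G.box0 r • G.g + (4 : S) • fun l => G.D1 l fun l => G.d l r := by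
    funext μ ν
    simp only [waveRhs, Pi.add_apply, Pi.sub_apply, Pi.smul_apply, smul_eq_mul, H]
    ring
  have d48 : ∀ k, G.d k (-48 : S) = 0 := fun k => by
    have : G.d k (48 : S) = 0 := G.d_ofNat k 48
    rw [map_neg, this, neg_zero]
  have d24 : ∀ k, G.d k (24 : S) = 0 := fun k => G.d_ofNat k 24
  have d4 : ∀ k, G.d k (4 : S) = 0 := fun k => G.d_ofNat k 4
  have h1 : ∀ k a b, G.D2 k (G.waveRhs Φ r) a b = -48 * G.D2 k H a b
      + 24 * (G.d k (G.normSq Φ) * G.g a b) + 4 * (G.d k r * Φ a b + r * G.D2 k Φ a b)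
      - G.d k (G.box0 r) * G.g a b + 4 * G.D2 k (fun l => G.D1 l fun l => G.d l r) a b := by
    intro k a b
    rw [h0]
    simp only [G.isConn_D2.add, G.isConn_D2.sub, G.isConn_D2.smul, D2_g, Pi.add_apply,
      Pi.sub_apply, Pi.smul_apply, smul_eq_mul, Pi.zero_apply, mul_zero, add_zero, d48, d24, d4,
      zero_mul, zero_add]
  have h2 : (G.tr fun k l => G.D2 k H l ν)
      = - (G.tr fun m μ => G.tr fun σ τ => (G.D2 σ G.Ric m ν - G.D2 ν G.Ric m σ) * Φ μ τ)
          + G.tr fun k l => G.tr fun m μ => G.tr fun ρ σ => G.RL ρ ν m l * G.D2 k Φ μ σ := by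
    rw [tr_congr fun k l => G.D2_contract_42 G.RL Φ k l ν, tr_add, div_RL_contract]
  rw [div2, tr_congr fun k a => h1 k a ν]
  simp only [tr_add, tr_sub, tr_mul_left, tr_mul_g, h2, d_normSq hsymm]
  rw [box1, div2]
  ring

variable (hsymm : ∀ a b, Φ a b = Φ b a) (htr : G.tr Φ = 0) (hmet : G.MetricEq Φ r Q)
  (h12 : J₁ ≤ J₂) (hd : ∀ k, ∀ f ∈ J₁, G.d k f ∈ J₂)
  (hDQ : ∀ k a, G.D1 k Q a ∈ J₁) (hY : ∀ a, G.divDefect Φ r a ∈ J₁)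

include hsymm htr hmet h12 hd hDQ hY in
/-- The wave operator on the divergence defect involves the gauge quantities only. -/
theorem box1_divDefect_mem (hwave : G.WaveEq Φ A r) (hA : ∀ a b, A a b ∈ J₁) (ν : Fin 4) :
    G.box1 (G.divDefect Φ r) ν ∈ J₂ := by
  have hE := fun μ ν => hwave.sub_waveRhs_mem hsymm htr hmet hDQ hA μ ν
  have hDD : ∀ k a b, G.D2 k (fun l => G.D1 l Q) a b ∈ J₂ := D2_mem h12 hd hDQ
  set X := G.tr fun m μ => G.tr fun σ τ => G.D2 ν Φ m σ * Φ μ τ with hX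
  set P := G.tr fun σ τ => G.d σ r * Φ τ ν with hP
  set W := G.tr fun k l => G.tr fun σ τ => Φ l σ * G.D2 k Φ τ ν with hW
  set T := G.tr fun k l => G.tr fun m μ => G.tr fun ρ σ => G.RL ρ ν m l * G.D2 k Φ μ σ with hT
  set a1 := G.tr fun σ τ => G.div2 G.Ric σ * Φ τ ν with ha1
  set a2 := G.tr fun k l => G.tr fun σ τ => G.Ric l σ * G.D2 k Φ τ ν with ha2
  set a4 := G.tr fun m μ => G.tr fun σ τ =>
    (G.D2 σ G.Ric m ν - G.D2 ν G.Ric m σ) * Φ μ τ with ha4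
  -- The divergence of a tensor with entries in `J₁` lies in `J₂`. The facts `m1` to `m5` then
  -- replace Ricci by `Φ` and `r`, modulo gauge quantities.
  have m0 : 24 * G.div2 (G.boxT Φ) ν - G.div2 (G.waveRhs Φ r) ν ∈ J₂ := by
    have h1 : 24 * G.div2 (G.boxT Φ) ν - G.div2 (G.waveRhs Φ r) ν
        = G.tr fun m μ => G.D2 m (fun μ ν => 24 * G.boxT Φ μ ν - G.waveRhs Φ r μ ν) μ ν := by
      rw [div2, div2, ← tr_mul_left, ← tr_sub]
      refine tr_congr fun m μ => ?_
      have h2 : (fun μ ν => 24 * G.boxT Φ μ ν - G.waveRhs Φ r μ ν)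
          = (24 : S) • G.boxT Φ - G.waveRhs Φ r := rfl
      have d24 : G.d m (24 : S) = 0 := G.d_ofNat m 24
      rw [h2, G.isConn_D2.sub, G.isConn_D2.smul, d24]
      simp
    rw [h1]
    exact tr_mem fun m μ => D2_mem h12 hd hE m μ ν
  have e0 := G.div2_boxT' Φ ν
  have e1 := div2_waveRhs (G := G) (r := r) hsymm ν
  have m1 : 2 * a1 - P ∈ J₂ := by
    have h1 : 2 * a1 - P = G.tr fun σ τ => G.d σ (G.tr fun m μ => G.D1 m Q μ) * Φ τ ν := by
      rw [ha1, hP, ← tr_mul_left, ← tr_sub]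
      refine tr_congr fun σ τ => ?_
      have h2 := G.two_div_Ric σ
      rw [hmet.Rs_eq htr, map_add] at h2
      unfold div2
      linear_combination (Φ τ ν) * h2
    rw [h1]
    exact tr_mem fun σ τ => J₂.mul_mem_right _ (hd σ _ (tr_mem fun m μ => hDQ m μ))
  have m2 : 4 * a2 - 8 * W - r * G.div2 Φ ν ∈ J₂ := by
    have h1 : G.div2 Φ ν = G.tr fun k l => G.tr fun σ τ => G.g l σ * G.D2 k Φ τ ν :=
      tr_congr fun k l => (tr_g (G := G) l fun τ => G.D2 k Φ τ ν).symm
    have h2 : 4 * a2 - 8 * W - r * G.div2 Φ ν = G.tr fun k l => G.tr fun σ τ =>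
        2 * (G.D1 l Q σ + G.D1 σ Q l) * G.D2 k Φ τ ν := by
      rw [h1, ha2, hW]
      simp only [← tr_mul_left, ← tr_sub]
      refine tr_congr fun k l => tr_congr fun σ τ => ?_
      linear_combination (G.D2 k Φ τ ν) * hmet l σ
    rw [h2]
    exact tr_mem fun k l => tr_mem fun σ τ => J₂.mul_mem_right _ (J₂.mul_mem_left _
      (J₂.add_mem (h12 (hDQ l σ)) (h12 (hDQ σ l))))
  have m4 : 4 * a4 - 8 * W - P + 8 * X ∈ J₂ := by
    have hW' : W = G.tr fun m μ => G.tr fun σ τ => G.D2 σ Φ m ν * Φ μ τ := by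
      rw [tr_comm, hW]
      refine tr_congr fun σ τ => ?_
      rw [← tr_swap]
      exact tr_congr fun m μ => by rw [hsymm τ μ, mul_comm]
    have hP' : P = G.tr fun m μ => G.tr fun σ τ => G.d σ r * G.g m ν * Φ μ τ := by
      rw [tr_comm, hP]
      refine tr_congr fun σ τ => ?_
      rw [hsymm τ ν, ← tr_g (G := G) ν fun μ => Φ μ τ, ← tr_mul_left]
      exact tr_congr fun m μ => by rw [smul_eq_mul, G.g_symm ν m, mul_assoc]
    -- The second gradient of `r` in the antisymmetrised derivative of Ricci meets the trace of `Φ`,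
    -- and can be added for free.
    have h0 : (G.tr fun m μ => G.tr fun σ τ => G.d ν r * G.g m σ * Φ μ τ) = 0 := by
      have h : ∀ m μ, (G.tr fun σ τ => G.d ν r * G.g m σ * Φ μ τ) = G.d ν r * Φ μ m := by
        intro m μ
        rw [← tr_g (G := G) m fun τ => Φ μ τ, ← tr_mul_left]
        exact tr_congr fun σ τ => by rw [smul_eq_mul, mul_assoc]
      rw [tr_congr h, tr_mul_left, tr_swap fun m μ => Φ m μ, htr, mul_zero]
    let z : Fin 4 → Fin 4 → Fin 4 → S := fun k a b =>
      2 * (G.D2 k (fun l => G.D1 l Q) a b + G.D2 k (fun l => G.D1 l Q) b a)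
    have hz : ∀ k a b, z k a b ∈ J₂ := fun k a b =>
      J₂.mul_mem_left _ (J₂.add_mem (hDD k a b) (hDD k b a))
    have h1 : 4 * a4 - 8 * W - P + 8 * X + (G.tr fun m μ => G.tr fun σ τ =>
          G.d ν r * G.g m σ * Φ μ τ)
        = G.tr fun m μ => G.tr fun σ τ => (z σ m ν - z ν m σ) * Φ μ τ := by
      rw [ha4, hW', hP', hX]
      simp only [← tr_mul_left, ← tr_sub, ← tr_add]
      refine tr_congr fun m μ => tr_congr fun σ τ => ?_
      simp only [z]
      linear_combination (Φ μ τ) * hmet.D2_Ric σ m ν - (Φ μ τ) * hmet.D2_Ric ν m σ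
    rw [h0, add_zero] at h1
    rw [h1]
    exact tr_mem fun m μ => tr_mem fun σ τ => J₂.mul_mem_right _ (J₂.sub_mem (hz _ _ _) (hz _ _ _))
  have m5 : 4 * (G.tr fun ρ σ => G.Ric ρ ν * G.d σ r) - 8 * P - r * G.d ν r ∈ J₂ := by
    have h1 : G.d ν r = G.tr fun ρ σ => G.g ρ ν * G.d σ r := by
      conv_lhs => rw [← tr_g (G := G) ν fun σ => G.d σ r]
      exact tr_congr fun ρ σ => by rw [G.g_symm, smul_eq_mul]
    have h1' : P = G.tr fun ρ σ => Φ ρ ν * G.d σ r := by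
      rw [hP, ← tr_swap]
      exact tr_congr fun ρ σ => mul_comm _ _
    have h2 : 4 * (G.tr fun ρ σ => G.Ric ρ ν * G.d σ r) - 8 * P - r * G.d ν r
        = G.tr fun ρ σ => 2 * (G.D1 ρ Q ν + G.D1 ν Q ρ) * G.d σ r := by
      conv_lhs => rw [h1, h1']
      simp only [← tr_mul_left, ← tr_sub]
      refine tr_congr fun ρ σ => ?_
      linear_combination (G.d σ r) * hmet ρ ν
    rw [h2]
    exact tr_mem fun ρ σ => J₂.mul_mem_right _ (J₂.mul_mem_left _
      (J₂.add_mem (h12 (hDQ ρ ν)) (h12 (hDQ ν ρ))))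
  have m6 : G.divDefect Φ r ν ∈ J₂ := h12 (hY ν)
  have e2 := G.box1_grad r ν
  have e3 : G.box1 (G.divDefect Φ r) ν
      = 8 * G.box1 (G.div2 Φ) ν - G.box1 (fun l => G.d l r) ν := by
    have h0 : ∀ l, G.D1 l (G.divDefect Φ r)
        = (8 : S) • G.D1 l (G.div2 Φ) - G.D1 l (fun l => G.d l r) := by
      intro l
      have h1 : G.divDefect Φ r = (8 : S) • G.div2 Φ - fun l => G.d l r := rfl
      have d8 : G.d l (8 : S) = 0 := G.d_ofNat l 8
      rw [h1, G.isConn_D1.sub, G.isConn_D1.smul, d8, zero_smul, zero_add]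
    rw [box1, box1, box1, ← tr_mul_left, ← tr_sub]
    refine tr_congr fun k l => ?_
    have h1 : (fun l => G.D1 l (G.divDefect Φ r))
        = (8 : S) • (fun l => G.D1 l (G.div2 Φ)) - fun l => G.D1 l (fun l => G.d l r) := by
      funext l; exact h0 l
    have d8 : G.d k (8 : S) = 0 := G.d_ofNat k 8
    rw [h1, G.isConn_D2.sub, G.isConn_D2.smul, d8]
    simp
  refine natCast_mul_mem 12 (by norm_num) ?_
  -- Everything not controlled by the gauge quantities cancels here. In particular the term `T`,
  -- curvature times `∇Φ`, enters `24 ∇·□Φ` and the divergence of `waveRhs` with the same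
  -- coefficient `-48`.
  have key : ((12 : ℕ) : S) * G.box1 (G.divDefect Φ r) ν
      = 4 * (24 * G.div2 (G.boxT Φ) ν - G.div2 (G.waveRhs Φ r) ν)
        + 24 * (4 * a4 - 8 * W - P + 8 * X) - 48 * (2 * a1 - P)
        - 24 * (4 * a2 - 8 * W - r * G.div2 Φ ν)
        + (4 * (G.tr fun ρ σ => G.Ric ρ ν * G.d σ r) - 8 * P - r * G.d ν r)
        - r * G.divDefect Φ r ν := by
    rw [e3]
    rw [divDefect]
    unfold box0 at e1
    push_cast
    linear_combination (-96) * e0 + 4 * e1 + 4 * e2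
  rw [key]
  exact J₂.sub_mem (J₂.add_mem (J₂.sub_mem (J₂.sub_mem (J₂.add_mem (J₂.mul_mem_left _ m0)
    (J₂.mul_mem_left _ m4)) (J₂.mul_mem_left _ m1)) (J₂.mul_mem_left _ m2)) m5)
    (J₂.mul_mem_left _ m6)

end

end MetricAlgebra
end AdSGauge

/-! ### One-sided derivatives and the energy method at a corner -/

namespace AdSGauge

/-! ### Partial derivatives of smooth functions -/

section pd

variable {V : Set Pt} {f f' : Scalar} {x : Pt}

lemma differentiableAt_of_contDiffOn (hV : IsOpen V) (hf : ContDiffOn ℝ ∞ f V) (hx : x ∈ V) :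
    DifferentiableAt ℝ f x :=
  (hf.contDiffAt (hV.mem_nhds hx)).differentiableAt (by simp)

lemma contDiffOn_pd (hV : IsOpen V) (hf : ContDiffOn ℝ ∞ f V) (i : Fin 4) :
    ContDiffOn ℝ ∞ (pd i f) V :=
  (hf.fderiv_of_isOpen hV (by simp)).clm_apply contDiffOn_const

lemma pd_add (hV : IsOpen V) (hf : ContDiffOn ℝ ∞ f V) (hf' : ContDiffOn ℝ ∞ f' V) (hx : x ∈ V)
    (i : Fin 4) : pd i (fun y => f y + f' y) x = pd i f x + pd i f' x := by
  simp only [pd]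
  rw [fderiv_fun_add (differentiableAt_of_contDiffOn hV hf hx)
    (differentiableAt_of_contDiffOn hV hf' hx)]
  rfl

lemma pd_mul (hV : IsOpen V) (hf : ContDiffOn ℝ ∞ f V) (hf' : ContDiffOn ℝ ∞ f' V) (hx : x ∈ V)
    (i : Fin 4) : pd i (fun y => f y * f' y) x = f x * pd i f' x + f' x * pd i f x := by
  simp only [pd]
  rw [fderiv_fun_mul (differentiableAt_of_contDiffOn hV hf hx)
    (differentiableAt_of_contDiffOn hV hf' hx)]
  rfl

lemma pd_const (c : ℝ) (i : Fin 4) : pd i (fun _ => c) x = 0 := by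
  simp [pd]

lemma pd_sum {α : Type*} (s : Finset α) {F : α → Scalar} (hV : IsOpen V)
    (hF : ∀ a ∈ s, ContDiffOn ℝ ∞ (F a) V) (hx : x ∈ V) (i : Fin 4) :
    pd i (fun y => ∑ a ∈ s, F a y) x = ∑ a ∈ s, pd i (F a) x := by
  simp only [pd]
  rw [fderiv_fun_sum fun a ha => differentiableAt_of_contDiffOn hV (hF a ha) hx]
  simp

lemma pd_comm (hV : IsOpen V) (hf : ContDiffOn ℝ ∞ f V) (hx : x ∈ V) (i j : Fin 4) :
    pd i (pd j f) x = pd j (pd i f) x := by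
  have hd : DifferentiableAt ℝ (fderiv ℝ f) x :=
    ((hf.fderiv_of_isOpen hV (m := ∞) (by simp)).contDiffAt (hV.mem_nhds hx)).differentiableAt
      (by simp)
  have key : ∀ i j, pd i (pd j f) x
      = fderiv ℝ (fderiv ℝ f) x (Pi.single i 1) (Pi.single j 1) := by
    intro i j
    have : pd j f = fun y => fderiv ℝ f y (Pi.single j 1) := rfl
    rw [this, pd, fderiv_clm_apply hd (differentiableAt_const _)]
    simp
  rw [key, key]
  have hs := (hf.contDiffAt (hV.mem_nhds hx)).isSymmSndFDerivAt
    (by simpa using ENat.LEInfty.out)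
  exact hs _ _

/-- A differentiable function vanishing along a one-sided coordinate segment has vanishing
partial derivative. -/
lemma pd_eq_zero_of_segment (hf : DifferentiableAt ℝ f x) (i : Fin 4)
    (h : ∀ᶠ t in nhdsWithin (0 : ℝ) (Set.Ici 0), f (x + t • Pi.single i 1) = 0) :
    pd i f x = 0 := by
  have h1 : HasDerivAt (fun t : ℝ => x + t • (Pi.single i 1 : Pt)) (Pi.single i 1) 0 := by
    simpa using ((hasDerivAt_id (0 : ℝ)).smul_const (Pi.single i 1 : Pt)).const_add x
  have h2 : HasDerivAt (fun t : ℝ => f (x + t • (Pi.single i 1 : Pt))) (pd i f x) 0 := by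
    have h3 : HasFDerivAt f (fderiv ℝ f x) (x + (0 : ℝ) • (Pi.single i 1 : Pt)) := by
      simpa using hf.hasFDerivAt
    exact h3.comp_hasDerivAt (0 : ℝ) h1
  have h4 : HasDerivWithinAt (fun t : ℝ => f (x + t • (Pi.single i 1 : Pt))) 0 (Set.Ici 0) 0 := by
    refine (hasDerivWithinAt_const (0 : ℝ) (Set.Ici 0) (0 : ℝ)).congr_of_eventuallyEq h ?_
    exact h.self_of_nhdsWithin (Set.mem_Ici.mpr le_rfl)
  exact (uniqueDiffOn_Ici (0 : ℝ) 0 Set.self_mem_Ici).eq_deriv _ h2.hasDerivWithinAt h4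

/-- If `f` vanishes on a set stable under small positive translations in the direction `i`, so does
`∂_i f`. -/
lemma pd_eq_zero_of_eqOn (hV : IsOpen V) (hf : ContDiffOn ℝ ∞ f V) (hx : x ∈ V) (i : Fin 4)
    {P : Pt → Prop} (hP : ∀ t : ℝ, 0 ≤ t → P (x + t • Pi.single i 1))
    (h : ∀ y ∈ V, P y → f y = 0) : pd i f x = 0 := by
  refine pd_eq_zero_of_segment (differentiableAt_of_contDiffOn hV hf hx) i ?_
  have hc : Filter.Tendsto (fun t : ℝ => x + t • (Pi.single i 1 : Pt))
      (nhdsWithin 0 (Set.Ici 0)) (nhds x) := by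
    have : Continuous fun t : ℝ => x + t • (Pi.single i 1 : Pt) := by fun_prop
    have h0 := this.tendsto 0
    simp only [zero_smul, add_zero] at h0
    exact h0.mono_left nhdsWithin_le_nhds
  filter_upwards [hc (hV.mem_nhds hx), self_mem_nhdsWithin] with t ht ht0
  exact h _ ht (hP t ht0)

end pd

/-! ### Energy estimate -/

open Asymptotics Filter MeasureTheory

/-- The quadrant `x⁰ ≥ 0`, `x¹ ≥ 0`. -/
def quadrant : Set Pt := {x | 0 ≤ x 0 ∧ 0 ≤ x 1}

lemma isClosed_quadrant : IsClosed quadrant :=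
  (isClosed_le continuous_const (continuous_apply 0)).inter
    (isClosed_le continuous_const (continuous_apply 1))

/-- The square makes the cutoff differentiable at the edge of its support, as the divergence theorem
on a box needs. -/
lemma hasDerivAt_sq_posPart (t : ℝ) : HasDerivAt (fun s : ℝ => (max s 0) ^ 2) (2 * max t 0) t := by
  rcases lt_trichotomy t 0 with ht | rfl | ht
  · rw [max_eq_right ht.le]
    have : (fun s : ℝ => (max s 0) ^ 2) =ᶠ[nhds t] fun _ => 0 := by
      filter_upwards [gt_mem_nhds ht] with s hs
      rw [max_eq_right hs.le]; simp
    simpa using (hasDerivAt_const t (0 : ℝ)).congr_of_eventuallyEq this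
  · rw [hasDerivAt_iff_isLittleO_nhds_zero]
    simp only [zero_add, max_self, mul_zero, smul_zero, sub_zero, ne_eq, OfNat.ofNat_ne_zero,
      not_false_eq_true, zero_pow]
    have h1 : (fun h : ℝ => max h 0 ^ 2) =O[nhds 0] fun h : ℝ => h ^ 2 := by
      refine IsBigO.of_bound 1 (Eventually.of_forall fun h => ?_)
      rw [one_mul, norm_pow, norm_pow]
      refine pow_le_pow_left₀ (norm_nonneg _) ?_ 2
      rw [Real.norm_eq_abs, Real.norm_eq_abs, abs_of_nonneg (le_max_right _ _)]
      exact max_le (le_abs_self h) (abs_nonneg h)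
    exact h1.trans_isLittleO (isLittleO_pow_id one_lt_two)
  · rw [max_eq_left ht.le]
    have : (fun s : ℝ => (max s 0) ^ 2) =ᶠ[nhds t] fun s => s ^ 2 := by
      filter_upwards [lt_mem_nhds ht] with s hs
      rw [max_eq_left hs.le]
    simpa using (hasDerivAt_pow 2 t).congr_of_eventuallyEq this

lemma sq_sum_le_four (ξ : Fin 4 → ℝ) : (∑ a, |ξ a|) ^ 2 ≤ 4 * ∑ a, ξ a ^ 2 := by
  have := sq_sum_le_card_mul_sum_sq (s := Finset.univ) (f := fun a => |ξ a|)
  simpa using this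

/-- A quadratic form which is positive definite at a point is so uniformly near that point. -/
lemma exists_uniform_posDef {p : Pt} (m : Fin 4 → Fin 4 → Scalar)
    (hm : ∀ a b, ContinuousAt (m a b) p)
    (hpos : ∀ ξ : Fin 4 → ℝ, ξ ≠ 0 → 0 < ∑ a, ∑ b, m a b p * ξ a * ξ b) :
    ∃ c > 0, ∀ᶠ x in nhds p, ∀ ξ : Fin 4 → ℝ,
      c * ∑ a, ξ a ^ 2 ≤ ∑ a, ∑ b, m a b x * ξ a * ξ b := by
  let T : Set (Fin 4 → ℝ) := Metric.sphere 0 1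
  have hT : IsCompact T := isCompact_sphere 0 1
  have hne : T.Nonempty := NormedSpace.sphere_nonempty.mpr zero_le_one
  obtain ⟨ξ₀, hξ₀, hmin⟩ := hT.exists_isMinOn (f := fun ξ => ∑ a, ∑ b, m a b p * ξ a * ξ b) hne
    (Continuous.continuousOn (by fun_prop))
  set c := ∑ a, ∑ b, m a b p * ξ₀ a * ξ₀ b with hc
  have hc0 : 0 < c := hpos ξ₀ (by
    rintro rfl
    simp [T] at hξ₀)
  -- The unit sphere is that of the sup norm, so `∑ ξ² ≤ 4 ‖ξ‖²` and a factor 4 is lost.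
  have hp : ∀ ξ : Fin 4 → ℝ, c / 4 * ∑ a, ξ a ^ 2 ≤ ∑ a, ∑ b, m a b p * ξ a * ξ b := by
    intro ξ
    rcases eq_or_ne ξ 0 with rfl | hξ
    · simp
    have hn : 0 < ‖ξ‖ := norm_pos_iff.mpr hξ
    have h1 : (‖ξ‖⁻¹ • ξ) ∈ T := by
      simp [T, norm_smul, hn.ne']
    have h2 := hmin h1
    simp only [Set.mem_ofPred_eq, Pi.smul_apply, smul_eq_mul] at h2
    have h3 : ∑ a, ∑ b, m a b p * (‖ξ‖⁻¹ * ξ a) * (‖ξ‖⁻¹ * ξ b)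
        = (‖ξ‖ ^ 2)⁻¹ * ∑ a, ∑ b, m a b p * ξ a * ξ b := by
      simp only [Finset.mul_sum]
      refine Finset.sum_congr rfl fun a _ => Finset.sum_congr rfl fun b _ => ?_
      rw [← inv_pow]; ring
    rw [h3, ← hc] at h2
    have h4 : c * ‖ξ‖ ^ 2 ≤ ∑ a, ∑ b, m a b p * ξ a * ξ b := by
      rwa [inv_mul_eq_div, le_div_iff₀ (by positivity)] at h2
    have h5 : ∑ a, ξ a ^ 2 ≤ 4 * ‖ξ‖ ^ 2 := by
      have : ∀ a, ξ a ^ 2 ≤ ‖ξ‖ ^ 2 := fun a => by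
        rw [← sq_abs]
        exact pow_le_pow_left₀ (abs_nonneg _) (norm_le_pi_norm ξ a) 2
      calc ∑ a, ξ a ^ 2 ≤ ∑ _a : Fin 4, ‖ξ‖ ^ 2 := Finset.sum_le_sum fun a _ => this a
        _ = 4 * ‖ξ‖ ^ 2 := by simp
    calc c / 4 * ∑ a, ξ a ^ 2 ≤ c / 4 * (4 * ‖ξ‖ ^ 2) := by gcongr
      _ = c * ‖ξ‖ ^ 2 := by ring
      _ ≤ _ := h4
  refine ⟨c / 8, by positivity, ?_⟩
  -- An error `c / 32` in each entry changes the form by at most `c / 8 * ∑ ξ²`, half of the bound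
  -- at `p`.
  have hev : ∀ᶠ x in nhds p, ∀ a b, |m a b x - m a b p| < c / 32 := by
    rw [eventually_all]; intro a
    rw [eventually_all]; intro b
    have := (hm a b).eventually (Metric.ball_mem_nhds (m a b p) (show 0 < c / 32 by positivity))
    filter_upwards [this] with x hx
    rwa [Real.dist_eq] at hx
  filter_upwards [hev] with x hx ξ
  have h1 : |∑ a, ∑ b, (m a b p - m a b x) * ξ a * ξ b| ≤ c / 32 * (4 * ∑ a, ξ a ^ 2) := by
    calc |∑ a, ∑ b, (m a b p - m a b x) * ξ a * ξ b|
        ≤ ∑ a, ∑ b, |(m a b p - m a b x) * ξ a * ξ b| :=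
          (Finset.abs_sum_le_sum_abs _ _).trans
            (Finset.sum_le_sum fun a _ => Finset.abs_sum_le_sum_abs _ _)
      _ ≤ ∑ a, ∑ b, c / 32 * (|ξ a| * |ξ b|) := by
          refine Finset.sum_le_sum fun a _ => Finset.sum_le_sum fun b _ => ?_
          rw [abs_mul, abs_mul, mul_assoc, abs_sub_comm]
          exact mul_le_mul_of_nonneg_right (hx a b).le (by positivity)
      _ = c / 32 * (∑ a, |ξ a|) ^ 2 := by
          rw [sq, Finset.sum_mul_sum, Finset.mul_sum]
          simp only [Finset.mul_sum]
      _ ≤ c / 32 * (4 * ∑ a, ξ a ^ 2) := by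
          gcongr
          exact sq_sum_le_four ξ
  have h2 : ∑ a, ∑ b, m a b x * ξ a * ξ b = ∑ a, ∑ b, m a b p * ξ a * ξ b
      - ∑ a, ∑ b, (m a b p - m a b x) * ξ a * ξ b := by
    simp only [← Finset.sum_sub_distrib]
    exact Finset.sum_congr rfl fun a _ => Finset.sum_congr rfl fun b _ => by ring
  rw [h2]
  have h3 := (abs_le.mp h1).2
  have h4 := hp ξ
  linarith

end AdSGauge

namespace AdSGauge
open Asymptotics Filter MeasureTheory

/-! ### Energy current of a wave equation -/

/-- `h^{bc} ∂_c u`. -/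
def gradUp (h : Tensor2) (u : Scalar) (b : Fin 4) : Scalar := fun x => ∑ c, h b c x * pd c u x

/-- `h^{bc} ∂_b u ∂_c u`. -/
def gradSq (h : Tensor2) (u : Scalar) : Scalar := fun x => ∑ c, pd c u x * gradUp h u c x

/-- `h^{ab} ∂_a ∂_b u`. -/
def waveOp (h : Tensor2) (u : Scalar) : Scalar := fun x => ∑ a, ∑ b, h a b x * pd a (pd b u) x

/-- The energy current along `-h^{a0}`, with a zeroth order term. -/
def energyFlux (h : Tensor2) (u : Scalar) (a : Fin 4) : Scalar := fun x =>
  1 / 2 * (h a 0 x * gradSq h u x) - gradUp h u 0 x * gradUp h u a x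
    - (if a = 0 then 1 else 0) * (u x * u x)

def energyDensity (u : Scalar) : Scalar := fun x => u x ^ 2 + ∑ c, pd c u x ^ 2

/-- First order derivative terms `∂_a h^{bc} ∂_c u`. -/
def gradCoeff (h : Tensor2) (u : Scalar) (a b : Fin 4) : Scalar :=
  fun x => ∑ c, pd c u x * pd a (h b c) x

section

variable {V : Set Pt} {h : Tensor2} {u : Scalar} (hV : IsOpen V)
  (hh : ∀ a b, ContDiffOn ℝ ∞ (h a b) V) (hu : ContDiffOn ℝ ∞ u V)

include hV hh hu

lemma contDiffOn_gradUp (b : Fin 4) : ContDiffOn ℝ ∞ (gradUp h u b) V :=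
  ContDiffOn.sum fun c _ => (hh b c).mul (contDiffOn_pd hV hu c)

lemma contDiffOn_gradSq : ContDiffOn ℝ ∞ (gradSq h u) V :=
  ContDiffOn.sum fun c _ => (contDiffOn_pd hV hu c).mul (contDiffOn_gradUp hV hh hu c)

lemma contDiffOn_energyFlux (a : Fin 4) : ContDiffOn ℝ ∞ (energyFlux h u a) V :=
  ((contDiffOn_const.mul ((hh a 0).mul (contDiffOn_gradSq hV hh hu))).sub
    ((contDiffOn_gradUp hV hh hu 0).mul (contDiffOn_gradUp hV hh hu a))).sub
    (contDiffOn_const.mul (hu.mul hu))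

lemma pd_gradUp {x : Pt} (hx : x ∈ V) (a b : Fin 4) : pd a (gradUp h u b) x
    = ∑ c, h b c x * pd a (pd c u) x + gradCoeff h u a b x := by
  unfold gradUp gradCoeff
  rw [pd_sum _ hV (fun c _ => (hh b c).mul (contDiffOn_pd hV hu c)) hx, ← Finset.sum_add_distrib]
  exact Finset.sum_congr rfl fun c _ => pd_mul hV (hh b c) (contDiffOn_pd hV hu c) hx a

lemma pd_gradSq {x : Pt} (hx : x ∈ V) (hs : ∀ a b, h a b x = h b a x) (a : Fin 4) :
    pd a (gradSq h u) x = 2 * ∑ c, gradUp h u c x * pd a (pd c u) x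
      + ∑ c, pd c u x * gradCoeff h u a c x := by
  have h1 : pd a (gradSq h u) x = ∑ c, (pd c u x * pd a (gradUp h u c) x
      + gradUp h u c x * pd a (pd c u) x) := by
    unfold gradSq
    rw [pd_sum _ hV (fun c _ => (contDiffOn_pd hV hu c).mul (contDiffOn_gradUp hV hh hu c)) hx]
    exact Finset.sum_congr rfl fun c _ =>
      pd_mul hV (contDiffOn_pd hV hu c) (contDiffOn_gradUp hV hh hu c) hx a
  have h2 : ∑ c, pd c u x * ∑ e, h c e x * pd a (pd e u) x
      = ∑ c, gradUp h u c x * pd a (pd c u) x := by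
    simp only [gradUp, Finset.mul_sum, Finset.sum_mul]
    rw [Finset.sum_comm]
    refine Finset.sum_congr rfl fun c _ => Finset.sum_congr rfl fun e _ => ?_
    rw [hs e c]; ring
  rw [h1]
  simp only [pd_gradUp hV hh hu hx, mul_add, Finset.sum_add_distrib, h2]
  ring

/-- The divergence of the energy current. -/
lemma div_energyFlux {x : Pt} (hx : x ∈ V) (hs : ∀ a b, h a b x = h b a x) :
    ∑ a, pd a (energyFlux h u a) x = - (gradUp h u 0 x * waveOp h u x)
      + ∑ a, (1 / 2 * (h a 0 x * ∑ c, pd c u x * gradCoeff h u a c x)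
        + 1 / 2 * (gradSq h u x * pd a (h a 0) x)
        - gradUp h u 0 x * gradCoeff h u a a x - gradUp h u a x * gradCoeff h u a 0 x)
      - 2 * (u x * pd 0 u x) := by
  have h1 : ∀ a, pd a (energyFlux h u a) x
      = 1 / 2 * (h a 0 x * pd a (gradSq h u) x + gradSq h u x * pd a (h a 0) x)
        - (gradUp h u 0 x * pd a (gradUp h u a) x + gradUp h u a x * pd a (gradUp h u 0) x)
        - (if a = 0 then 1 else 0) * (2 * (u x * pd a u x)) := by
    intro a
    have s1 := (hh a 0).mul (contDiffOn_gradSq hV hh hu)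
    have s2 := (contDiffOn_gradUp hV hh hu 0).mul (contDiffOn_gradUp hV hh hu a)
    have s3 := hu.mul hu
    have e : energyFlux h u a = fun x => (1 / 2 * (h a 0 x * gradSq h u x)
      + (-1) * (gradUp h u 0 x * gradUp h u a x))
      + (-(if a = 0 then 1 else 0)) * (u x * u x) := by
      funext y; simp only [energyFlux]; ring
    rw [e, pd_add hV ((contDiffOn_const.mul s1).add (contDiffOn_const.mul s2))
      (contDiffOn_const.mul s3) hx,
      pd_add hV (contDiffOn_const.mul s1) (contDiffOn_const.mul s2) hx,
      pd_mul hV contDiffOn_const s1 hx, pd_mul hV contDiffOn_const s2 hx,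
      pd_mul hV contDiffOn_const s3 hx, pd_mul hV (hh a 0) (contDiffOn_gradSq hV hh hu) hx,
      pd_mul hV (contDiffOn_gradUp hV hh hu 0) (contDiffOn_gradUp hV hh hu a) hx,
      pd_mul hV hu hu hx]
    simp only [pd_const]
    ring
  -- By symmetry of `h` and of second derivatives, the two contributions with `∂∂u` outside the wave
  -- operator are equal and cancel.
  have h2 : ∑ a, h a 0 x * ∑ c, gradUp h u c x * pd a (pd c u) x
      = ∑ a, gradUp h u a x * ∑ c, h 0 c x * pd a (pd c u) x := by
    simp only [Finset.mul_sum]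
    rw [Finset.sum_comm]
    refine Finset.sum_congr rfl fun a _ => Finset.sum_congr rfl fun c _ => ?_
    rw [hs c 0, pd_comm hV hu hx c a]; ring
  have h3 : ∑ a, ((if a = 0 then 1 else 0) * (2 * (u x * pd a u x)) : ℝ)
      = 2 * (u x * pd 0 u x) := by simp
  simp only [h1, pd_gradSq hV hh hu hx hs, pd_gradUp hV hh hu hx, Finset.sum_sub_distrib,
    Finset.sum_add_distrib, mul_add, h3, waveOp, Finset.mul_sum] at h2 ⊢
  have h4 : ∑ a, ∑ c, (1 / 2 : ℝ) * (h a 0 x * (2 * (gradUp h u c x * pd a (pd c u) x)))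
      = ∑ a, ∑ c, h a 0 x * (gradUp h u c x * pd a (pd c u) x) :=
    Finset.sum_congr rfl fun a _ => Finset.sum_congr rfl fun c _ => by ring
  rw [h4, h2]
  ring

omit hh in
-- The current is quadratic in the first jet of `u`, and its divergence contains second derivatives
-- only through `waveOp`. The smooth coefficients are bounded on the compact set.
lemma energyFlux_isBigO {K : Set Pt} (hK : IsCompact K) (hKV : K ⊆ V) {N : Scalar}
    (hh : ∀ a b, ContDiffOn ℝ ∞ (h a b) V)
    (hs : ∀ x ∈ K, ∀ a b, h a b x = h b a x)
    (h0 : u =O[𝓟 K] N) (h1 : ∀ c, pd c u =O[𝓟 K] N) (hw : waveOp h u =O[𝓟 K] N) :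
    (∀ a, energyFlux h u a =O[𝓟 K] fun x => N x * N x) ∧
      (fun x => ∑ a, pd a (energyFlux h u a) x) =O[𝓟 K] fun x => N x * N x := by
  have one : ∀ {f : Scalar}, ContDiffOn ℝ ∞ f V → f =O[𝓟 K] fun _ => (1 : ℝ) := fun hf =>
    (hf.continuousOn.mono hKV).isBigO_principal hK (by simp)
  have cm : ∀ {f f' M : Scalar}, ContDiffOn ℝ ∞ f V → f' =O[𝓟 K] M →
      (fun x => f x * f' x) =O[𝓟 K] M := fun hf hf' => by
    simpa using (one hf).mul hf'
  have mc : ∀ {f f' M : Scalar}, f' =O[𝓟 K] M → ContDiffOn ℝ ∞ f V →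
      (fun x => f' x * f x) =O[𝓟 K] M := fun hf' hf => by
    simpa using hf'.mul (one hf)
  have hU : ∀ b, gradUp h u b =O[𝓟 K] N := fun b =>
    IsBigO.fun_sum fun c _ => cm (hh b c) (h1 c)
  have hC : ∀ a b, gradCoeff h u a b =O[𝓟 K] N := fun a b =>
    IsBigO.fun_sum fun c _ => mc (h1 c) (contDiffOn_pd hV (hh b c) a)
  have hS : gradSq h u =O[𝓟 K] fun x => N x * N x :=
    IsBigO.fun_sum fun c _ => (h1 c).mul (hU c)
  constructor
  · intro a
    exact (((cm (hh a 0) hS).const_mul_left _).sub ((hU 0).mul (hU a))).sub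
      ((h0.mul h0).const_mul_left _)
  · have e : (fun x => ∑ a, pd a (energyFlux h u a) x) =ᶠ[𝓟 K] _ :=
      eventually_principal.mpr fun x hx => div_energyFlux hV hh hu (hKV hx) (hs x hx)
    refine IsBigO.congr' ?_ e.symm EventuallyEq.rfl
    refine (((hU 0).mul hw).neg_left.add (IsBigO.fun_sum fun a _ => ?_)).sub
      ((h0.mul (h1 0)).const_mul_left 2)
    have hDC : (fun x => ∑ c, pd c u x * gradCoeff h u a c x) =O[𝓟 K] fun x => N x * N x :=
      IsBigO.fun_sum fun c _ => (h1 c).mul (hC a c)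
    exact ((((cm (hh a 0) hDC).const_mul_left _).add
      ((mc hS (contDiffOn_pd hV (hh a 0) a)).const_mul_left _)).sub ((hU 0).mul (hC a a))).sub
      ((hU a).mul (hC a 0))

end

/-- `-J⁰` is the energy density of the current. -/
lemma neg_energyFlux_zero (h : Tensor2) (u : Scalar) (x : Pt) :
    - energyFlux h u 0 x = u x ^ 2
      + ∑ a, ∑ b, (h 0 a x * h 0 b x - 1 / 2 * h 0 0 x * h a b x) * pd a u x * pd b u x := by
  have h1 : ∑ a, ∑ b, (h 0 a x * h 0 b x - 1 / 2 * h 0 0 x * h a b x) * pd a u x * pd b u x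
      = gradUp h u 0 x * gradUp h u 0 x - 1 / 2 * (h 0 0 x * gradSq h u x) := by
    simp only [gradUp, gradSq]
    rw [Finset.sum_mul_sum]
    simp only [Finset.mul_sum, ← Finset.sum_sub_distrib]
    exact Finset.sum_congr rfl fun a _ => Finset.sum_congr rfl fun b _ => by ring
  rw [h1, energyFlux, if_pos rfl]
  ring

end AdSGauge

namespace AdSGauge
open Asymptotics Filter MeasureTheory

/-! ### Uniqueness for the initial-boundary value problem near the corner -/

lemma energyDensity_nonneg (u : Scalar) (x : Pt) : 0 ≤ energyDensity u x := by
  unfold energyDensity; positivity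

lemma energyFlux_eq_zero {h : Tensor2} {u : Scalar} {x : Pt} (h0 : u x = 0)
    (h1 : ∀ c, pd c u x = 0) (a : Fin 4) : energyFlux h u a x = 0 := by
  simp [energyFlux, gradSq, gradUp, h0, h1]

/-- This makes the Dirichlet boundary conservative: with `h^{01} = 0` the multiplier `h^{0c} ∂_c u`
is a tangential derivative, which vanishes. -/
lemma energyFlux_one_eq_zero {h : Tensor2} {u : Scalar} {x : Pt} (h01 : h 0 1 x = 0)
    (h10 : h 1 0 x = 0) (h1 : ∀ c, c ≠ 1 → pd c u x = 0) : energyFlux h u 1 x = 0 := by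
  have : gradUp h u 0 x = 0 := by
    refine Finset.sum_eq_zero fun c _ => ?_
    rcases eq_or_ne c 1 with rfl | hc
    · rw [h01, zero_mul]
    · rw [h1 c hc, mul_zero]
  simp [energyFlux, this, h10]

/-- Solutions of a system of wave equations with vanishing initial data on `x⁰ = 0` and Dirichlet
data on the timelike boundary `x¹ = 0` vanish near the corner. -/
theorem wave_uniqueness {ι : Type*} [Fintype ι] {V : Set Pt} (hV : IsOpen V) {p : Pt} (hp : p ∈ V)
    (hp0 : p 0 = 0) (hp1 : p 1 = 0) {h : Tensor2} (hh : ∀ a b, ContDiffOn ℝ ∞ (h a b) V)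
    (hsym : ∀ x ∈ V, x ∈ quadrant → ∀ a b, h a b x = h b a x)
    (h01 : ∀ x ∈ V, x ∈ quadrant → x 1 = 0 → h 0 1 x = 0)
    (hpos : ∀ ξ : Fin 4 → ℝ, ξ ≠ 0 →
      0 < ∑ a, ∑ b, (h 0 a p * h 0 b p - 1 / 2 * h 0 0 p * h a b p) * ξ a * ξ b)
    {u : ι → Scalar} (hu : ∀ I, ContDiffOn ℝ ∞ (u I) V)
    (hu1 : ∀ I, ∀ x ∈ V, x ∈ quadrant → x 1 = 0 → u I x = 0)
    (hu0 : ∀ I, ∀ x ∈ V, x ∈ quadrant → x 0 = 0 → u I x = 0 ∧ ∀ k, pd k (u I) x = 0)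
    (hw : ∀ K : Set Pt, IsCompact K → K ⊆ V → K ⊆ quadrant → ∀ I,
      waveOp h (u I) =O[𝓟 K] fun x => √(∑ J, energyDensity (u J) x)) :
    ∃ ε > 0, ∀ x, dist x p < ε → x ∈ quadrant → ∀ I, u I x = 0 := by
  set E : Scalar := fun x => ∑ J, energyDensity (u J) x with hE
  have hE0 : ∀ x, 0 ≤ E x := fun x => Finset.sum_nonneg fun J _ => energyDensity_nonneg _ _
  have hEs : ContDiffOn ℝ ∞ E V := ContDiffOn.sum fun J _ =>
    ((hu J).pow 2).add (ContDiffOn.sum fun c _ => (contDiffOn_pd hV (hu J) c).pow 2)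
  have hNN : (fun x => √(E x) * √(E x)) = E := by
    funext x; exact Real.mul_self_sqrt (hE0 x)
  obtain ⟨c₀, hc₀, hev⟩ := exists_uniform_posDef
    (fun a b x => h 0 a x * h 0 b x - 1 / 2 * h 0 0 x * h a b x)
    (fun a b => ((((hh 0 a).mul (hh 0 b)).sub ((contDiffOn_const.mul (hh 0 0)).mul
      (hh a b))).continuousOn.continuousAt (hV.mem_nhds hp))) hpos
  obtain ⟨r₀, hr₀, hball⟩ := Metric.nhds_basis_closedBall.mem_iff.mp
    (inter_mem (hV.mem_nhds hp) hev)
  -- A compact quarter ball on which the energy form is uniformly positive and all constants are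
  -- uniform.
  set K := Metric.closedBall p r₀ ∩ quadrant with hKdef
  have hK : IsCompact K := (isCompact_closedBall p r₀).inter_right isClosed_quadrant
  have hKV : K ⊆ V := fun x hx => (hball hx.1).1
  have hKq : K ⊆ quadrant := fun x hx => hx.2
  have hwK := hw K hK hKV hKq
  have hdens : ∀ I x, energyDensity (u I) x ≤ E x := fun I x =>
    Finset.single_le_sum (f := fun J => energyDensity (u J) x)
      (fun J _ => energyDensity_nonneg _ _) (Finset.mem_univ I)
  have hb0 : ∀ I, u I =O[𝓟 K] fun x => √(E x) := fun I =>
    IsBigO.of_bound 1 <| eventually_principal.mpr fun x _ => by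
      rw [one_mul, Real.norm_eq_abs, Real.norm_eq_abs, abs_of_nonneg (Real.sqrt_nonneg _)]
      refine Real.abs_le_sqrt (le_trans ?_ (hdens I x))
      exact le_add_of_nonneg_right (Finset.sum_nonneg fun _ _ => sq_nonneg _)
  have hb1 : ∀ I c, pd c (u I) =O[𝓟 K] fun x => √(E x) := fun I c =>
    IsBigO.of_bound 1 <| eventually_principal.mpr fun x _ => by
      rw [one_mul, Real.norm_eq_abs, Real.norm_eq_abs, abs_of_nonneg (Real.sqrt_nonneg _)]
      refine Real.abs_le_sqrt (le_trans ?_ (hdens I x))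
      exact (Finset.single_le_sum (f := fun c => pd c (u I) x ^ 2) (fun _ _ => sq_nonneg _)
        (Finset.mem_univ c)).trans (le_add_of_nonneg_left (sq_nonneg _))
  have hflux := fun I => energyFlux_isBigO hV (hu I) hK hKV hh
    (fun x hx => hsym x (hKV hx) (hKq hx)) (hb0 I) (hb1 I) (hwK I)
  rw [hNN] at hflux
  let J : Fin 4 → Scalar := fun a x => ∑ I, energyFlux h (u I) a x
  have hJs : ∀ a, ContDiffOn ℝ ∞ (J a) V := fun a =>
    ContDiffOn.sum fun I _ => contDiffOn_energyFlux hV hh (hu I) a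
  have hJ1 : (fun x => ∑ a, |J a x|) =O[𝓟 K] E :=
    IsBigO.fun_sum fun a _ => (IsBigO.fun_sum fun I _ => (hflux I).1 a).abs_left
  have hJ2 : (fun x => ∑ a, pd a (J a) x) =O[𝓟 K] E := by
    have e : (fun x => ∑ I, ∑ a, pd a (energyFlux h (u I) a) x) =ᶠ[𝓟 K]
        fun x => ∑ a, pd a (J a) x := eventually_principal.mpr fun x hx => by
      simp only [J]
      rw [Finset.sum_comm]
      refine Finset.sum_congr rfl fun a _ => ?_
      rw [pd_sum _ hV (fun I _ => contDiffOn_energyFlux hV hh (hu I) a) (hKV hx)]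
    exact (IsBigO.fun_sum fun I _ => (hflux I).2).congr' e EventuallyEq.rfl
  obtain ⟨C₁, hC₁, hC₁'⟩ := hJ1.exists_nonneg
  obtain ⟨C₂, hC₂, hC₂'⟩ := hJ2.exists_nonneg
  rw [isBigOWith_principal] at hC₁' hC₂'
  -- Coercivity: the weight `1` comes from the explicit `u²` in the current, the weight `c₀` from
  -- the positive energy form.
  have hneg : ∀ x ∈ K, min 1 c₀ * E x ≤ - J 0 x := by
    intro x hx
    simp only [J, hE, ← Finset.sum_neg_distrib, Finset.mul_sum]
    refine Finset.sum_le_sum fun I _ => ?_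
    rw [neg_energyFlux_zero, energyDensity, mul_add]
    refine add_le_add ?_ (le_trans ?_ ((hball hx.1).2 fun a => pd a (u I) x))
    · exact mul_le_of_le_one_left (sq_nonneg _) (min_le_left _ _)
    · exact mul_le_mul_of_nonneg_right (min_le_right _ _) (Finset.sum_nonneg fun _ _ => sq_nonneg _)
  set c₁ := min 1 c₀ with hc₁
  have hc₁0 : 0 < c₁ := lt_min one_pos hc₀
  -- Small enough for the tilt of `dφ` away from `-dx⁰`, of size `2r`, to consume at most half of
  -- the coercivity constant.
  set r := min r₀ (c₁ / (4 * (C₁ + 1))) with hr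
  have hr0 : 0 < r := lt_min hr₀ (by positivity)
  have hrC : 2 * r * C₁ ≤ c₁ / 2 := by
    have : r ≤ c₁ / (4 * (C₁ + 1)) := min_le_right _ _
    rw [le_div_iff₀ (by positivity)] at this
    nlinarith
  -- The bound by `r ^ 2` keeps the support of the weight off the outer faces of the box; the other
  -- bound lets `φ ≤ δ` absorb the divergence of the current.
  set δ := min (r ^ 2) (c₁ / (2 * (C₂ + 1))) with hδ
  have hδ0 : 0 < δ := lt_min (by positivity) (by positivity)
  have hδC : δ * C₂ ≤ c₁ / 2 := by
    have : δ ≤ c₁ / (2 * (C₂ + 1)) := min_le_right _ _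
    rw [le_div_iff₀ (by positivity)] at this
    nlinarith
  have hδr : δ ≤ r ^ 2 := min_le_left _ _
  -- The set `φ > 0` meets the quadrant in a small lens at `p`, capped by a hypersurface close to a
  -- level set of `x⁰`.
  let φ : Scalar := fun x => δ - x 0 - ∑ j, (x j - p j) ^ 2
  let φ' : Pt → Pt →L[ℝ] ℝ := fun x => - ContinuousLinearMap.proj 0
    - ∑ j, (2 * (x j - p j)) • ContinuousLinearMap.proj j
  have hφ : ∀ x, HasFDerivAt φ (φ' x) x := by
    intro x
    have h1 : ∀ j : Fin 4, HasFDerivAt (fun x : Pt => x j) (ContinuousLinearMap.proj j) x :=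
      fun j => (ContinuousLinearMap.proj (R := ℝ) (φ := fun _ : Fin 4 => ℝ) j).hasFDerivAt
    have h2 : HasFDerivAt (fun x : Pt => ∑ j, (x j - p j) ^ 2)
        (∑ j, (2 * (x j - p j)) • ContinuousLinearMap.proj j) x :=
      HasFDerivAt.fun_sum fun j _ => by simpa using ((h1 j).sub_const (p j)).pow 2
    exact ((h1 0).const_sub δ).sub h2
  have hφ'1 : ∀ x i, φ' x (Pi.single i 1) = - (if i = 0 then 1 else 0) - 2 * (x i - p i) := by
    intro x i
    simp [φ', Pi.single_apply, eq_comm]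
  have hφc : Continuous φ := by
    change Continuous fun x : Pt => δ - x 0 - ∑ j, (x j - p j) ^ 2
    fun_prop
  -- The faces `x⁰ = 0` and `x¹ = 0` of the box pass through `p`; in the other two directions the
  -- box is centred at `p`.
  let a : Pt := fun i => p i - (if i = 0 ∨ i = 1 then 0 else r)
  let b : Pt := fun i => p i + r
  have hab : a ≤ b := fun i => by
    simp only [a, b]; split_ifs <;> linarith
  have hbox : ∀ x ∈ Set.Icc a b, x ∈ K := by
    intro x hx
    have h1 : ∀ i, |x i - p i| ≤ r := fun i => by
      have h2 := hx.1 i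
      have h3 := hx.2 i
      simp only [a, b] at h2 h3
      rw [abs_le]
      split_ifs at h2 <;> constructor <;> linarith
    refine ⟨?_, ?_, ?_⟩
    · rw [Metric.mem_closedBall, dist_pi_le_iff hr₀.le]
      exact fun i => (h1 i).trans (min_le_left _ _)
    · have := hx.1 0; simpa [a, hp0] using this
    · have := hx.1 1; simpa [a, hp1] using this
  have hboxr : ∀ x ∈ Set.Icc a b, ∀ i, |x i - p i| ≤ r := by
    intro x hx i
    have h2 := hx.1 i
    have h3 := hx.2 i
    simp only [a, b] at h2 h3
    rw [abs_le]
    split_ifs at h2 <;> constructor <;> linarith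
  -- The current weighted by the square of the positive part of `φ`; the box replaces the curved
  -- lens as domain of integration.
  let f : Fin 4 → Scalar := fun i x => (max (φ x) 0) ^ 2 * J i x
  let f' : Fin 4 → Pt → Pt →L[ℝ] ℝ := fun i x =>
    (max (φ x) 0) ^ 2 • fderiv ℝ (J i) x + J i x • ((2 * max (φ x) 0) • φ' x)
  have hf : ∀ i, ContinuousOn (f i) (Set.Icc a b) := fun i =>
    ((hφc.max continuous_const).pow 2).continuousOn.mul
      ((hJs i).continuousOn.mono fun x hx => hKV (hbox x hx))
  have hf' : ∀ x ∈ V, ∀ i, HasFDerivAt (f i) (f' i x) x := fun x hx i =>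
    ((hasDerivAt_sq_posPart (φ x)).comp_hasFDerivAt x (hφ x)).mul
      (differentiableAt_of_contDiffOn hV (hJs i) hx).hasFDerivAt
  have hf'1 : ∀ x, ∑ i, f' i x (Pi.single i 1) = (max (φ x) 0) ^ 2 * ∑ i, pd i (J i) x
      + 2 * max (φ x) 0 * (- J 0 x - 2 * ∑ i, (x i - p i) * J i x) := by
    intro x
    have h1 : ∀ i, f' i x (Pi.single i 1) = (max (φ x) 0) ^ 2 * pd i (J i) x
        + 2 * max (φ x) 0 * (- ((if i = 0 then 1 else 0) * J i x) - 2 * ((x i - p i) * J i x)) := by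
      intro i
      have : f' i x (Pi.single i 1) = (max (φ x) 0) ^ 2 * pd i (J i) x
          + J i x * (2 * max (φ x) 0 * φ' x (Pi.single i 1)) := rfl
      rw [this, hφ'1]; ring
    simp only [h1, Finset.sum_add_distrib, ← Finset.mul_sum, Finset.sum_sub_distrib,
      Finset.sum_neg_distrib]
    simp
  have hpdJ : ContinuousOn (fun x => ∑ i, pd i (J i) x) (Set.Icc a b) :=
    continuousOn_finsetSum _ fun i _ => (contDiffOn_pd hV (hJs i) i).continuousOn.mono
      fun x hx => hKV (hbox x hx)
  have hJc : ∀ i, ContinuousOn (J i) (Set.Icc a b) := fun i =>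
    (hJs i).continuousOn.mono fun x hx => hKV (hbox x hx)
  have hcont : ContinuousOn (fun x => ∑ i, f' i x (Pi.single i 1)) (Set.Icc a b) := by
    simp only [hf'1]
    refine ContinuousOn.add (((hφc.max continuous_const).pow 2).continuousOn.mul hpdJ)
      ((continuous_const.mul (hφc.max continuous_const)).continuousOn.mul
        ((hJc 0).neg.sub (continuousOn_const.mul (continuousOn_finsetSum _ fun i _ => ?_))))
    exact ((continuous_apply i).sub continuous_const).continuousOn.mul (hJc i)
  have hφr : ∀ x ∈ Set.Icc a b, ∀ i, |x i - p i| = r → max (φ x) 0 = 0 := by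
    intro x hx i hi
    refine max_eq_right ?_
    have h1 : (x i - p i) ^ 2 ≤ ∑ j, (x j - p j) ^ 2 :=
      Finset.single_le_sum (f := fun j => (x j - p j) ^ 2) (fun _ _ => sq_nonneg _)
        (Finset.mem_univ i)
    rw [← sq_abs, hi] at h1
    have h2 : 0 ≤ x 0 := (hKq (hbox x hx)).1
    simp only [φ]
    linarith
  have hfront : ∀ x ∈ Set.Icc a b, ∀ i, x i = b i → f i x = 0 := by
    intro x hx i hi
    simp only [f]
    rw [hφr x hx i (by rw [hi]; simp [b, abs_of_pos hr0])]
    simp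
  -- Three reasons: zero Cauchy data on `x⁰ = 0`, zero flux through `x¹ = 0`, zero weight on the
  -- remaining two faces.
  have hback : ∀ x ∈ Set.Icc a b, ∀ i, x i = a i → f i x = 0 := by
    intro x hx i hi
    have hxV := hKV (hbox x hx)
    have hxq := hKq (hbox x hx)
    by_cases hi0 : i = 0
    · subst hi0
      have hx0 : x 0 = 0 := by rw [hi]; simp [a, hp0]
      have : J 0 x = 0 := Finset.sum_eq_zero fun I _ =>
        energyFlux_eq_zero (hu0 I x hxV hxq hx0).1 (hu0 I x hxV hxq hx0).2 0
      simp only [f, this, mul_zero]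
    by_cases hi1 : i = 1
    · subst hi1
      have hx1 : x 1 = 0 := by rw [hi]; simp [a, hp1]
      have : J 1 x = 0 := Finset.sum_eq_zero fun I _ => by
        refine energyFlux_one_eq_zero (h01 x hxV hxq hx1)
          ((hsym x hxV hxq 1 0).trans (h01 x hxV hxq hx1)) fun c hc => ?_
        refine pd_eq_zero_of_eqOn hV (hu I) hxV c (P := fun y => y ∈ quadrant ∧ y 1 = 0)
          (fun t ht => ?_) fun y hyV hy => hu1 I y hyV hy.1 hy.2
        have e1 : (x + t • (Pi.single c 1 : Pt)) 1 = 0 := by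
          simp [hx1, Ne.symm hc]
        refine ⟨⟨?_, e1.ge⟩, e1⟩
        simp only [Pi.add_apply, Pi.smul_apply, smul_eq_mul, Pi.single_apply]
        have := hxq.1
        split_ifs <;> linarith
      simp only [f, this, mul_zero]
    · simp only [f]
      rw [hφr x hx i (by rw [hi]; simp [a, hi0, hi1, abs_of_pos hr0])]
      simp
  have hdiv := integral_divergence_of_hasFDerivAt_off_countable' a b hab f f' ∅
    Set.countable_empty hf (fun x hx i => hf' x (hKV (hbox x ⟨fun j => (hx.1 j trivial).1.le,
      fun j => (hx.1 j trivial).2.le⟩)) i) (hcont.integrableOn_compact isCompact_Icc)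
  have hzero : ∫ x in Set.Icc a b, ∑ i, f' i x (Pi.single i 1) = 0 := by
    rw [hdiv]
    refine Finset.sum_eq_zero fun i _ => ?_
    rw [setIntegral_eq_zero_of_forall_eq_zero, setIntegral_eq_zero_of_forall_eq_zero, sub_zero]
    · intro y hy
      refine hback _ ?_ i (by simp)
      exact Fin.insertNth_mem_Icc.mpr ⟨⟨le_rfl, hab i⟩, hy⟩
    · intro y hy
      refine hfront _ ?_ i (by simp)
      exact Fin.insertNth_mem_Icc.mpr ⟨⟨hab i, le_rfl⟩, hy⟩
  -- A nonnegative lower bound for the divergence, whose integral is zero; hence the energy vanishes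
  -- wherever `φ > 0`.
  let M : Scalar := fun x => max (φ x) 0 * (c₁ / 2 * E x)
  have hM0 : ∀ x, 0 ≤ M x := fun x => by
    have := hE0 x
    have := le_max_right (φ x) 0
    simp only [M]; positivity
  have hMc : ContinuousOn M (Set.Icc a b) :=
    (hφc.max continuous_const).continuousOn.mul (continuousOn_const.mul
      (hEs.continuousOn.mono fun x hx => hKV (hbox x hx)))
  have hMle : ∀ x ∈ Set.Icc a b, M x ≤ ∑ i, f' i x (Pi.single i 1) := by
    intro x hx
    rw [hf'1]
    have hxK := hbox x hx
    have hφδ : max (φ x) 0 ≤ δ := by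
      refine max_le ?_ hδ0.le
      have h2 : 0 ≤ x 0 := (hKq hxK).1
      have h3 : 0 ≤ ∑ j, (x j - p j) ^ 2 := Finset.sum_nonneg fun _ _ => sq_nonneg _
      simp only [φ]
      linarith
    have hφ0 := le_max_right (φ x) 0
    set m := max (φ x) 0
    have e1 : |∑ i, (x i - p i) * J i x| ≤ r * (C₁ * E x) := by
      have h1 := hC₁' x hxK
      rw [Real.norm_eq_abs, Real.norm_eq_abs, abs_of_nonneg (hE0 x),
        abs_of_nonneg (Finset.sum_nonneg fun _ _ => abs_nonneg _)] at h1
      calc |∑ i, (x i - p i) * J i x| ≤ ∑ i, |(x i - p i) * J i x| := Finset.abs_sum_le_sum_abs _ _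
        _ ≤ ∑ i, r * |J i x| := Finset.sum_le_sum fun i _ => by
            rw [abs_mul]
            exact mul_le_mul_of_nonneg_right (hboxr x hx i) (abs_nonneg _)
        _ = r * ∑ i, |J i x| := by rw [Finset.mul_sum]
        _ ≤ r * (C₁ * E x) := mul_le_mul_of_nonneg_left h1 hr0.le
    have e2 : |∑ i, pd i (J i) x| ≤ C₂ * E x := by
      have h1 := hC₂' x hxK
      rwa [Real.norm_eq_abs, Real.norm_eq_abs, abs_of_nonneg (hE0 x)] at h1
    have e3 := hneg x hxK
    have e4 : c₁ / 2 * E x ≤ - J 0 x - 2 * ∑ i, (x i - p i) * J i x := by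
      have := (abs_le.mp e1).2
      have := mul_le_mul_of_nonneg_right hrC (hE0 x)
      linarith
    have e5 : - (c₁ / 2 * E x) ≤ m * ∑ i, pd i (J i) x := by
      have h1 : |m * ∑ i, pd i (J i) x| ≤ c₁ / 2 * E x := by
        rw [abs_mul, abs_of_nonneg hφ0]
        calc m * |∑ i, pd i (J i) x| ≤ δ * (C₂ * E x) :=
              mul_le_mul hφδ e2 (abs_nonneg _) hδ0.le
          _ = δ * C₂ * E x := by ring
          _ ≤ c₁ / 2 * E x := mul_le_mul_of_nonneg_right hδC (hE0 x)
      exact (abs_le.mp h1).1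
    -- The cap term contributes `2m · c₁E/2`, and the divergence of the current costs at most half
    -- of that.
    calc M x = m * (-(c₁ / 2 * E x)) + 2 * m * (c₁ / 2 * E x) := by simp only [M, m]; ring
      _ ≤ m * (m * ∑ i, pd i (J i) x) + 2 * m * (- J 0 x - 2 * ∑ i, (x i - p i) * J i x) :=
          add_le_add (mul_le_mul_of_nonneg_left e5 hφ0)
            (mul_le_mul_of_nonneg_left e4 (by positivity))
      _ = _ := by ring
  have hMi : IntegrableOn M (Set.Icc a b) := hMc.integrableOn_compact isCompact_Icc
  have hM1 : ∫ x in Set.Icc a b, M x = 0 := by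
    refine le_antisymm ?_ (integral_nonneg hM0)
    rw [← hzero]
    exact setIntegral_mono_on hMi (hcont.integrableOn_compact isCompact_Icc) measurableSet_Icc hMle
  have hM2 : Set.EqOn M 0 (Set.Icc a b) := by
    have h1 := (setIntegral_eq_zero_iff_of_nonneg_ae (Eventually.of_forall hM0) hMi).mp hM1
    have hab' : ∀ i, a i < b i := fun i => by
      simp only [a, b]; split_ifs <;> linarith
    refine Measure.eqOn_of_ae_eq h1 hMc continuousOn_const ?_
    rw [← Set.pi_univ_Icc, interior_pi_set Set.finite_univ, closure_pi_set]
    simp only [interior_Icc]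
    refine Set.pi_mono fun i _ => ?_
    rw [closure_Ioo (hab' i).ne]
  have hball2 : ∀ᶠ x in nhds p, 0 < φ x ∧ dist x p < r := by
    refine (hφc.tendsto p |>.eventually (lt_mem_nhds ?_)).and (Metric.ball_mem_nhds p hr0)
    simp [φ, hp0, hδ0]
  obtain ⟨ε, hε, hε'⟩ := Metric.eventually_nhds_iff.mp hball2
  refine ⟨ε, hε, fun x hx hxq I => ?_⟩
  obtain ⟨h1, h2⟩ := hε' hx
  have hxbox : x ∈ Set.Icc a b := by
    have h3 : ∀ i, |x i - p i| < r := fun i => (dist_le_pi_dist x p i).trans_lt h2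
    constructor
    · intro i
      simp only [a]
      split_ifs with hi
      · rcases hi with rfl | rfl
        · rw [hp0, sub_zero]; exact hxq.1
        · rw [hp1, sub_zero]; exact hxq.2
      · have := (abs_lt.mp (h3 i)).1; linarith
    · intro i
      have := (abs_lt.mp (h3 i)).2
      simp only [b]; linarith
  have h4 := hM2 hxbox
  simp only [M, Pi.zero_apply, max_eq_left h1.le, mul_eq_zero] at h4
  have h5 : E x = 0 := by
    rcases h4 with h4 | h4 | h4
    · exact absurd h4 h1.ne'
    · exact absurd h4 (by positivity)
    · exact h4
  have h6 := hdens I x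
  rw [h5, energyDensity] at h6
  have h7 : 0 ≤ ∑ c, pd c (u I) x ^ 2 := Finset.sum_nonneg fun _ _ => sq_nonneg _
  have h8 := sq_nonneg (u I x)
  exact pow_eq_zero_iff (two_ne_zero) |>.mp (by linarith)

end AdSGauge

/-! ### The ring of functions smooth up to the boundary, and the dictionary to coordinate components
-/

namespace AdSGauge
open TopologicalSpace (Opens)

/-! ### Smooth functions up to the boundary -/

/-- The part of the patch `V` in the quadrant. -/
abbrev corneredPatch (V : Opens Pt) : Set Pt := (V : Set Pt) ∩ quadrant

/-- Functions on `V ∩ {x⁰ ≥ 0, x¹ ≥ 0}` which are restrictions of smooth functions on `V`. -/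
def smoothRing (V : Opens Pt) : Subalgebra ℝ (corneredPatch V → ℝ) where
  carrier := {s | ∃ F : Scalar, ContDiffOn ℝ ∞ F V ∧ ∀ x, s x = F x}
  mul_mem' := by
    rintro s t ⟨F, hF, hs⟩ ⟨F', hF', ht⟩
    exact ⟨fun x => F x * F' x, hF.mul hF', fun x => by rw [Pi.mul_apply, hs, ht]⟩
  add_mem' := by
    rintro s t ⟨F, hF, hs⟩ ⟨F', hF', ht⟩
    exact ⟨fun x => F x + F' x, hF.add hF', fun x => by rw [Pi.add_apply, hs, ht]⟩
  algebraMap_mem' r := ⟨fun _ => r, contDiffOn_const, fun _ => rfl⟩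

variable {V : Opens Pt}

/-- `F` is a smooth function on `V` which restricts to `s`. -/
structure Rep (F : Scalar) (s : smoothRing V) : Prop where
  smooth : ContDiffOn ℝ ∞ F V
  eq : ∀ x, s.1 x = F x

namespace smoothRing

def mk (F : Scalar) (hF : ContDiffOn ℝ ∞ F V) : smoothRing V := ⟨fun x => F x, F, hF, fun _ => rfl⟩

/-- An arbitrary smooth extension; on the quadrant neither its values nor its derivatives depend on
the choice. -/
def rep (s : smoothRing V) : Scalar := s.2.choose

end smoothRing

open smoothRing

lemma rep_mk (F : Scalar) (hF : ContDiffOn ℝ ∞ F V) : Rep F (mk F hF) := ⟨hF, fun _ => rfl⟩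

lemma rep_rep (s : smoothRing V) : Rep (rep s) s := ⟨s.2.choose_spec.1, s.2.choose_spec.2⟩

namespace Rep

variable {F F' : Scalar} {s s' : smoothRing V}

lemma add (h : Rep F s) (h' : Rep F' s') : Rep (fun x => F x + F' x) (s + s') :=
  ⟨h.smooth.add h'.smooth, fun x => congrArg₂ (· + ·) (h.eq x) (h'.eq x)⟩

lemma sub (h : Rep F s) (h' : Rep F' s') : Rep (fun x => F x - F' x) (s - s') :=
  ⟨h.smooth.sub h'.smooth, fun x => congrArg₂ (· - ·) (h.eq x) (h'.eq x)⟩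

lemma neg (h : Rep F s) : Rep (fun x => - F x) (-s) :=
  ⟨h.smooth.neg, fun x => congrArg (- ·) (h.eq x)⟩

lemma mul (h : Rep F s) (h' : Rep F' s') : Rep (fun x => F x * F' x) (s * s') :=
  ⟨h.smooth.mul h'.smooth, fun x => congrArg₂ (· * ·) (h.eq x) (h'.eq x)⟩

lemma const (c : ℝ) : Rep (V := V) (fun _ => c) (algebraMap ℝ _ c) :=
  ⟨contDiffOn_const, fun _ => rfl⟩

lemma zero : Rep (V := V) (fun _ => 0) 0 := ⟨contDiffOn_const, fun _ => rfl⟩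

lemma one : Rep (V := V) (fun _ => 1) 1 := ⟨contDiffOn_const, fun _ => rfl⟩

lemma ofNat (n : ℕ) [n.AtLeastTwo] : Rep (V := V) (fun _ => (OfNat.ofNat n : ℝ)) (OfNat.ofNat n) := by
  have := const (V := V) (OfNat.ofNat n)
  rwa [map_ofNat] at this

lemma sum {α : Type*} {t : Finset α} {F : α → Scalar} {s : α → smoothRing V}
    (h : ∀ a, Rep (F a) (s a)) : Rep (fun x => ∑ a ∈ t, F a x) (∑ a ∈ t, s a) := by
  classical
  induction t using Finset.induction_on with
  | empty => simpa using zero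
  | insert a t ha ih =>
    simp only [Finset.sum_insert ha]
    exact (h a).add ih

/-- Equality in the ring is tested on the quadrant only, which is how equations assumed on the
region become ring identities. -/
lemma ext (h : Rep F s) (h' : Rep F' s') (e : ∀ x ∈ V, x ∈ quadrant → F x = F' x) : s = s' :=
  Subtype.ext (funext fun x => by rw [h.eq, h'.eq, e x x.2.1 x.2.2])

lemma congr_eq (h : Rep F s) (e : s = s') : Rep F s' := e ▸ h

lemma eval_eq (h : Rep F s) (h' : Rep F' s) {x : Pt} (hx : x ∈ V) (hq : x ∈ quadrant) :
    F x = F' x := (h.eq ⟨x, hx, hq⟩).symm.trans (h'.eq ⟨x, hx, hq⟩)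

end Rep

lemma quadrant_add {x : Pt} (hx : x ∈ quadrant) (i : Fin 4) {t : ℝ} (ht : 0 ≤ t) :
    x + t • (Pi.single i 1 : Pt) ∈ quadrant := by
  have h0 := hx.1
  have h1 := hx.2
  constructor <;> simp only [Pi.add_apply, Pi.smul_apply, smul_eq_mul, Pi.single_apply] <;>
    split_ifs <;> linarith

/-- The quadrant is stable under positive translations along the axes, so every partial derivative
there is a one-sided derivative inside it. This makes the derivations of the ring well defined. -/
lemma pd_eq_of_rep {F F' : Scalar} {s : smoothRing V} (h : Rep F s) (h' : Rep F' s) (i : Fin 4)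
    {x : Pt} (hx : x ∈ V) (hq : x ∈ quadrant) : pd i F x = pd i F' x := by
  have hs := h.smooth.sub h'.smooth
  have h1 : pd i (fun y => F y - F' y) x = 0 :=
    pd_eq_zero_of_eqOn V.isOpen hs hx i (fun t ht => quadrant_add hq i ht)
      fun y hy hyq => sub_eq_zero.mpr (h.eval_eq h' hy hyq)
  have h2 : pd i (fun y => (F y - F' y) + F' y) x = 0 + pd i F' x := by
    rw [pd_add V.isOpen hs h'.smooth hx, h1]
  simpa using h2

namespace smoothRing

/-- Partial derivatives as derivations. -/
def d (i : Fin 4) : Derivation ℝ (smoothRing V) (smoothRing V) :=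
  Derivation.mk'
    { toFun := fun s => mk (pd i (rep s)) (contDiffOn_pd V.isOpen (rep_rep s).smooth i)
      map_add' := fun s t => by
        refine Subtype.ext (funext fun x => ?_)
        change pd i (rep (s + t)) x = pd i (rep s) x + pd i (rep t) x
        rw [pd_eq_of_rep (rep_rep (s + t)) ((rep_rep s).add (rep_rep t)) i x.2.1 x.2.2,
          pd_add V.isOpen (rep_rep s).smooth (rep_rep t).smooth x.2.1]
      map_smul' := fun c s => by
        refine Subtype.ext (funext fun x => ?_)
        change pd i (rep (c • s)) x = c * pd i (rep s) x
        have h : Rep (fun x => c * rep s x) (c • s) :=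
          ((Rep.const c).mul (rep_rep s)).congr_eq (Algebra.smul_def c s).symm
        rw [pd_eq_of_rep (rep_rep (c • s)) h i x.2.1 x.2.2,
          pd_mul V.isOpen contDiffOn_const (rep_rep s).smooth x.2.1, pd_const]
        ring }
    fun s t => by
      refine Subtype.ext (funext fun x => ?_)
      change pd i (rep (s * t)) x = s.1 x * pd i (rep t) x + t.1 x * pd i (rep s) x
      rw [pd_eq_of_rep (rep_rep (s * t)) ((rep_rep s).mul (rep_rep t)) i x.2.1 x.2.2,
        pd_mul V.isOpen (rep_rep s).smooth (rep_rep t).smooth x.2.1, (rep_rep s).eq,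
        (rep_rep t).eq]

end smoothRing

lemma Rep.pd {F : Scalar} {s : smoothRing V} (h : Rep F s) (i : Fin 4) :
    Rep (pd i F) (smoothRing.d i s) :=
  ⟨contDiffOn_pd V.isOpen h.smooth i, fun x => pd_eq_of_rep (rep_rep s) h i x.2.1 x.2.2⟩

lemma smoothRing.d_comm (i j : Fin 4) (s : smoothRing V) : d i (d j s) = d j (d i s) :=
  (((rep_rep s).pd j).pd i).ext (((rep_rep s).pd i).pd j)
    fun _ hx _ => pd_comm V.isOpen (rep_rep s).smooth hx i j

/-! ### The inverse metric -/

lemma contDiffOn_det {n : Type} [Fintype n] [DecidableEq n] {W : Set Pt} {h : n → n → Scalar}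
    (hh : ∀ a b, ContDiffOn ℝ ∞ (h a b) W) :
    ContDiffOn ℝ ∞ (fun x => (Matrix.of fun a b => h a b x).det) W := by
  simp only [Matrix.det_apply, Matrix.of_apply]
  exact ContDiffOn.sum fun σ _ => (contDiffOn_prod fun i _ => hh _ _).const_smul _

/-- Cramer's rule: each entry is a quotient of determinants. -/
lemma contDiffOn_inverse {W : Set Pt} {h : Tensor2} (hh : ∀ a b, ContDiffOn ℝ ∞ (h a b) W)
    (hdet : ∀ x ∈ W, (Matrix.of fun a b => h a b x).det ≠ 0) (a b : Fin 4) :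
    ContDiffOn ℝ ∞ (inverse h a b) W := by
  have h1 : inverse h a b = fun x => ((Matrix.of fun a b => h a b x).det)⁻¹ *
      (Matrix.of fun i j => (if i = b then (if j = a then 1 else 0) else h i j x)).det := by
    funext x
    rw [inverse, Matrix.inv_def, Matrix.smul_apply, Ring.inverse_eq_inv', smul_eq_mul,
      Matrix.adjugate_apply]
    congr 2
    ext i j
    by_cases hi : i = b
    · subst hi; simp [Pi.single_apply]
    · simp [hi]
  rw [h1]
  refine ((contDiffOn_det hh).inv hdet).mul (contDiffOn_det (h := fun i j x =>
    (if i = b then (if j = a then 1 else 0) else h i j x)) fun i j => ?_)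
  by_cases hi : i = b
  · simp only [hi, if_true]; exact contDiffOn_const
  · simp only [hi, if_false]; exact hh i j

lemma inverse_mul {n : Type} [Fintype n] [DecidableEq n] {h : n → n → Scalar} {x : Pt}
    (hdet : (Matrix.of fun a b => h a b x).det ≠ 0) (a c : n) :
    ∑ b, inverse h a b x * h b c x = if a = c then 1 else 0 := by
  have h1 := congrFun (congrFun (Matrix.nonsing_inv_mul (Matrix.of fun a b => h a b x)
    (isUnit_iff_ne_zero.mpr hdet)) a) c
  rwa [Matrix.mul_apply, Matrix.one_apply] at h1

lemma inverse_symm {n : Type} [Fintype n] [DecidableEq n] {h : n → n → Scalar} {x : Pt}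
    (hs : ∀ a b, h a b x = h b a x) (a b : n) : inverse h a b x = inverse h b a x := by
  have h1 : (Matrix.of fun a b => h a b x).transpose = Matrix.of fun a b => h a b x := by
    ext i j; exact hs j i
  have h2 := Matrix.transpose_nonsing_inv (Matrix.of fun a b => h a b x)
  rw [h1] at h2
  exact congrFun (congrFun h2 b) a

/-- A nondegenerate symmetric metric on the patch as a metric over the ring of smooth functions. -/
def metricAlgebra (V : Opens Pt) (g : Tensor2) (hg : ∀ a b, ContDiffOn ℝ ∞ (g a b) V)
    (hdet : ∀ x ∈ V, (Matrix.of fun a b => g a b x).det ≠ 0)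
    (hs : ∀ x ∈ V, x ∈ quadrant → ∀ a b, g a b x = g b a x) : MetricAlgebra (smoothRing V) where
  d := smoothRing.d
  d_comm := smoothRing.d_comm
  g a b := mk (g a b) (hg a b)
  gi a b := mk (inverse g a b) (contDiffOn_inverse hg hdet a b)
  g_symm a b := (rep_mk _ _).ext (rep_mk _ _) fun x hx hq => hs x hx hq a b
  gi_symm a b := (rep_mk _ _).ext (rep_mk _ _) fun x hx hq => inverse_symm (hs x hx hq) a b
  gi_g a c := by
    have h1 : Rep (V := V) (fun _ => if a = c then (1 : ℝ) else 0)
        (if a = c then 1 else 0 : smoothRing V) := by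
      by_cases h : a = c
      · simp only [h, if_true]; exact Rep.one
      · simp only [h, if_false]; exact Rep.zero
    exact (Rep.sum fun b => (rep_mk _ _).mul (rep_mk _ _)).ext h1
      fun x hx hq => inverse_mul (hdet x hx) a c

end AdSGauge

namespace AdSGauge
open TopologicalSpace (Opens)
open smoothRing

namespace MetricAlgebra

variable {S : Type*} [CommRing S] [Algebra ℝ S] (G : MetricAlgebra S)

def covUp (W : Fin 4 → S) (μ σ : Fin 4) : S := G.d μ (W σ) + ∑ l, G.Γ σ μ l * W l

def lower (W : Fin 4 → S) (μ : Fin 4) : S := ∑ ν, G.g μ ν * W ν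

/-- Lowering an index commutes with the covariant derivative, by metric compatibility. -/
lemma sum_g_covUp (W : Fin 4 → S) (k a : Fin 4) :
    ∑ σ, G.g σ a * G.covUp W k σ = G.D1 k (G.lower W) a := by
  have h1 : ∑ ν, (∑ τ, G.Γ τ k a * G.g τ ν) * W ν
      = ∑ τ, G.Γ τ k a * ∑ ν, G.g τ ν * W ν := by
    simp only [Finset.sum_mul, Finset.mul_sum]
    rw [Finset.sum_comm]
    exact Finset.sum_congr rfl fun _ _ => Finset.sum_congr rfl fun _ _ => by ring
  have h2 : ∑ ν, (∑ τ, G.Γ τ k ν * G.g a τ) * W ν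
      = ∑ σ, G.g a σ * ∑ l, G.Γ σ k l * W l := by
    simp only [Finset.sum_mul, Finset.mul_sum]
    rw [Finset.sum_comm]
    exact Finset.sum_congr rfl fun _ _ => Finset.sum_congr rfl fun _ _ => by ring
  rw [D1_apply]
  simp only [lower, map_sum, Derivation.leibniz, smul_eq_mul, d_g, covUp, mul_add,
    Finset.sum_add_distrib]
  simp only [mul_comm (W _), h1, h2, G.g_symm _ a]
  ring

lemma covUp_sub (W W' : Fin 4 → S) (μ σ : Fin 4) :
    G.covUp (fun σ => W σ - W' σ) μ σ = G.covUp W μ σ - G.covUp W' μ σ := by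
  simp only [covUp, map_sub, mul_sub, Finset.sum_sub_distrib]
  ring

def symGrad (W : Fin 4 → S) (μ ν : Fin 4) : S :=
  half S * ∑ σ, (G.g σ μ * G.covUp W ν σ + G.g σ ν * G.covUp W μ σ)

def ΓUp (ν : Fin 4) : S := ∑ μ, ∑ l, G.gi μ l * G.Γ ν μ l

/-- The gauge quantity `Q_μ` for the gauge source functions `F`. -/
def gaugeQ (F : Fin 4 → S) : Fin 4 → S := G.lower fun μ => G.ΓUp μ - F μ

lemma two_mul_symGrad_sub (F : Fin 4 → S) (μ ν : Fin 4) :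
    2 * (G.symGrad G.ΓUp μ ν - G.symGrad F μ ν)
      = G.D1 μ (G.gaugeQ F) ν + G.D1 ν (G.gaugeQ F) μ := by
  rw [gaugeQ, ← sum_g_covUp, ← sum_g_covUp]
  simp only [covUp_sub, mul_sub, Finset.sum_sub_distrib, symGrad, Finset.sum_add_distrib]
  linear_combination (∑ σ, G.g σ μ * G.covUp G.ΓUp ν σ + ∑ σ, G.g σ ν * G.covUp G.ΓUp μ σ
    - ∑ σ, G.g σ μ * G.covUp F ν σ - ∑ σ, G.g σ ν * G.covUp F μ σ) * two_mul_half (S := S)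

/-- The coefficients of the reduced wave operator. -/
def redCoeff (Φ : Fin 4 → Fin 4 → S) (r : S) (F : Fin 4 → S) (τ l : Fin 4) : S :=
  (2 * Φ τ l + algebraMap ℝ S (1 / 4) * r * G.g τ l - G.Ric τ l)
    - ∑ σ, G.g σ τ * G.covUp (fun ρ => F ρ - G.ΓUp ρ) l σ

/-- The metric equation turns the curvature part of the coefficient into a symmetrised gradient of
`Q`, leaving its antisymmetrised gradient. So the modification of the wave operator is itself a
gauge quantity. -/
lemma four_mul_redCoeff {Φ : Fin 4 → Fin 4 → S} {r : S} {F : Fin 4 → S}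
    (hmet : G.MetricEq Φ r (G.gaugeQ F)) (τ l : Fin 4) :
    4 * G.redCoeff Φ r F τ l = 2 * G.D1 l (G.gaugeQ F) τ - 2 * G.D1 τ (G.gaugeQ F) l := by
  have h1 : 4 * algebraMap ℝ S (1 / 4) = 1 := by
    have : (4 : S) = algebraMap ℝ S 4 := (map_ofNat _ _).symm
    rw [this, ← map_mul]; norm_num
  have h2 : ∑ σ, G.g σ τ * G.covUp (fun ρ => F ρ - G.ΓUp ρ) l σ = - G.D1 l (G.gaugeQ F) τ := by
    rw [gaugeQ, ← sum_g_covUp]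
    simp only [covUp_sub, mul_sub, Finset.sum_sub_distrib]
    ring
  rw [redCoeff, h2]
  linear_combination r * G.g τ l * h1 - hmet τ l

end MetricAlgebra

/-! ### Components of the geometric quantities as ring elements -/

variable {V : Opens Pt}

/-- The algebra `G` is the one of the metric `g`. -/
structure Represents (G : MetricAlgebra (smoothRing V)) (g : Tensor2) : Prop where
  d_eq : ∀ i s, G.d i s = smoothRing.d i s
  rep_g : ∀ a b, Rep (g a b) (G.g a b)
  rep_gi : ∀ a b, Rep (inverse g a b) (G.gi a b)

lemma represents_metricAlgebra {g : Tensor2} (hg : ∀ a b, ContDiffOn ℝ ∞ (g a b) V)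
    (hdet : ∀ x ∈ V, (Matrix.of fun a b => g a b x).det ≠ 0)
    (hs : ∀ x ∈ V, x ∈ quadrant → ∀ a b, g a b x = g b a x) :
    Represents (metricAlgebra V g hg hdet hs) g :=
  ⟨fun _ _ => rfl, fun a b => ⟨hg a b, fun _ => rfl⟩,
    fun a b => ⟨contDiffOn_inverse hg hdet a b, fun _ => rfl⟩⟩

namespace Represents

variable {G : MetricAlgebra (smoothRing V)} {g : Tensor2} (H : Represents G g)

include H

lemma pd {F : Scalar} {s : smoothRing V} (h : Rep F s) (i : Fin 4) :
    Rep (AdSGauge.pd i F) (G.d i s) := (h.pd i).congr_eq (H.d_eq i s).symm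

lemma christoffel (ν μ l : Fin 4) : Rep (christoffel g ν μ l) (G.Γ ν μ l) :=
  (Rep.const (1 / 2)).mul (Rep.sum fun ρ => (H.rep_gi ν ρ).mul
    (((H.pd (H.rep_g ρ l) μ).add (H.pd (H.rep_g μ ρ) l)).sub (H.pd (H.rep_g μ l) ρ)))

lemma contractedChristoffel (ν : Fin 4) : Rep (contractedChristoffel g ν) (G.ΓUp ν) := by
  have h : Rep (fun x => ∑ μ, ∑ l, inverse g μ l x * AdSGauge.christoffel g ν μ l x) (G.ΓUp ν) :=
    Rep.sum fun μ => Rep.sum fun l => (H.rep_gi μ l).mul (H.christoffel ν μ l)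
  exact h

lemma covVec {W : Tensor1} {w : Fin 4 → smoothRing V} (h : ∀ a, Rep (W a) (w a)) (μ σ : Fin 4) :
    Rep (covVec g W μ σ) (G.covUp w μ σ) :=
  (H.pd (h σ) μ).add (Rep.sum fun l => (H.christoffel σ μ l).mul (h l))

lemma cov1 {W : Tensor1} {w : Fin 4 → smoothRing V} (h : ∀ a, Rep (W a) (w a)) (μ ν : Fin 4) :
    Rep (cov1 g W μ ν) (G.D1 μ w ν) :=
  (H.pd (h ν) μ).sub (Rep.sum fun l => (H.christoffel l μ ν).mul (h l))

lemma cov2 {T : Tensor2} {t : Fin 4 → Fin 4 → smoothRing V} (h : ∀ a b, Rep (T a b) (t a b))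
    (l μ ν : Fin 4) : Rep (cov2 g T l μ ν) (G.D2 l t μ ν) :=
  (((H.pd (h μ ν) l).sub (Rep.sum fun τ => (H.christoffel τ l μ).mul (h τ ν))).sub
    (Rep.sum fun τ => (H.christoffel τ l ν).mul (h μ τ))).congr_eq (by
      rw [MetricAlgebra.D2_apply]; ring)

lemma covCov2 {T : Tensor2} {t : Fin 4 → Fin 4 → smoothRing V} (h : ∀ a b, Rep (T a b) (t a b))
    (k l μ ν : Fin 4) : Rep (covCov2 g T k l μ ν) (G.D3 k (fun l => G.D2 l t) l μ ν) :=
  ((((H.pd (H.cov2 h l μ ν) k).sub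
    (Rep.sum fun τ => (H.christoffel τ k l).mul (H.cov2 h τ μ ν))).sub
    (Rep.sum fun τ => (H.christoffel τ k μ).mul (H.cov2 h l τ ν))).sub
    (Rep.sum fun τ => (H.christoffel τ k ν).mul (H.cov2 h l μ τ))).congr_eq (by
      rw [MetricAlgebra.D3_apply]; ring)

lemma box2 {T : Tensor2} {t : Fin 4 → Fin 4 → smoothRing V} (h : ∀ a b, Rep (T a b) (t a b))
    (μ ν : Fin 4) : Rep (box2 g T μ ν) (G.boxT t μ ν) :=
  Rep.sum fun k => Rep.sum fun l => (H.rep_gi k l).mul (H.covCov2 h k l μ ν)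

lemma hessian {f : Scalar} {s : smoothRing V} (h : Rep f s) (μ ν : Fin 4) :
    Rep (hessian g f μ ν) (G.D1 μ (fun l => G.d l s) ν) :=
  H.cov1 (fun l => H.pd h l) μ ν

lemma box0 {f : Scalar} {s : smoothRing V} (h : Rep f s) : Rep (box0 g f) (G.box0 s) :=
  Rep.sum fun μ => Rep.sum fun ν => (H.rep_gi μ ν).mul (H.hessian h μ ν)

lemma riemann (σ μ l ν : Fin 4) : Rep (riemann g σ μ l ν) (G.riem σ μ l ν) :=
  (((H.pd (H.christoffel σ ν μ) l).sub (H.pd (H.christoffel σ l μ) ν)).add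
    (Rep.sum fun τ => (H.christoffel σ l τ).mul (H.christoffel τ ν μ))).sub
    (Rep.sum fun τ => (H.christoffel σ ν τ).mul (H.christoffel τ l μ))

lemma riemannLow (σ μ l ν : Fin 4) : Rep (riemannLow g σ μ l ν) (G.RL σ μ l ν) :=
  Rep.sum fun ρ => (H.rep_g σ ρ).mul (H.riemann ρ μ l ν)

lemma ricci (μ ν : Fin 4) : Rep (ricci g μ ν) (G.Ric μ ν) :=
  Rep.sum fun σ => H.riemann σ μ σ ν

lemma scalarCurv : Rep (scalarCurv g) G.Rs :=
  Rep.sum fun μ => Rep.sum fun ν => (H.rep_gi μ ν).mul (H.ricci μ ν)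

lemma schouten (μ ν : Fin 4) : Rep (schouten g μ ν) (G.schouten μ ν) :=
  (Rep.const (1 / 2)).mul ((H.ricci μ ν).sub (((Rep.const (1 / 6)).mul H.scalarCurv).mul (H.rep_g μ ν)))

lemma weyl (a b c e : Fin 4) : Rep (weyl g a b c e) (G.weyl a b c e) :=
  (H.riemannLow a b c e).sub (((((H.rep_g a c).mul (H.schouten b e)).sub
    ((H.rep_g a e).mul (H.schouten b c))).sub ((H.rep_g b c).mul (H.schouten a e))).add
    ((H.rep_g b e).mul (H.schouten a c)))

lemma tr {T : Tensor2} {t : Fin 4 → Fin 4 → smoothRing V} (h : ∀ a b, Rep (T a b) (t a b)) :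
    Rep (fun x => ∑ a, ∑ b, inverse g a b x * T a b x) (G.tr t) :=
  Rep.sum fun a => Rep.sum fun b => (H.rep_gi a b).mul (h a b)

lemma normSq {Φ : Tensor2} {φ : Fin 4 → Fin 4 → smoothRing V} (h : ∀ a b, Rep (Φ a b) (φ a b)) :
    Rep (normSq g Φ) (G.normSq φ) := by
  have h1 : Rep (AdSGauge.normSq g Φ) _ := Rep.sum fun a => Rep.sum fun b => Rep.sum fun c =>
    Rep.sum fun e => (((H.rep_gi a c).mul (H.rep_gi b e)).mul (h a b)).mul (h c e)
  refine h1.congr_eq ?_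
  simp only [MetricAlgebra.normSq, MetricAlgebra.tr, smul_eq_mul, Finset.mul_sum]
  refine Finset.sum_congr rfl fun a _ => ?_
  rw [Finset.sum_comm]
  exact Finset.sum_congr rfl fun c _ => Finset.sum_congr rfl fun b _ =>
    Finset.sum_congr rfl fun e _ => by ring

lemma QDown {F : Tensor1} {f : Fin 4 → smoothRing V} (h : ∀ a, Rep (F a) (f a)) (μ : Fin 4) :
    Rep (QDown g F μ) (G.gaugeQ f μ) :=
  Rep.sum fun ν => (H.rep_g μ ν).mul ((H.contractedChristoffel ν).sub (h ν))

lemma symGrad {W : Tensor1} {w : Fin 4 → smoothRing V} (h : ∀ a, Rep (W a) (w a)) (μ ν : Fin 4) :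
    Rep (symGrad g W μ ν) (G.symGrad w μ ν) :=
  (Rep.const (1 / 2)).mul (Rep.sum fun σ => ((H.rep_g σ μ).mul (H.covVec h ν σ)).add
    ((H.rep_g σ ν).mul (H.covVec h μ σ)))

variable {Φ : Tensor2} {φ : Fin 4 → Fin 4 → smoothRing V} (hφ : ∀ a b, Rep (Φ a b) (φ a b))
  {R : Scalar} {r : smoothRing V} (hr : Rep R r)
  {F : Tensor1} {f : Fin 4 → smoothRing V} (hf : ∀ a, Rep (F a) (f a))

include hφ hr hf

lemma reductionCoeff (τ l : Fin 4) :
    Rep (reductionCoeff g Φ R F τ l) (G.redCoeff φ r f τ l) :=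
  ((((Rep.ofNat 2).mul (hφ τ l)).add (((Rep.const (1 / 4)).mul hr).mul (H.rep_g τ l))).sub
    (H.ricci τ l)).sub (Rep.sum fun σ => (H.rep_g σ τ).mul
      (H.covVec (fun ρ => (hf ρ).sub (H.contractedChristoffel ρ)) l σ))

variable {Ξ : Scalar} {dW : Tensor4} {D : Set Pt}
  (hsol : IsReducedSolution D g Φ R F Ξ dW) (hD : ∀ x ∈ V, x ∈ quadrant → x ∈ D)
include hsol hD

lemma metricEq : G.MetricEq φ r (G.gaugeQ f) := by
  intro μ ν
  have h1 : G.Ric μ ν - G.symGrad G.ΓUp μ ν + G.symGrad f μ ν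
      = 2 * φ μ ν + algebraMap ℝ _ (1 / 4) * r * G.g μ ν :=
    (((H.ricci μ ν).sub (H.symGrad H.contractedChristoffel μ ν)).add (H.symGrad hf μ ν)).ext
      (((Rep.ofNat 2).mul (hφ μ ν)).add (((Rep.const (1 / 4)).mul hr).mul (H.rep_g μ ν)))
      fun x hx hq => hsol.metricEq x (hD x hx hq) μ ν
  have h2 : 4 * algebraMap ℝ (smoothRing V) (1 / 4) = 1 := by
    have : (4 : smoothRing V) = algebraMap ℝ _ 4 := (map_ofNat _ _).symm
    rw [this, ← map_mul]; norm_num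
  linear_combination 4 * h1 + 2 * G.two_mul_symGrad_sub f μ ν + r * G.g μ ν * h2

/-- The factor `Ξ` occurs only in the product `Ξ d`, which is replaced by the Weyl tensor, so
nothing is divided by `Ξ`. -/
lemma waveEq : G.WaveEq φ (G.redCoeff φ r f) r := by
  intro μ ν
  have hW : Rep (fun x => ∑ l, ∑ a, inverse g l a x * ∑ ρ, ∑ b, inverse g ρ b x *
      (AdSGauge.weyl g μ l ν ρ x * Φ a b x))
      (G.tr fun l a => G.tr fun ρ b => G.weyl μ l ν ρ * φ a b) :=
    H.tr fun l a => H.tr fun ρ b => (H.weyl μ l ν ρ).mul (hφ a b)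
  have hP := H.tr fun l ρ => (hφ μ ρ).mul (hφ ν l)
  have hA := H.reductionCoeff hφ hr hf
  refine ((((Rep.ofNat 24).mul (H.box2 hφ μ ν)).add ((Rep.ofNat 24).mul (Rep.sum fun τ =>
    (hA τ μ).mul (Rep.sum fun ρ => (H.rep_gi τ ρ).mul (hφ ρ ν))))).add
    ((Rep.ofNat 24).mul (Rep.sum fun τ => (hA τ ν).mul (Rep.sum fun ρ => (H.rep_gi τ ρ).mul
    (hφ μ ρ))))).ext ((((((Rep.ofNat 96).mul hP).sub (((Rep.ofNat 24).mul (H.rep_g μ ν)).mul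
    (H.normSq hφ))).sub ((Rep.ofNat 48).mul hW)).add (((Rep.ofNat 8).mul hr).mul (hφ μ ν))).sub
    ((H.rep_g μ ν).mul (H.box0 hr)) |>.add ((Rep.ofNat 4).mul (H.hessian hr μ ν))) fun x hx hq => ?_
  have h1 := hsol.waveEq x (hD x hx hq) μ ν
  have h2 : Ξ x * (∑ l, ∑ ρ, ∑ a, ∑ b, dW μ l ν ρ x * inverse g l a x * inverse g ρ b x * Φ a b x)
      = ∑ l, ∑ a, inverse g l a x * ∑ ρ, ∑ b, inverse g ρ b x *
      (AdSGauge.weyl g μ l ν ρ x * Φ a b x) := by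
    simp only [Finset.mul_sum]
    refine Finset.sum_congr rfl fun l _ => ?_
    rw [Finset.sum_comm]
    refine Finset.sum_congr rfl fun a _ => Finset.sum_congr rfl fun ρ _ =>
      Finset.sum_congr rfl fun b _ => ?_
    rw [← hsol.rescaledWeyl x (hD x hx hq)]
    ring
  have h3 : ∑ l, ∑ ρ, inverse g l ρ x * Φ μ ρ x * Φ ν l x
      = ∑ l, ∑ ρ, inverse g l ρ x * (Φ μ ρ x * Φ ν l x) := by
    simp only [mul_assoc]
  rw [reducedBox2, waveSource, h3] at h1
  linear_combination 24 * h1 - 48 * h2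

end Represents

end AdSGauge

/-! ### Closure of the subsidiary system -/

namespace AdSGauge
open TopologicalSpace (Opens)
open Asymptotics Filter
open smoothRing

namespace MetricAlgebra

variable {S : Type*} [CommRing S] [Algebra ℝ S] (G : MetricAlgebra S)

/-- The ideal generated by the elements of `J` and their first derivatives. -/
def prolong (J : Ideal S) : Ideal S := Ideal.span {f | f ∈ J ∨ ∃ k, ∃ h ∈ J, f = G.d k h}

lemma le_prolong (J : Ideal S) : J ≤ G.prolong J := fun _ h => Ideal.subset_span (Or.inl h)

lemma d_mem_prolong {J : Ideal S} (k : Fin 4) {f : S} (h : f ∈ J) : G.d k f ∈ G.prolong J :=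
  Ideal.subset_span (Or.inr ⟨k, f, h, rfl⟩)

/-- By the Leibniz rule it suffices to differentiate the generators. -/
lemma prolong_span_le {X : Set S} {K : Ideal S} (h0 : ∀ f ∈ X, f ∈ K)
    (h1 : ∀ k, ∀ f ∈ X, G.d k f ∈ K) : G.prolong (Ideal.span X) ≤ K := by
  have hX : Ideal.span X ≤ K := Ideal.span_le.mpr h0
  refine Ideal.span_le.mpr ?_
  rintro f (hf | ⟨k, h, hh, rfl⟩)
  · exact hX hf
  · change G.d k h ∈ K
    induction hh using Submodule.span_induction with
    | mem f hf => exact h1 k f hf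
    | zero => rw [map_zero]; exact K.zero_mem
    | add f f' _ _ hf hf' => rw [map_add]; exact K.add_mem hf hf'
    | smul s f hf hd =>
      rw [smul_eq_mul, Derivation.leibniz]
      exact K.add_mem (K.mul_mem_left _ hd) (K.mul_mem_right _ (hX hf))

/-- The second order part `g^{ab} ∂_a ∂_b` of the wave operator. -/
def waveSymbol (f : S) : S := ∑ a, ∑ b, G.gi a b * G.d a (G.d b f)

/-- The covariant and the coordinate wave operator have the same second order part. -/
lemma box1_sub_waveSymbol_mem {J : Ideal S} {w : Fin 4 → S} (h0 : ∀ a, w a ∈ J)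
    (h1 : ∀ k a, G.d k (w a) ∈ J) (ν : Fin 4) : G.box1 w ν - G.waveSymbol (w ν) ∈ J := by
  have hD : ∀ l a, G.D1 l w a ∈ J := fun l a => by
    rw [D1_apply]
    exact J.sub_mem (h1 l a) (J.sum_mem fun τ _ => J.mul_mem_left _ (h0 τ))
  have e : G.box1 w ν - G.waveSymbol (w ν)
      = G.tr fun k l => G.D2 k (fun l => G.D1 l w) l ν - G.d k (G.d l (w ν)) := by
    rw [tr_sub]; rfl
  rw [e]
  refine tr_mem fun k l => ?_
  have e2 : G.D2 k (fun l => G.D1 l w) l ν - G.d k (G.d l (w ν))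
      = - (∑ τ, G.d k (G.Γ τ l ν * w τ)) - ∑ τ, G.Γ τ k l * G.D1 τ w ν
        - ∑ τ, G.Γ τ k ν * G.D1 l w τ := by
    rw [D2_apply, G.D1_apply l ν w, map_sub, map_sum]; ring
  rw [e2]
  refine J.sub_mem (J.sub_mem (J.neg_mem (J.sum_mem fun τ _ => ?_))
    (J.sum_mem fun τ _ => J.mul_mem_left _ (hD _ _))) (J.sum_mem fun τ _ => J.mul_mem_left _ (hD _ _))
  rw [Derivation.leibniz]
  exact J.add_mem (J.mul_mem_left _ (h1 _ _)) (J.mul_mem_right _ (h0 _))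

section system

variable {G} {Φ : Fin 4 → Fin 4 → S} {r : S} {F : Fin 4 → S}

variable (G Φ r F) in
/-- The gauge quantities, their derivatives in the directions other than `x¹`, and the divergence
defect. -/
def gaugeSystem : Fin 4 ⊕ (ScriIdx × Fin 4) ⊕ Fin 4 → S :=
  Sum.elim (G.gaugeQ F) (Sum.elim (fun p => G.d p.1 (G.gaugeQ F p.2)) (G.divDefect Φ r))

variable (hsymm : ∀ a b, Φ a b = Φ b a) (htr : G.tr Φ = 0) (hmet : G.MetricEq Φ r (G.gaugeQ F))
  (hwave : G.WaveEq Φ (G.redCoeff Φ r F) r) (hu : IsUnit (G.gi 1 1))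

include hsymm htr hmet hwave hu

/-- The gauge system is closed: its wave operator is of first order in the unknowns. -/
lemma waveSymbol_gaugeSystem_mem {K : Ideal S} (h0 : ∀ I, G.gaugeSystem Φ r F I ∈ K)
    (h1 : ∀ k I, G.d k (G.gaugeSystem Φ r F I) ∈ K) (I) :
    G.waveSymbol (G.gaugeSystem Φ r F I) ∈ K := by
  set Q := G.gaugeQ F with hQ
  set Y := G.divDefect Φ r with hY
  -- `J₁` is generated by `Y` and the first jet of `Q`. The wave operators of `Q` lie in it, those
  -- of `Y` and `∂Q` in its prolongation; it remains to show that the prolongation lies in `K`.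
  let X : Set S := {f | (∃ a, f = Q a) ∨ (∃ a, f = Y a) ∨ ∃ k a, f = G.d k (Q a)}
  let J₁ : Ideal S := Ideal.span X
  have q0 : ∀ a, Q a ∈ J₁ := fun a => Ideal.subset_span (Or.inl ⟨a, rfl⟩)
  have y0 : ∀ a, Y a ∈ J₁ := fun a => Ideal.subset_span (Or.inr (Or.inl ⟨a, rfl⟩))
  have q1 : ∀ k a, G.d k (Q a) ∈ J₁ := fun k a => Ideal.subset_span (Or.inr (Or.inr ⟨k, a, rfl⟩))
  have dQ : ∀ k a, G.D1 k Q a ∈ J₁ := fun k a => by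
    rw [D1_apply]
    exact J₁.sub_mem (q1 k a) (J₁.sum_mem fun τ _ => J₁.mul_mem_left _ (q0 τ))
  have hA : ∀ a b, G.redCoeff Φ r F a b ∈ J₁ := fun a b => by
    refine natCast_mul_mem 4 (by norm_num) ?_
    have := G.four_mul_redCoeff hmet a b
    rw [Nat.cast_ofNat, this]
    exact J₁.sub_mem (J₁.mul_mem_left _ (dQ _ _)) (J₁.mul_mem_left _ (dQ _ _))
  have sQ : ∀ ν, G.waveSymbol (Q ν) ∈ J₁ := fun ν => by
    have b1 : G.box1 Q ν ∈ J₁ := by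
      refine natCast_mul_mem 2 (by norm_num) ?_
      have h := hmet.box1_Q htr ν
      have e : ((2 : ℕ) : S) * G.box1 Q ν = - Y ν - 2 * (G.tr fun ρ σ => G.Ric ρ ν * Q σ) := by
        push_cast
        linear_combination h
      rw [e]
      exact J₁.sub_mem (J₁.neg_mem (y0 ν)) (J₁.mul_mem_left _ (tr_mem fun ρ σ =>
        J₁.mul_mem_left _ (q0 σ)))
    have := J₁.sub_mem b1 (G.box1_sub_waveSymbol_mem q0 q1 ν)
    simpa using this
  have sY : ∀ ν, G.waveSymbol (Y ν) ∈ G.prolong J₁ := fun ν => by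
    have b1 : G.box1 Y ν ∈ G.prolong J₁ := box1_divDefect_mem hsymm htr hmet (G.le_prolong J₁)
      (fun k f hf => G.d_mem_prolong k hf) dQ y0 hwave hA ν
    have := (G.prolong J₁).sub_mem b1 (G.box1_sub_waveSymbol_mem (fun a => G.le_prolong J₁ (y0 a))
      (fun k a => G.d_mem_prolong k (y0 a)) ν)
    simpa using this
  have sD : ∀ i ν, G.waveSymbol (G.d i (Q ν)) ∈ G.prolong J₁ := fun i ν => by
    have e : G.waveSymbol (G.d i (Q ν)) = G.d i (G.waveSymbol (Q ν))
        - ∑ a, ∑ b, G.d i (G.gi a b) * G.d a (G.d b (Q ν)) := by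
      simp only [waveSymbol, map_sum, Derivation.leibniz, smul_eq_mul, ← Finset.sum_sub_distrib]
      refine Finset.sum_congr rfl fun a _ => Finset.sum_congr rfl fun b _ => ?_
      rw [G.d_comm i a, G.d_comm i b]
      ring
    rw [e]
    exact Ideal.sub_mem _ (G.d_mem_prolong i (sQ ν)) (Ideal.sum_mem _ fun a _ =>
      Ideal.sum_mem _ fun b _ => Ideal.mul_mem_left _ _ (G.d_mem_prolong a (q1 b ν)))
  have kQ : ∀ a, Q a ∈ K := fun a => h0 (Sum.inl a)
  have kY : ∀ a, Y a ∈ K := fun a => h0 (Sum.inr (Sum.inr a))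
  have kdQ : ∀ k a, G.d k (Q a) ∈ K := fun k a => h1 k (Sum.inl a)
  have hX : ∀ f ∈ X, f ∈ K := by
    rintro f (⟨a, rfl⟩ | ⟨a, rfl⟩ | ⟨k, a, rfl⟩)
    exacts [kQ a, kY a, kdQ k a]
  have kdd : ∀ k l a, l ≠ 1 → G.d k (G.d l (Q a)) ∈ K := fun k l a hl =>
    h1 k (Sum.inr (Sum.inl (⟨l, hl⟩, a)))
  have kdd' : ∀ k l a, k ≠ 1 ∨ l ≠ 1 → G.d k (G.d l (Q a)) ∈ K := by
    rintro k l a (h | h)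
    · rw [G.d_comm]; exact kdd _ _ _ h
    · exact kdd _ _ _ h
  -- The one second derivative that is not a derivative of an unknown. It is isolated in the wave
  -- equation for `Q`, where its coefficient `g^{11}` is a unit.
  have k11 : ∀ a, G.d 1 (G.d 1 (Q a)) ∈ K := fun a => by
    have e : G.gi 1 1 * G.d 1 (G.d 1 (Q a)) = G.waveSymbol (Q a) - ∑ k, ∑ l,
        if k = 1 ∧ l = 1 then 0 else G.gi k l * G.d k (G.d l (Q a)) := by
      simp only [waveSymbol, ← Finset.sum_sub_distrib]
      rw [Finset.sum_eq_single 1, Finset.sum_eq_single 1]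
      · simp
      · intro b _ hb; simp [hb]
      · simp
      · intro b _ hb; simp [hb]
      · simp
    have hm : G.gi 1 1 * G.d 1 (G.d 1 (Q a)) ∈ K := by
      rw [e]
      refine K.sub_mem (Ideal.span_le.mpr hX (sQ a)) (K.sum_mem fun k _ => K.sum_mem fun l _ => ?_)
      split_ifs with h
      · exact K.zero_mem
      · exact K.mul_mem_left _ (kdd' _ _ _ (not_and_or.mp h))
    exact (K.unit_mul_mem_iff_mem hu).mp hm
  have hJ : G.prolong J₁ ≤ K := by
    refine G.prolong_span_le hX ?_
    rintro k f (⟨a, rfl⟩ | ⟨a, rfl⟩ | ⟨l, a, rfl⟩)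
    · exact kdQ k a
    · exact h1 k (Sum.inr (Sum.inr a))
    · by_cases h : k ≠ 1 ∨ l ≠ 1
      · exact kdd' _ _ _ h
      · push Not at h
        rw [h.1, h.2]; exact k11 a
  rcases I with a | ⟨i, a⟩ | a
  · exact hJ (G.le_prolong _ (sQ a))
  · exact hJ (sD i a)
  · exact hJ (sY a)

end system

end MetricAlgebra

/-! ### Bounds on compact sets -/

variable {V : Opens Pt}

lemma Rep.isBigO_one {F : Scalar} {s : smoothRing V} (h : Rep F s) {K : Set Pt} (hK : IsCompact K)
    (hKV : K ⊆ V) : F =O[𝓟 K] fun _ => (1 : ℝ) := by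
  obtain ⟨C, hC⟩ := hK.exists_bound_of_continuousOn (h.smooth.continuousOn.mono hKV)
  exact IsBigO.of_bound C (by
    rw [eventually_principal]
    intro x hx
    simpa using hC x hx)

/-- The functions which are bounded by `N` on compact sets. -/
def boundIdeal (V : Opens Pt) (N : Scalar) : Ideal (smoothRing V) where
  carrier := {s | ∀ K : Set Pt, IsCompact K → K ⊆ V → K ⊆ quadrant → rep s =O[𝓟 K] N}
  add_mem' := by
    intro s t hs ht K hK hV hq
    refine ((hs K hK hV hq).add (ht K hK hV hq)).congr' ?_ EventuallyEq.rfl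
    filter_upwards [mem_principal_self K] with x hx
    exact ((rep_rep s).add (rep_rep t)).eval_eq (rep_rep (s + t)) (hV hx) (hq hx)
  zero_mem' := by
    intro K hK hV hq
    refine (isBigO_zero N _).congr' ?_ EventuallyEq.rfl
    filter_upwards [mem_principal_self K] with x hx
    exact Rep.zero.eval_eq (rep_rep 0) (hV hx) (hq hx)
  smul_mem' := by
    intro s t ht K hK hV hq
    have h := ((rep_rep s).isBigO_one hK hV).mul (ht K hK hV hq)
    simp only [one_mul] at h
    refine h.congr' ?_ EventuallyEq.rfl
    filter_upwards [mem_principal_self K] with x hx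
    exact ((rep_rep s).mul (rep_rep t)).eval_eq (rep_rep (s * t)) (hV hx) (hq hx)

lemma Rep.mem_boundIdeal_iff {N F : Scalar} {s : smoothRing V} (h : Rep F s) :
    s ∈ boundIdeal V N ↔
      ∀ K : Set Pt, IsCompact K → K ⊆ V → K ⊆ quadrant → F =O[𝓟 K] N := by
  refine forall_congr' fun K => forall_congr' fun _ => forall_congr' fun hV =>
    forall_congr' fun hq => isBigO_congr ?_ EventuallyEq.rfl
  filter_upwards [mem_principal_self K] with x hx
  exact (rep_rep s).eval_eq h (hV hx) (hq hx)

lemma Represents.waveOp {G : MetricAlgebra (smoothRing V)} {g : Tensor2} (H : Represents G g)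
    {f : Scalar} {s : smoothRing V} (h : Rep f s) :
    Rep (waveOp (inverse g) f) (G.waveSymbol s) :=
  Rep.sum fun a => Rep.sum fun b => (H.rep_gi a b).mul (H.pd (H.pd h b) a)

/-- The membership is used for the ideal of functions bounded by the root of the total energy
density, which contains every unknown and its first derivatives. -/
lemma Represents.isBigO_waveOp {G : MetricAlgebra (smoothRing V)} {g : Tensor2}
    (H : Represents G g) {ι : Type*} [Fintype ι] {u : ι → Scalar} {s : ι → smoothRing V}
    (hu : ∀ I, Rep (u I) (s I))
    (hmem : ∀ K : Ideal (smoothRing V), (∀ I, s I ∈ K) → (∀ k I, G.d k (s I) ∈ K) →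
      ∀ I, G.waveSymbol (s I) ∈ K)
    (K : Set Pt) (hK : IsCompact K) (hV : K ⊆ V) (hq : K ⊆ quadrant) (I : ι) :
    AdSGauge.waveOp (inverse g) (u I) =O[𝓟 K] fun x => √(∑ J, energyDensity (u J) x) := by
  have hb : ∀ (I : ι) (f : Scalar), (∀ x, f x ^ 2 ≤ energyDensity (u I) x) → ∀ K : Set Pt,
      f =O[𝓟 K] fun x => √(∑ J, energyDensity (u J) x) := by
    intro I f hf K
    refine IsBigO.of_bound 1 (Eventually.of_forall fun x => ?_)
    rw [one_mul, Real.norm_of_nonneg (Real.sqrt_nonneg _), Real.norm_eq_abs]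
    refine Real.abs_le_sqrt ((hf x).trans ?_)
    exact Finset.single_le_sum (f := fun J => energyDensity (u J) x)
      (fun J _ => energyDensity_nonneg _ _) (Finset.mem_univ I)
  refine (H.waveOp (hu I)).mem_boundIdeal_iff.mp (hmem _ (fun I => ?_) (fun k I => ?_) I) K hK hV hq
  · exact (hu I).mem_boundIdeal_iff.mpr fun K _ _ _ => hb I _ (fun x =>
      le_add_of_nonneg_right (Finset.sum_nonneg fun c _ => sq_nonneg _)) K
  · exact (H.pd (hu I) k).mem_boundIdeal_iff.mpr fun K _ _ _ => hb I _ (fun x =>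
      (Finset.single_le_sum (f := fun c => AdSGauge.pd c (u I) x ^ 2) (fun c _ => sq_nonneg _)
        (Finset.mem_univ k)).trans (le_add_of_nonneg_left (sq_nonneg _))) K

end AdSGauge

/-! ### Vanishing on the initial surface -/

namespace AdSGauge
open TopologicalSpace (Opens)
open smoothRing

namespace MetricAlgebra

variable {S : Type*} [CommRing S] [Algebra ℝ S] (G : MetricAlgebra S)

/-- The elements of `J` whose `x⁰`-derivatives up to order `m` lie in `J`. -/
def jet (J : Ideal S) : ℕ → Ideal S
  | 0 => J
  | m + 1 =>
    { carrier := {f | f ∈ jet J m ∧ G.d 0 f ∈ jet J m}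
      add_mem' := fun {a b} ha hb => ⟨Ideal.add_mem _ ha.1 hb.1, by
        rw [map_add]; exact Ideal.add_mem _ ha.2 hb.2⟩
      zero_mem' := ⟨Ideal.zero_mem _, by rw [map_zero]; exact Ideal.zero_mem _⟩
      smul_mem' := fun c f hf => ⟨Ideal.mul_mem_left _ _ hf.1, by
        rw [smul_eq_mul, Derivation.leibniz]
        exact Ideal.add_mem _ (Ideal.mul_mem_left _ _ hf.2) (Ideal.mul_mem_right _ _ hf.1)⟩ }

/-- The derivative of a function along the vector field `n`. -/
def along (n : Fin 4 → S) (f : S) : S := ∑ l, n l * G.d l f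

/-- The Lie derivative of a covector along the vector field `n`. -/
def lie (n w : Fin 4 → S) (μ : Fin 4) : S := ∑ l, (n l * G.d l (w μ) + w l * G.d μ (n l))

section

variable {G} {J : Ideal S} (hJ : ∀ k, k ≠ 0 → ∀ f ∈ J, G.d k f ∈ J)

include hJ

lemma d_mem_jet_of_ne {k : Fin 4} (hk : k ≠ 0) :
    ∀ (m : ℕ) {f : S}, f ∈ G.jet J m → G.d k f ∈ G.jet J m
  | 0, f, hf => hJ k hk f hf
  | m + 1, f, hf => ⟨d_mem_jet_of_ne hk m hf.1, by
      rw [G.d_comm]; exact d_mem_jet_of_ne hk m hf.2⟩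

lemma d_mem_jet (k : Fin 4) {m : ℕ} {f : S} (hf : f ∈ G.jet J (m + 1)) : G.d k f ∈ G.jet J m := by
  by_cases hk : k = 0
  · rw [hk]; exact hf.2
  · exact d_mem_jet_of_ne hJ hk m hf.1

variable {n : Fin 4 → S} (hn : IsUnit (n 0))
include hn

/-- The other components of `n` only bring in tangential derivatives, which preserve the jet ideal,
and `n⁰` can be divided out. -/
lemma d_mem_jet_of_along {m : ℕ} {f : S} (hf : f ∈ G.jet J m) (h : G.along n f ∈ G.jet J m) :
    G.d 0 f ∈ G.jet J m := by
  refine (Ideal.unit_mul_mem_iff_mem _ hn).mp ?_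
  have e : n 0 * G.d 0 f = G.along n f - ∑ l, if l = 0 then 0 else n l * G.d l f := by
    rw [along, ← Finset.sum_sub_distrib, Finset.sum_eq_single 0]
    · simp
    · intro b _ hb; simp [hb]
    · simp
  rw [e]
  refine Ideal.sub_mem _ h (Ideal.sum_mem _ fun l _ => ?_)
  split_ifs with hl
  · exact Ideal.zero_mem _
  · exact Ideal.mul_mem_left _ _ (d_mem_jet_of_ne hJ hl m hf)

lemma mem_jet_of_along : ∀ (m : ℕ) {f : S}, (∀ j ≤ m, (G.along n)^[j] f ∈ J) → f ∈ G.jet J m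
  | 0, f, h => h 0 le_rfl
  | m + 1, f, h => by
    have h1 := mem_jet_of_along m fun j hj => h j (hj.trans m.le_succ)
    refine ⟨h1, d_mem_jet_of_along hJ hn h1 (mem_jet_of_along m fun j hj => ?_)⟩
    have := h (j + 1) (Nat.succ_le_succ hj)
    rwa [Function.iterate_succ_apply] at this

/-- The Lie derivative differs from the componentwise derivative by terms of order zero in `w`. They
involve all components, so the induction runs over all of them at once. -/
lemma mem_jet_of_lie : ∀ (m : ℕ) {w : Fin 4 → S}, (∀ j ≤ m, ∀ μ, (G.lie n)^[j] w μ ∈ J) →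
    ∀ μ, w μ ∈ G.jet J m
  | 0, w, h, μ => h 0 le_rfl μ
  | m + 1, w, h, μ => by
    have h1 := mem_jet_of_lie m fun j hj => h j (hj.trans m.le_succ)
    have h2 : ∀ μ, G.lie n w μ ∈ G.jet J m := mem_jet_of_lie m fun j hj => by
      have := h (j + 1) (Nat.succ_le_succ hj)
      rwa [Function.iterate_succ_apply] at this
    refine ⟨h1 μ, d_mem_jet_of_along hJ hn (h1 μ) ?_⟩
    have e : G.along n (w μ) = G.lie n w μ - ∑ l, w l * G.d μ (n l) := by
      rw [lie, along, Finset.sum_add_distrib]; ring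
    rw [e]
    exact Ideal.sub_mem _ (h2 μ) (Ideal.sum_mem _ fun l _ => Ideal.mul_mem_right _ _ (h1 l))

omit hn in
/-- If the gauge quantities vanish to third order, then the gauge system vanishes to first order. -/
lemma gaugeSystem_mem_jet {Φ : Fin 4 → Fin 4 → S} {r : S} {F : Fin 4 → S} (htr : G.tr Φ = 0)
    (hmet : G.MetricEq Φ r (G.gaugeQ F)) (hQ : ∀ a, G.gaugeQ F a ∈ G.jet J 3) (I) :
    G.gaugeSystem Φ r F I ∈ G.jet J 1 := by
  have h1 : ∀ k a, G.d k (G.gaugeQ F a) ∈ G.jet J 2 := fun k a => d_mem_jet hJ k (hQ a)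
  have hQ1 : ∀ a, G.gaugeQ F a ∈ G.jet J 1 := fun a => (hQ a).1.1
  rcases I with a | ⟨i, a⟩ | a
  · exact hQ1 a
  · exact (h1 i a).1
  · have h2 := G.box1_sub_waveSymbol_mem hQ1 (fun k a => (h1 k a).1) a
    have h3 : G.waveSymbol (G.gaugeQ F a) ∈ G.jet J 1 := Ideal.sum_mem _ fun k _ =>
      Ideal.sum_mem _ fun l _ => Ideal.mul_mem_left _ _ (d_mem_jet hJ k (h1 l a))
    -- The defect is read off from the wave equation for `Q`; two derivatives reduce the order of
    -- vanishing from 3 to 1.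
    have e : G.divDefect Φ r a = - (2 * ((G.box1 (G.gaugeQ F) a - G.waveSymbol (G.gaugeQ F a))
        + G.waveSymbol (G.gaugeQ F a)) + 2 * (G.tr fun ρ σ => G.Ric ρ a * G.gaugeQ F σ)) := by
      linear_combination hmet.box1_Q htr a
    change G.divDefect Φ r a ∈ _
    rw [e]
    exact neg_mem (Ideal.add_mem _ (Ideal.mul_mem_left _ _ (Ideal.add_mem _ h2 h3))
      (Ideal.mul_mem_left _ _ (tr_mem fun ρ σ => Ideal.mul_mem_left _ _ (hQ1 σ))))

end

/-- The conormal of the level sets of `xⁱ` for the lapse `N`, with `c = ε N`. -/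
def conormal (i : Fin 4) (c : S) (μ : Fin 4) : S := if μ = i then c else 0

/-- The normal of the level sets of `xⁱ`. -/
def normal (i : Fin 4) (c : S) (μ : Fin 4) : S := ∑ ν, G.gi μ ν * conormal i c ν

lemma normal_eq (i : Fin 4) (c : S) (μ : Fin 4) : G.normal i c μ = G.gi μ i * c := by
  simp [normal, conormal]

def projector (ε : ℝ) (i : Fin 4) (c : S) (μ ν : Fin 4) : S :=
  (if μ = ν then 1 else 0) - algebraMap ℝ S ε * conormal i c μ * G.normal i c ν

def normalPart (i : Fin 4) (c : S) (w : Fin 4 → S) : S := ∑ ν, G.normal i c ν * w ν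

def tangentialPart (ε : ℝ) (i : Fin 4) (c : S) (w : Fin 4 → S) (μ : Fin 4) : S :=
  ∑ ν, G.projector ε i c μ ν * w ν

lemma tangentialPart_eq (ε : ℝ) (i : Fin 4) (c : S) (w : Fin 4 → S) (μ : Fin 4) :
    G.tangentialPart ε i c w μ = w μ - algebraMap ℝ S ε * conormal i c μ * G.normalPart i c w := by
  simp only [tangentialPart, projector, sub_mul, Finset.sum_sub_distrib, normalPart, Finset.mul_sum]
  simp [mul_assoc]

end MetricAlgebra

variable {V : Opens Pt}

lemma Rep.isUnit {F : Scalar} {s : smoothRing V} (h : Rep F s) (h0 : ∀ x ∈ V, F x ≠ 0) :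
    IsUnit s := by
  refine IsUnit.of_mul_eq_one (smoothRing.mk (fun x => (F x)⁻¹) (h.smooth.inv h0)) ?_
  exact (h.mul (rep_mk _ _)).ext Rep.one fun x hx _ => mul_inv_cancel₀ (h0 x hx)

lemma Rep.ite {F : Scalar} {s : smoothRing V} (h : Rep F s) (p : Prop) [Decidable p] :
    Rep (fun x => if p then F x else 0) (if p then s else 0) := by
  by_cases hp : p
  · simpa only [hp, if_true] using h
  · simpa only [hp, if_false] using Rep.zero

lemma contDiffOn_lapse {ε : ℝ} {i : Fin 4} {g : Tensor2} {W : Set Pt}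
    (hg : ContDiffOn ℝ ∞ (inverse g i i) W) (h : ∀ x ∈ W, 0 < ε * inverse g i i x) :
    ContDiffOn ℝ ∞ (lapse ε i g) W :=
  ((contDiffOn_const.mul hg).sqrt fun x hx => (h x hx).ne').inv fun x hx =>
    (Real.sqrt_pos.mpr (h x hx)).ne'

namespace Represents

variable {G : MetricAlgebra (smoothRing V)} {g : Tensor2} (H : Represents G g) {ε : ℝ} {i : Fin 4}
  {N : smoothRing V} (hN : Rep (lapse ε i g) N)

include H hN

omit H in
lemma conormal (μ : Fin 4) :
    Rep (conormal ε i g μ) (MetricAlgebra.conormal i (algebraMap ℝ _ ε * N) μ) :=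
  ((Rep.const ε).mul hN).ite _

lemma normal (μ : Fin 4) : Rep (normal ε i g μ) (G.normal i (algebraMap ℝ _ ε * N) μ) :=
  Rep.sum fun ν => (H.rep_gi μ ν).mul (conormal hN ν)

lemma projector (μ ν : Fin 4) :
    Rep (projector ε i g μ ν) (G.projector ε i (algebraMap ℝ _ ε * N) μ ν) :=
  (Rep.one.ite _).sub (((Rep.const ε).mul (conormal hN μ)).mul (H.normal hN ν))

variable {W : Tensor1} {w : Fin 4 → smoothRing V} (hw : ∀ a, Rep (W a) (w a))

include hw in
lemma normalPart : Rep (normalPart ε i g W) (G.normalPart i (algebraMap ℝ _ ε * N) w) :=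
  Rep.sum fun ν => (H.normal hN ν).mul (hw ν)

include hw in
lemma tangentialPart (μ : Fin 4) :
    Rep (tangentialPart ε i g W μ) (G.tangentialPart ε i (algebraMap ℝ _ ε * N) w μ) :=
  Rep.sum fun ν => (H.projector hN μ ν).mul (hw ν)

lemma normalDeriv0 {f : Scalar} {s : smoothRing V} (h : Rep f s) :
    Rep (normalDeriv0 ε i g f) (G.along (G.normal i (algebraMap ℝ _ ε * N)) s) :=
  Rep.sum fun l => (H.normal hN l).mul (H.pd h l)

include hw in
lemma normalDeriv1 (μ : Fin 4) :
    Rep (normalDeriv1 ε i g W μ) (G.lie (G.normal i (algebraMap ℝ _ ε * N)) w μ) :=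
  Rep.sum fun l => ((H.normal hN l).mul (H.pd (hw μ) l)).add
    ((hw l).mul (H.pd (H.normal hN l) μ))

lemma iterate_normalDeriv0 {f : Scalar} {s : smoothRing V} (h : Rep f s) (m : ℕ) :
    Rep ((AdSGauge.normalDeriv0 ε i g)^[m] f)
      ((G.along (G.normal i (algebraMap ℝ _ ε * N)))^[m] s) := by
  induction m with
  | zero => exact h
  | succ m ih =>
    rw [Function.iterate_succ_apply', Function.iterate_succ_apply']
    exact H.normalDeriv0 hN ih

include hw in
lemma iterate_normalDeriv1 (m : ℕ) : ∀ μ, Rep ((AdSGauge.normalDeriv1 ε i g)^[m] W μ)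
    ((G.lie (G.normal i (algebraMap ℝ _ ε * N)))^[m] w μ) := by
  induction m with
  | zero => exact hw
  | succ m ih =>
    rw [Function.iterate_succ_apply', Function.iterate_succ_apply']
    exact H.normalDeriv1 hN ih

end Represents

/-- The functions which vanish on the hypersurface `xⁱ = 0`. -/
def hypersurfaceIdeal (V : Opens Pt) (i : Fin 4) : Ideal (smoothRing V) where
  carrier := {s | ∀ x : corneredPatch V, x.1 i = 0 → s.1 x = 0}
  add_mem' := fun {s t} hs ht x hx => by
    change s.1 x + t.1 x = 0
    rw [hs x hx, ht x hx, add_zero]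
  zero_mem' := fun _ _ => rfl
  smul_mem' := fun c s hs x hx => by
    change c.1 x * s.1 x = 0
    rw [hs x hx, mul_zero]

lemma Rep.mem_hypersurfaceIdeal_iff {F : Scalar} {s : smoothRing V} (h : Rep F s) {i : Fin 4} :
    s ∈ hypersurfaceIdeal V i ↔ ∀ x ∈ V, x ∈ quadrant → x i = 0 → F x = 0 :=
  ⟨fun hs x hx hq h0 => (h.eq ⟨x, hx, hq⟩).symm.trans (hs ⟨x, hx, hq⟩ h0),
    fun hF x h0 => (h.eq x).trans (hF x x.2.1 x.2.2 h0)⟩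

/-- Positive translations along another axis preserve both the quadrant and the hypersurface, so a
one-sided derivative suffices. -/
lemma d_mem_hypersurfaceIdeal {i k : Fin 4} (hk : k ≠ i) {s : smoothRing V}
    (hs : s ∈ hypersurfaceIdeal V i) : smoothRing.d k s ∈ hypersurfaceIdeal V i := by
  refine ((rep_rep s).pd k).mem_hypersurfaceIdeal_iff.mpr fun x hx hq h0 => ?_
  refine pd_eq_zero_of_eqOn V.isOpen (rep_rep s).smooth hx k
    (P := fun y => y ∈ quadrant ∧ y i = 0) (fun t ht => ⟨quadrant_add hq k ht, ?_⟩)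
    fun y hy h => (rep_rep s).mem_hypersurfaceIdeal_iff.mp hs y hy h.1 h.2
  simp [h0, hk.symm]

/-- The gauge quantities vanish to third order on the initial surface. -/
lemma Represents.gaugeQ_mem_jet {G : MetricAlgebra (smoothRing V)} {g : Tensor2}
    (H : Represents G g) {F : Tensor1} {f : Fin 4 → smoothRing V} (hf : ∀ a, Rep (F a) (f a))
    (hneg : ∀ x ∈ V, inverse g 0 0 x < 0) {U : Set Pt}
    (hU : ∀ x ∈ V, x ∈ quadrant → x ∈ region U) (hQ3 : QGauge3 U g F) (a : Fin 4) :
    G.gaugeQ f a ∈ G.jet (hypersurfaceIdeal V 0) 3 := by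
  have hpos : ∀ x ∈ V, 0 < -1 * inverse g 0 0 x := fun x hx => by linarith [hneg x hx]
  have hN := rep_mk (V := V) _ (contDiffOn_lapse (H.rep_gi 0 0).smooth hpos)
  set N := smoothRing.mk (V := V) _ (contDiffOn_lapse (H.rep_gi 0 0).smooth hpos)
  have hJ : ∀ k, k ≠ 0 → ∀ f ∈ hypersurfaceIdeal V 0, G.d k f ∈ hypersurfaceIdeal V 0 :=
    fun k hk f hf => by rw [H.d_eq]; exact d_mem_hypersurfaceIdeal hk hf
  have hn : IsUnit (G.normal 0 (algebraMap ℝ _ (-1) * N) 0) := by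
    rw [G.normal_eq]
    refine ((H.rep_gi 0 0).mul ((Rep.const (-1)).mul hN)).isUnit fun x hx => ?_
    have h1 := Real.sqrt_pos.mpr (hpos x hx)
    exact mul_ne_zero (hneg x hx).ne (mul_ne_zero (by norm_num) (inv_ne_zero h1.ne'))
  have hQ := fun a => H.QDown hf a
  have hS : ∀ x ∈ V, x ∈ quadrant → x 0 = 0 → x ∈ initialSurface U :=
    fun x hx hq h0 => ⟨hU x hx hq, h0⟩
  have h1 : G.normalPart 0 (algebraMap ℝ _ (-1) * N) (G.gaugeQ f)
      ∈ G.jet (hypersurfaceIdeal V 0) 3 :=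
    MetricAlgebra.mem_jet_of_along hJ hn 3 fun j hj =>
      (H.iterate_normalDeriv0 hN (H.normalPart hN hQ) j).mem_hypersurfaceIdeal_iff.mpr
        fun x hx hq h0 => (hQ3 x (hS x hx hq h0) j hj).1
  have h2 : ∀ a, G.tangentialPart (-1) 0 (algebraMap ℝ _ (-1) * N) (G.gaugeQ f) a
      ∈ G.jet (hypersurfaceIdeal V 0) 3 :=
    MetricAlgebra.mem_jet_of_lie hJ hn 3 fun j hj μ =>
      (H.iterate_normalDeriv1 hN (H.tangentialPart hN hQ) j μ).mem_hypersurfaceIdeal_iff.mpr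
        fun x hx hq h0 => (hQ3 x (hS x hx hq h0) j hj).2 μ
  have e := G.tangentialPart_eq (-1) 0 (algebraMap ℝ _ (-1) * N) (G.gaugeQ f) a
  rw [eq_sub_iff_add_eq] at e
  rw [← e]
  exact Ideal.add_mem _ (h2 a) (Ideal.mul_mem_left _ _ h1)

end AdSGauge

/-! ### Vanishing on the conformal boundary -/

namespace AdSGauge
namespace MetricAlgebra

variable {S : Type*} [CommRing S] [Algebra ℝ S] (G : MetricAlgebra S)

/-- Evaluation `e` at a point of a hypersurface `x¹ = const` with defining ideal `J`, on which the
coordinates are Gaussian to zeroth order. -/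
structure GaussianAt (J : Ideal S) (e : S →+* ℝ) : Prop where
  eval : ∀ f ∈ J, e f = 0
  tangential : ∀ k, k ≠ 1 → ∀ f ∈ J, G.d k f ∈ J
  gi_one : ∀ a, G.gi 1 a - (if a = 1 then 1 else 0) ∈ J

namespace GaussianAt

variable {G} {J : Ideal S} {e : S →+* ℝ} (h : G.GaussianAt J e)

include h

lemma eval_gi (a : Fin 4) : e (G.gi 1 a) = if a = 1 then 1 else 0 := by
  have := h.eval _ (h.gi_one a)
  rw [map_sub, sub_eq_zero] at this
  rw [this]
  split_ifs <;> simp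

lemma eval_gi' (a : Fin 4) : e (G.gi a 1) = if a = 1 then 1 else 0 := by
  rw [G.gi_symm, h.eval_gi]

omit h in
lemma d_const_sub (k : Fin 4) {f : S} (p : Prop) [Decidable p] :
    G.d k (f - if p then 1 else 0) = G.d k f := by
  rw [map_sub]
  split_ifs <;> simp

lemma d_gi_mem {k : Fin 4} (hk : k ≠ 1) (a : Fin 4) : G.d k (G.gi 1 a) ∈ J := by
  have := h.tangential k hk _ (h.gi_one a)
  rwa [d_const_sub] at this

lemma eval_d_gi (k a : Fin 4) : e (G.d k (G.gi 1 a))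
    = - (∑ τ, e (G.Γ 1 k τ) * e (G.gi τ a) + e (G.Γ a k 1)) := by
  rw [G.d_gi, map_neg, map_add, map_sum, map_sum]
  simp only [map_mul, h.eval_gi]
  simp

/-- Since `g^{11} = 1` along the boundary, `0 = ∂_τ g^{11} = -2 Γ^1_{τ1}`. -/
lemma eval_Γ_tangential {τ : Fin 4} (hτ : τ ≠ 1) : e (G.Γ 1 τ 1) = 0 := by
  have h1 := h.eval_d_gi τ 1
  rw [h.eval _ (h.d_gi_mem hτ 1)] at h1
  simp only [h.eval_gi'] at h1
  simp only [mul_ite, mul_one, mul_zero, Finset.sum_ite_eq', Finset.mem_univ, if_true] at h1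
  linarith

lemma eval_d_one_gi (a : Fin 4) : e (G.d 1 (G.gi 1 a))
    = - (e (G.Γ a 1 1) + if a = 1 then e (G.Γ 1 1 1) else 0) := by
  rw [h.eval_d_gi, Finset.sum_eq_single 1, h.eval_gi]
  · split_ifs <;> ring
  · intro τ _ hτ
    rw [G.Γ_symm, h.eval_Γ_tangential hτ, zero_mul]
  · simp

/-- The contracted Christoffel symbols with an index tangent to the hypersurface. -/
lemma eval_ΓUp (a : Fin 4) : e (G.ΓUp a) = e (G.Γ a 1 1)
    + ∑ μ : ScriIdx, ∑ l : ScriIdx, e (G.gi μ.1 l.1) * e (G.Γ a μ.1 l.1) := by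
  have h1 : e (G.ΓUp a) = ∑ μ, ∑ l, e (G.gi μ l) * e (G.Γ a μ l) := by
    simp only [ΓUp, map_sum, map_mul]
  rw [h1, Fintype.sum_eq_add_sum_subtype_ne _ (1 : Fin 4)]
  congr 1
  · simp [h.eval_gi]
  · refine Finset.sum_congr rfl fun μ _ => ?_
    rw [Fintype.sum_eq_add_sum_subtype_ne _ (1 : Fin 4), h.eval_gi', if_neg μ.2, zero_mul, zero_add]

variable {κ : ℝ} (hκ : ∀ a b, a ≠ 1 → b ≠ 1 → e (G.Γ 1 a b) = - κ * e (G.g a b))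

lemma sum_gi_g_tangential (a : Fin 4) {c : Fin 4} (hc : c ≠ 1) :
    ∑ b : ScriIdx, e (G.gi c b.1) * e (G.g b.1 a) = if c = a then 1 else 0 := by
  have h1 := congrArg e (G.gi_g c a)
  rw [map_sum, Fintype.sum_eq_add_sum_subtype_ne _ (1 : Fin 4)] at h1
  simp only [map_mul] at h1
  rw [h.eval_gi', if_neg hc, zero_mul, zero_add] at h1
  rw [h1]
  split_ifs <;> simp

include hκ

/-- The hypothesis `hκ` is umbilicity in components; its trace over the three tangential directions
gives `3κ`. -/
lemma eval_ΓUp_one : e (G.ΓUp 1) = e (G.Γ 1 1 1) - 3 * κ := by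
  rw [h.eval_ΓUp]
  have h1 : ∀ μ : ScriIdx, ∑ l : ScriIdx, e (G.gi μ.1 l.1) * e (G.Γ 1 μ.1 l.1) = -κ := by
    intro μ
    have := h.sum_gi_g_tangential μ.1 μ.2
    rw [if_pos rfl] at this
    calc _ = -κ * ∑ l : ScriIdx, e (G.gi μ.1 l.1) * e (G.g l.1 μ.1) := by
          rw [Finset.mul_sum]
          refine Finset.sum_congr rfl fun l _ => ?_
          rw [hκ _ _ μ.2 l.2, G.g_symm]
          ring
      _ = -κ := by rw [this, mul_one]
  rw [Finset.sum_congr rfl fun μ _ => h1 μ, Finset.sum_const, Finset.card_univ]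
  have : Fintype.card ScriIdx = 3 := by simp [ScriIdx]
  rw [this]
  ring

/-- The shape operator is `κ` times the identity, from `∂_c g^{1τ} = 0` along the boundary. -/
lemma eval_Γ_shape {c τ : Fin 4} (hc : c ≠ 1) (hτ : τ ≠ 1) :
    e (G.Γ τ 1 c) = if τ = c then κ else 0 := by
  have h1 := h.eval_d_gi c τ
  rw [h.eval _ (h.d_gi_mem hc τ), Fintype.sum_eq_add_sum_subtype_ne _ (1 : Fin 4), h.eval_gi,
    if_neg hτ, mul_zero, zero_add] at h1
  have h2 : ∑ b : ScriIdx, e (G.Γ 1 c b.1) * e (G.gi b.1 τ)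
      = -κ * ∑ b : ScriIdx, e (G.gi τ b.1) * e (G.g b.1 c) := by
    rw [Finset.mul_sum]
    refine Finset.sum_congr rfl fun b _ => ?_
    rw [hκ _ _ hc b.2, G.g_symm c, G.gi_symm τ]
    ring
  rw [h2, h.sum_gi_g_tangential c hτ] at h1
  rw [G.Γ_symm, show e (G.Γ τ c 1) = κ * (if τ = c then 1 else 0) by linarith]
  simp

omit hκ in
-- With `eval_d_shift`, this identifies the normal derivatives of lapse and shift with the
-- `Γ^a_{11}`, the only part of `Γ^a` not fixed by the geometry of the boundary.
lemma eval_d_lapse {N : S} (hN : N * N * G.gi 1 1 = 1) (hN1 : e N = 1) :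
    e (G.d 1 N) = e (G.Γ 1 1 1) := by
  have h1 := congrArg (fun f => e (G.d 1 f)) hN
  simp only [Derivation.leibniz, smul_eq_mul, map_add, map_mul, Derivation.map_one_eq_zero,
    map_zero, hN1, h.eval_gi, h.eval_d_one_gi, if_true] at h1
  linarith

omit hκ in
lemma eval_d_shift {c : Fin 4} (hc : c ≠ 1) {β : S} (hβ : β * G.gi 1 1 = - G.gi 1 c) :
    e (G.d 1 β) = e (G.Γ c 1 1) := by
  have h0 := congrArg e hβ
  have h1 := congrArg (fun f => e (G.d 1 f)) hβ
  simp only [map_mul, map_neg, h.eval_gi, if_neg hc, if_true] at h0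
  simp only [Derivation.leibniz, smul_eq_mul, map_add, map_mul, map_neg,
    h.eval_gi, h.eval_d_one_gi, if_true, if_neg hc] at h1
  simp only [mul_one, neg_zero] at h0
  rw [h0] at h1
  linarith

section wave

variable {Q : Fin 4 → S} (hQ : ∀ a, Q a ∈ J)

include hQ

omit hκ in
lemma eval_dd_zero {k l : Fin 4} (hk : k ≠ 1) (hl : l ≠ 1) (a : Fin 4) :
    e (G.d k (G.d l (Q a))) = 0 :=
  h.eval _ (h.tangential k hk _ (h.tangential l hl _ (hQ a)))

/-- The wave operator of a covector vanishing on the hypersurface. -/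
lemma eval_box1 (ν : Fin 4) : e (G.box1 Q ν) = e (G.d 1 (G.d 1 (Q ν)))
    - 2 * ∑ τ, e (G.Γ τ 1 ν) * e (G.d 1 (Q τ)) - (e (G.Γ 1 1 1) - 3 * κ) * e (G.d 1 (Q ν)) := by
  have hd : ∀ l a, e (G.d l (Q a)) = if l = 1 then e (G.d 1 (Q a)) else 0 := by
    intro l a
    split_ifs with hl
    · rw [hl]
    · exact h.eval _ (h.tangential l hl _ (hQ a))
  have h0 : ∀ a, e (Q a) = 0 := fun a => h.eval _ (hQ a)
  have hD : ∀ l a, e (G.D1 l Q a) = if l = 1 then e (G.d 1 (Q a)) else 0 := by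
    intro l a
    rw [D1_apply, map_sub, hd, map_sum]
    simp [h0]
  have hT : ∀ k l, e (G.D2 k (fun l => G.D1 l Q) l ν) = e (G.d k (G.d l (Q ν)))
      - (if k = 1 then ∑ τ, e (G.Γ τ l ν) * e (G.d 1 (Q τ)) else 0)
      - e (G.Γ 1 k l) * e (G.d 1 (Q ν))
      - (if l = 1 then ∑ τ, e (G.Γ τ k ν) * e (G.d 1 (Q τ)) else 0) := by
    intro k l
    have e1 : e (G.d k (G.D1 l Q ν)) = e (G.d k (G.d l (Q ν)))
        - if k = 1 then ∑ τ, e (G.Γ τ l ν) * e (G.d 1 (Q τ)) else 0 := by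
      rw [D1_apply, map_sub, map_sub, map_sum, map_sum]
      simp only [Derivation.leibniz, smul_eq_mul, map_add, map_mul, h0, zero_mul, add_zero]
      split_ifs with hk
      · rw [hk]
      · have : ∀ a, e (G.d k (Q a)) = 0 := fun a => by rw [hd, if_neg hk]
        simp [this]
    rw [D2_apply, map_sub, map_sub, e1, map_sum, map_sum]
    simp only [map_mul, hD, mul_ite, mul_zero, Finset.sum_ite_eq', Finset.mem_univ, if_true]
    split_ifs <;> (try simp only [Finset.sum_const_zero]) <;> ring
  have h1 : e (G.box1 Q ν) = ∑ k, ∑ l, e (G.gi k l) * e (G.D2 k (fun l => G.D1 l Q) l ν) := by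
    simp only [box1, tr, smul_eq_mul, map_sum, map_mul]
  have hΓ : ∑ k, ∑ l, e (G.gi k l) * e (G.Γ 1 k l) = e (G.Γ 1 1 1) - 3 * κ := by
    rw [← h.eval_ΓUp_one hκ]
    simp only [ΓUp, map_sum, map_mul]
  have hdd : ∑ k, ∑ l, e (G.gi k l) * e (G.d k (G.d l (Q ν))) = e (G.d 1 (G.d 1 (Q ν))) := by
    rw [Fintype.sum_eq_add_sum_subtype_ne _ (1 : Fin 4)]
    simp only [h.eval_gi]
    rw [Finset.sum_eq_zero (s := Finset.univ (α := ScriIdx))]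
    · simp
    · intro k _
      refine Finset.sum_eq_zero fun l _ => ?_
      by_cases hl : l = 1
      · rw [hl, h.eval_gi', if_neg k.2, zero_mul]
      · rw [h.eval_dd_zero hQ k.2 hl, mul_zero]
  have hA : ∑ k, ∑ l, e (G.gi k l) * (if k = 1 then ∑ τ, e (G.Γ τ l ν) * e (G.d 1 (Q τ)) else 0)
      = ∑ τ, e (G.Γ τ 1 ν) * e (G.d 1 (Q τ)) := by
    rw [Finset.sum_comm]
    simp only [mul_ite, mul_zero, Finset.sum_ite_eq', Finset.mem_univ, if_true, h.eval_gi, ite_mul,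
      one_mul, zero_mul]
  have hB : ∑ k, ∑ l, e (G.gi k l) * (if l = 1 then ∑ τ, e (G.Γ τ k ν) * e (G.d 1 (Q τ)) else 0)
      = ∑ τ, e (G.Γ τ 1 ν) * e (G.d 1 (Q τ)) := by
    simp only [mul_ite, mul_zero, Finset.sum_ite_eq', Finset.mem_univ, if_true, h.eval_gi', ite_mul,
      one_mul, zero_mul]
  rw [h1]
  simp only [hT, mul_sub, Finset.sum_sub_distrib, ← mul_assoc, ← Finset.sum_mul, hΓ, hdd, hA, hB]
  ring

omit h hκ in
lemma normalPart_mem (N : S) : G.normalPart 1 N Q ∈ J :=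
  J.sum_mem fun ν _ => J.mul_mem_left _ (hQ ν)

variable {N : S} (hN : N * N * G.gi 1 1 = 1) (hNJ : N - 1 ∈ J)

include hN hNJ

omit hκ hQ hN in
lemma normal_sub_mem (l : Fin 4) : G.normal 1 N l - (if l = 1 then 1 else 0) ∈ J := by
  have e1 : G.normal 1 N l - (if l = 1 then 1 else 0)
      = (G.gi 1 l - if l = 1 then 1 else 0) * N + (if l = 1 then 1 else 0) * (N - 1) := by
    rw [G.normal_eq, G.gi_symm]; ring
  rw [e1]
  exact J.add_mem (J.mul_mem_right _ (h.gi_one l)) (J.mul_mem_left _ hNJ)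

omit hκ hQ hN in
lemma eval_normal (l : Fin 4) : e (G.normal 1 N l) = if l = 1 then 1 else 0 := by
  have := h.eval _ (h.normal_sub_mem hNJ l)
  rw [map_sub, sub_eq_zero] at this
  rw [this]
  split_ifs <;> simp

omit hκ hQ hN in
lemma eval_d_normal {k : Fin 4} (hk : k ≠ 1) (l : Fin 4) : e (G.d k (G.normal 1 N l)) = 0 := by
  have := h.eval _ (h.tangential k hk _ (h.normal_sub_mem hNJ l))
  rwa [d_const_sub] at this

omit hκ hQ in
lemma eval_d_one_normal (l : Fin 4) : e (G.d 1 (G.normal 1 N l)) = - e (G.Γ l 1 1) := by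
  have hN1 : e N = 1 := by
    have := h.eval _ hNJ
    rwa [map_sub, map_one, sub_eq_zero] at this
  rw [G.normal_eq, G.gi_symm, Derivation.leibniz, smul_eq_mul, smul_eq_mul, map_add, map_mul, map_mul,
    h.eval_gi, h.eval_d_lapse hN hN1, hN1, h.eval_d_one_gi]
  split_ifs with hl
  · rw [hl]; ring
  · ring

omit hκ hQ hN in
lemma eval_along (f : S) : e (G.along (G.normal 1 N) f) = e (G.d 1 f) := by
  rw [along, map_sum]
  simp only [map_mul, h.eval_normal hNJ]
  simp

omit hκ hN in
lemma eval_d_normalPart : e (G.d 1 (G.normalPart 1 N Q)) = e (G.d 1 (Q 1)) := by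
  rw [normalPart, map_sum, map_sum]
  simp only [Derivation.leibniz, smul_eq_mul, map_add, map_mul, h.eval _ (hQ _), zero_mul, add_zero,
    h.eval_normal hNJ]
  simp

omit hκ in
/-- The second condition on the normal part of `Q`. -/
lemma eval_dd_one (h1 : ∀ k, e (G.d k (G.normalPart 1 N Q)) = 0)
    (h2 : e (G.along (G.normal 1 N) (G.along (G.normal 1 N) (G.normalPart 1 N Q))) = 0) :
    e (G.d 1 (G.d 1 (Q 1))) = 2 * ∑ τ, e (G.Γ τ 1 1) * e (G.d 1 (Q τ)) := by
  rw [h.eval_along hNJ] at h2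
  have e1 : e (G.d 1 (G.along (G.normal 1 N) (G.normalPart 1 N Q)))
      = e (G.d 1 (G.d 1 (G.normalPart 1 N Q))) := by
    rw [along, map_sum, map_sum]
    simp only [Derivation.leibniz, smul_eq_mul, map_add, map_mul, h1, zero_mul, add_zero,
      h.eval_normal hNJ]
    simp
  have e2 : e (G.d 1 (G.d 1 (G.normalPart 1 N Q))) = e (G.d 1 (G.d 1 (Q 1)))
      - 2 * ∑ τ, e (G.Γ τ 1 1) * e (G.d 1 (Q τ)) := by
    rw [normalPart, map_sum, map_sum, map_sum]
    have : ∀ τ, e (G.d 1 (G.d 1 (G.normal 1 N τ * Q τ))) = (if τ = 1 then e (G.d 1 (G.d 1 (Q τ))) else 0)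
        - 2 * (e (G.Γ τ 1 1) * e (G.d 1 (Q τ))) := by
      intro τ
      simp only [Derivation.leibniz, smul_eq_mul, map_add, map_mul, h.eval _ (hQ _), zero_mul,
        h.eval_normal hNJ, h.eval_d_one_normal hN hNJ, ite_mul, one_mul]
      ring
    rw [Finset.sum_congr rfl fun τ _ => this τ, Finset.sum_sub_distrib, ← Finset.mul_sum]
    simp
  linarith

omit hκ in
/-- The condition on the tangential part of `Q`. -/
lemma eval_lie_lie {c : Fin 4} (hc : c ≠ 1) :
    e (G.lie (G.normal 1 N) (G.tangentialPart 1 1 N Q) c) = e (G.d 1 (Q c)) ∧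
    e (G.lie (G.normal 1 N) (G.lie (G.normal 1 N) (G.tangentialPart 1 1 N Q)) c)
      = e (G.d 1 (G.d 1 (Q c))) - e (G.Γ 1 1 1) * e (G.d 1 (Q c)) := by
  set t := G.tangentialPart 1 1 N Q with ht
  have htJ : ∀ a, t a ∈ J := fun a => J.sum_mem fun ν _ => J.mul_mem_left _ (hQ ν)
  have htc : t c = Q c := by
    rw [ht, G.tangentialPart_eq, conormal, if_neg hc]; simp
  -- Along the boundary the normal is `∂_1` with constant components, so the terms `w_l ∂_c n^l`
  -- drop out.
  have hl : ∀ w : Fin 4 → S, e (G.lie (G.normal 1 N) w c) = e (G.d 1 (w c)) := by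
    intro w
    rw [lie, map_sum]
    simp only [map_add, map_mul, h.eval_normal hNJ, h.eval_d_normal hNJ hc]
    simp
  refine ⟨by rw [hl, htc], ?_⟩
  rw [hl, lie, map_sum, map_sum]
  have hd1 : ∀ l, e (G.d 1 (G.d c (G.normal 1 N l))) * e (t l) = 0 := fun l => by
    rw [h.eval _ (htJ l), mul_zero]
  have hd : ∀ l, l ≠ 1 → e (G.d l (Q c)) = 0 := fun l hl => h.eval _ (h.tangential l hl _ (hQ c))
  have : ∀ l, e (G.d 1 (G.normal 1 N l * G.d l (t c) + t l * G.d c (G.normal 1 N l)))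
      = if l = 1 then e (G.d 1 (G.d 1 (Q c))) - e (G.Γ 1 1 1) * e (G.d 1 (Q c)) else 0 := by
    intro l
    rw [htc]
    simp only [Derivation.leibniz, smul_eq_mul, map_add, map_mul, h.eval _ (htJ _), zero_mul,
      h.eval_normal hNJ, h.eval_d_one_normal hN hNJ, h.eval_d_normal hNJ hc]
    split_ifs with hl
    · subst hl; ring
    · rw [hd l hl]; ring
  rw [Finset.sum_congr rfl fun l _ => this l]
  simp

/-- The gauge conditions on the boundary annihilate the wave operator of `Q`. -/
lemma eval_box1_eq_zero (h1 : ∀ k, e (G.d k (G.normalPart 1 N Q)) = 0)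
    (h2 : e (G.along (G.normal 1 N) (G.along (G.normal 1 N) (G.normalPart 1 N Q))) = 0)
    (h3 : ∀ c, c ≠ 1 →
      e (G.lie (G.normal 1 N) (G.lie (G.normal 1 N) (G.tangentialPart 1 1 N Q)) c)
        + κ * e (G.lie (G.normal 1 N) (G.tangentialPart 1 1 N Q) c) = 0) (ν : Fin 4) :
    e (G.box1 Q ν) = 0 := by
  have hd1 : e (G.d 1 (Q 1)) = 0 := by rw [← h.eval_d_normalPart hQ hNJ]; exact h1 1
  rw [h.eval_box1 hκ hQ]
  -- In the normal direction the terms `Γ^τ_{11} ∂_1 Q_τ` cancel and `∂_1 Q_1 = 0`. In a tangential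
  -- direction `-2κ + 3κ = κ` reproduces the left side of the gauge condition.
  by_cases hν : ν = 1
  · rw [hν, h.eval_dd_one hQ hN hNJ h1 h2, hd1]
    ring
  · have h4 := h3 ν hν
    rw [(h.eval_lie_lie hQ hN hNJ hν).1, (h.eval_lie_lie hQ hN hNJ hν).2] at h4
    have h5 : ∑ τ, e (G.Γ τ 1 ν) * e (G.d 1 (Q τ)) = κ * e (G.d 1 (Q ν)) := by
      rw [Finset.sum_eq_single ν]
      · rw [h.eval_Γ_shape hκ hν hν, if_pos rfl]
      · intro τ _ hτ
        by_cases h6 : τ = 1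
        · rw [h6, hd1, mul_zero]
        · rw [h.eval_Γ_shape hκ hν h6, if_neg hτ, zero_mul]
      · simp
    rw [h5]
    linarith

end wave

end GaussianAt

end MetricAlgebra
end AdSGauge

namespace AdSGauge
open TopologicalSpace (Opens)

variable {V : Opens Pt}

/-- Evaluation at a point. -/
def evalAt (x : corneredPatch V) : smoothRing V →+* ℝ :=
  (Pi.evalRingHom _ x).comp (smoothRing V).val.toRingHom

lemma Rep.evalAt {F : Scalar} {s : smoothRing V} (h : Rep F s) (x : corneredPatch V) :
    evalAt x s = F x := h.eq x

/-- The inverse of the intrinsic metric of the boundary in Gaussian coordinates. -/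
lemma inverse_scriMetric {g : Tensor2} {x : Pt}
    (hdet : (Matrix.of fun a b => g a b x).det ≠ 0)
    (h : ∀ a, a ≠ 1 → inverse g a 1 x = 0) (a b : ScriIdx) :
    inverse (scriMetric g) a b x = inverse g a.1 b.1 x := by
  have h1 : (Matrix.of fun a b : ScriIdx => inverse g a.1 b.1 x)
      * (Matrix.of fun a b : ScriIdx => scriMetric g a b x) = 1 := by
    ext i j
    have h2 := inverse_mul hdet i.1 j.1
    rw [Fintype.sum_eq_add_sum_subtype_ne _ (1 : Fin 4), h _ i.2, zero_mul, zero_add] at h2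
    rw [Matrix.mul_apply, Matrix.one_apply]
    simp only [Subtype.ext_iff]
    exact h2
  rw [inverse, Matrix.inv_eq_left_inv h1]
  rfl

/-- Without shift the inverse metric is block diagonal, so intrinsic and spacetime Christoffel
symbols with tangential indices agree. -/
lemma contractedChristoffelOn_scriMetric {g : Tensor2} {x : Pt}
    (hdet : (Matrix.of fun a b => g a b x).det ≠ 0)
    (h : ∀ a, a ≠ 1 → inverse g a 1 x = 0) (δ : ScriIdx) :
    contractedChristoffelOn Subtype.val (scriMetric g) δ x
      = ∑ μ : ScriIdx, ∑ l : ScriIdx, inverse g μ.1 l.1 x * christoffel g δ.1 μ.1 l.1 x := by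
  refine Finset.sum_congr rfl fun μ _ => Finset.sum_congr rfl fun l _ => ?_
  rw [inverse_scriMetric hdet h]
  congr 1
  rw [christoffel, christoffelOn, christoffelOn, Fintype.sum_eq_add_sum_subtype_ne _ (1 : Fin 4),
    h _ δ.2, zero_mul, zero_add]
  congr 1
  refine Finset.sum_congr rfl fun ρ _ => ?_
  rw [inverse_scriMetric hdet h]
  rfl

lemma extrinsicCurv_tangential {g : Tensor2} {x : Pt} {a b : Fin 4} (ha : a ≠ 1) (hb : b ≠ 1) :
    extrinsicCurv 1 1 g a b x = - christoffel g 1 a b x * lapse 1 1 g x := by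
  have hp : ∀ a σ, a ≠ 1 → projector 1 1 g a σ x = if a = σ then 1 else 0 := by
    intro a σ ha
    simp [projector, conormal, ha]
  -- This component vanishes as a function, not only at `x`, so its derivative contributes nothing.
  have hc : conormal 1 1 g b = fun _ => 0 := by
    funext y; simp [conormal, hb]
  rw [extrinsicCurv, Finset.sum_eq_single a, Finset.sum_eq_single b, cov1, hc, pd_const, hp _ _ ha,
    hp _ _ hb]
  · simp [conormal]
  · intro τ _ hτ
    rw [hp _ _ hb, if_neg hτ.symm, mul_zero, zero_mul]
  · simp
  · intro σ _ hσ
    exact Finset.sum_eq_zero fun τ _ => by rw [hp _ _ ha, if_neg hσ.symm, zero_mul, zero_mul]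
  · simp

lemma inducedMetric_tangential {g : Tensor2} {x : Pt} {a b : Fin 4} (ha : a ≠ 1) :
    inducedMetric 1 1 g a b x = g a b x := by
  simp [inducedMetric, conormal, ha]

lemma inverse_of_gaussian {U : Set Pt} {g : Tensor2} (hG : GaussianOnScri U g) {x : Pt}
    (hx : x ∈ scri U) (a : Fin 4) : inverse g 1 a x = if a = 1 then 1 else 0 := by
  obtain ⟨h1, h2⟩ := hG x hx
  have h3 : inverse g 1 1 x = 1 := by
    rw [lapse, one_mul, inv_eq_one, Real.sqrt_eq_one] at h1
    exact h1
  split_ifs with ha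
  · rw [ha, h3]
  · have := h2 ⟨a, ha⟩
    rwa [scriShift, h3, div_one, neg_eq_zero] at this

namespace Represents

open MetricAlgebra

variable {G : MetricAlgebra (smoothRing V)} {g : Tensor2} (H : Represents G g)
  {U : Set Pt} (hU : ∀ x ∈ V, x ∈ quadrant → x ∈ region U) (hG : GaussianOnScri U g)

omit hU hG in
include H in
lemma exists_lapse (hpos : ∀ x ∈ V, 0 < inverse g 1 1 x) :
    ∃ N : smoothRing V, Rep (lapse 1 1 g) N ∧ N * N * G.gi 1 1 = 1 := by
  have hN := rep_mk (V := V) _ (contDiffOn_lapse (ε := 1) (H.rep_gi 1 1).smooth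
    fun x hx => by rw [one_mul]; exact hpos x hx)
  refine ⟨_, hN, ((hN.mul hN).mul (H.rep_gi 1 1)).ext Rep.one fun x hx _ => ?_⟩
  have h1 := Real.sqrt_pos.mpr (hpos x hx)
  have h2 := Real.mul_self_sqrt (hpos x hx).le
  rw [lapse, one_mul]
  field_simp
  rw [sq, h2]

include H hU hG

lemma gaussianAt (x : corneredPatch V) (hx : x.1 1 = 0) :
    G.GaussianAt (hypersurfaceIdeal V 1) (evalAt x) where
  eval f hf := hf x hx
  tangential k hk f hf := by rw [H.d_eq]; exact d_mem_hypersurfaceIdeal hk hf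
  gi_one a := ((H.rep_gi 1 a).sub (Rep.one.ite _)).mem_hypersurfaceIdeal_iff.mpr
    fun y hy hq h0 => by rw [inverse_of_gaussian hG ⟨hU y hy hq, h0⟩, sub_self]

lemma eval_umbilic {κ : Scalar} (hUm : UmbilicScri U g κ) (x : corneredPatch V) (hx : x.1 1 = 0)
    {a b : Fin 4} (ha : a ≠ 1) (hb : b ≠ 1) :
    evalAt x (G.Γ 1 a b) = - κ x * evalAt x (G.g a b) := by
  have hs : x.1 ∈ scri U := ⟨hU x x.2.1 x.2.2, hx⟩
  have h1 := hUm x hs a b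
  rw [extrinsicCurv_tangential ha hb, inducedMetric_tangential ha, (hG x hs).1] at h1
  rw [(H.christoffel 1 a b).evalAt, (H.rep_g a b).evalAt]
  linarith

/-- The first gauge condition equates `Γ^1_{11}` with `3κ + 𝓕^1` and `Γ^δ_{11}` with `𝓕^δ - γ^δ`;
adding the tangential traces `-3κ` and `γ^δ` gives `Γ^μ = 𝓕^μ`. -/
lemma gaugeQ_mem_scri (hpos : ∀ x ∈ V, 0 < inverse g 1 1 x)
    (hdet : ∀ x ∈ V, (Matrix.of fun a b => g a b x).det ≠ 0) {κ : Scalar}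
    (hUm : UmbilicScri U g κ) {F : Tensor1} {f : Fin 4 → smoothRing V}
    (hf : ∀ a, Rep (F a) (f a)) (hQ1 : QGauge1 U g F κ) (a : Fin 4) :
    G.gaugeQ f a ∈ hypersurfaceIdeal V 1 := by
  obtain ⟨N, hN, hNN⟩ := H.exists_lapse hpos
  change ∑ ν, G.g a ν * (G.ΓUp ν - f ν) ∈ _
  refine Ideal.sum_mem _ fun ν _ => Ideal.mul_mem_left _ _ ?_
  intro x hx
  have hs : x.1 ∈ scri U := ⟨hU x x.2.1 x.2.2, hx⟩
  have hA := H.gaussianAt hU hG x hx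
  obtain ⟨h1, h2⟩ := hQ1 x hs
  change evalAt x (G.ΓUp ν - f ν) = 0
  rw [map_sub, sub_eq_zero, (hf ν).evalAt]
  by_cases hν : ν = 1
  · subst hν
    have h3 := hA.eval_d_lapse hNN ((hN.evalAt x).trans (hG x hs).1)
    rw [(H.pd hN 1).evalAt, h1] at h3
    rw [hA.eval_ΓUp_one fun a b => H.eval_umbilic hU hG hUm x hx]
    linarith
  · have hβ : Rep (scriShift g ⟨ν, hν⟩) (smoothRing.mk (V := V) _
        ((H.rep_gi 1 ν).smooth.neg.div (H.rep_gi 1 1).smooth fun x hx => (hpos x hx).ne')) :=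
      rep_mk _ _
    have h3 := hA.eval_d_shift hν ((hβ.mul (H.rep_gi 1 1)).ext (H.rep_gi 1 ν).neg fun x hx _ =>
      div_mul_cancel₀ _ (hpos x hx).ne')
    rw [(H.pd hβ 1).evalAt, h2, contractedChristoffelOn_scriMetric (hdet x x.2.1)] at h3
    · rw [hA.eval_ΓUp, ← h3]
      simp only [(H.rep_gi _ _).evalAt, (H.christoffel _ _ _).evalAt]
      ring
    · intro b hb
      rw [← (H.rep_gi b 1).evalAt x, hA.eval_gi', if_neg hb]

/-- Where `Q` vanishes the wave equation for `Q` reads `Y = -2 □Q`, and the second gauge condition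
annihilates `□Q`. -/
lemma divDefect_mem_scri (hpos : ∀ x ∈ V, 0 < inverse g 1 1 x) {κ : Scalar}
    (hUm : UmbilicScri U g κ) {F : Tensor1} {f : Fin 4 → smoothRing V}
    (hf : ∀ a, Rep (F a) (f a)) (hQ2 : QGauge2 U g F κ)
    {φ : Fin 4 → Fin 4 → smoothRing V} {r : smoothRing V} (htr : G.tr φ = 0)
    (hmet : G.MetricEq φ r (G.gaugeQ f)) (hQ : ∀ a, G.gaugeQ f a ∈ hypersurfaceIdeal V 1)
    (a : Fin 4) : G.divDefect φ r a ∈ hypersurfaceIdeal V 1 := by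
  obtain ⟨N, hN, hNN⟩ := H.exists_lapse hpos
  have hS : ∀ y ∈ V, y ∈ quadrant → y 1 = 0 → y ∈ scri U :=
    fun y hy hq h0 => ⟨hU y hy hq, h0⟩
  have hNJ : N - 1 ∈ hypersurfaceIdeal V 1 :=
    (hN.sub Rep.one).mem_hypersurfaceIdeal_iff.mpr fun y hy hq h0 => by
      rw [(hG y (hS y hy hq h0)).1, sub_self]
  have hN1 : algebraMap ℝ (smoothRing V) 1 * N = N := by rw [map_one, one_mul]
  have rQ := fun a => H.QDown hf a
  have rq := H.normalPart hN rQ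
  have rt := fun a => H.tangentialPart hN rQ a
  have rDq := H.normalDeriv0 hN rq
  have rDDq := H.normalDeriv0 hN rDq
  have rDt := fun a => H.normalDeriv1 hN rt a
  have rDDt := fun a => H.normalDeriv1 hN rDt a
  simp only [hN1] at rq rt rDq rDDq rDt rDDt
  intro x hx
  have hA := H.gaussianAt hU hG x hx
  have hq := hQ2 x (hS x x.2.1 x.2.2 hx)
  rw [← rDq.evalAt, ← rDDq.evalAt] at hq
  have e1 : ∀ k, evalAt x (G.d k (G.normalPart 1 N (G.gaugeQ f))) = 0 := by
    intro k
    by_cases hk : k = 1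
    · rw [hk, ← hA.eval_along hNJ]; exact hq.1
    · exact hA.eval _ (hA.tangential k hk _ (GaussianAt.normalPart_mem hQ N))
  have e2 := hA.eval_box1_eq_zero (κ := κ x) (fun a b => H.eval_umbilic hU hG hUm x hx) hQ hNN hNJ
    e1 hq.2.1 (fun c _ => by rw [(rDDt c).evalAt, (rDt c).evalAt]; exact hq.2.2 c) a
  have e3 := congrArg (evalAt x) (hmet.box1_Q htr a)
  have e4 : evalAt x (G.tr fun ρ σ => G.Ric ρ a * G.gaugeQ f σ) = 0 :=
    hA.eval _ (tr_mem fun ρ σ => Ideal.mul_mem_left _ _ (hQ σ))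
  rw [map_add, map_mul, map_mul, e2, e4, map_neg, mul_zero, add_zero] at e3
  exact neg_eq_zero.mp e3.symm

lemma gaugeSystem_mem_scri (hpos : ∀ x ∈ V, 0 < inverse g 1 1 x)
    (hdet : ∀ x ∈ V, (Matrix.of fun a b => g a b x).det ≠ 0) {κ : Scalar}
    (hUm : UmbilicScri U g κ) {F : Tensor1} {f : Fin 4 → smoothRing V}
    (hf : ∀ a, Rep (F a) (f a)) (hQ1 : QGauge1 U g F κ) (hQ2 : QGauge2 U g F κ)
    {φ : Fin 4 → Fin 4 → smoothRing V} {r : smoothRing V} (htr : G.tr φ = 0)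
    (hmet : G.MetricEq φ r (G.gaugeQ f)) (I) :
    G.gaugeSystem φ r f I ∈ hypersurfaceIdeal V 1 := by
  have hQ := H.gaugeQ_mem_scri hU hG hpos hdet hUm hf hQ1
  rcases I with a | ⟨i, a⟩ | a
  · exact hQ a
  · change G.d i.1 (G.gaugeQ f a) ∈ _
    rw [H.d_eq]
    exact d_mem_hypersurfaceIdeal i.2 (hQ a)
  · exact H.divDefect_mem_scri hU hG hpos hUm hf hQ2 htr hmet hQ a

end Represents

end AdSGauge

/-! ### Positivity for Lorentzian metrics, and the conclusion at a corner point -/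

namespace AdSGauge
open TopologicalSpace (Opens)
open smoothRing

/-! ### Algebra of Lorentzian metrics -/

lemma IsLorentzianAt.det_neg {g : Tensor2} {x : Pt} (h : IsLorentzianAt g x) :
    (Matrix.of fun a b => g a b x).det < 0 := by
  obtain ⟨_, P, hP, h1⟩ := h
  have h2 := congrArg Matrix.det h1
  rw [Matrix.det_mul, Matrix.det_mul, Matrix.det_transpose, Matrix.det_diagonal,
    Fin.prod_univ_four] at h2
  simp only [Matrix.cons_val, mul_one] at h2
  have h3 : 0 < P.det * P.det := mul_self_pos.mpr hP.ne_zero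
  by_contra hn
  have := mul_nonneg h3.le (not_lt.mp hn)
  linarith

/-- By Cramer's rule `g^{00}` is the determinant of the positive definite spatial block divided by
the negative determinant of the metric. -/
lemma IsSpacelikeAt.inverse_neg {g : Tensor2} {x : Pt} (hs : IsSpacelikeAt g x)
    (h : IsLorentzianAt g x) : inverse g 0 0 x < 0 := by
  have hpd : ((Matrix.of fun a b => g a b x).submatrix (Fin.succAbove 0)
      (Fin.succAbove (0 : Fin 4))).PosDef := by
    refine Matrix.PosDef.of_dotProduct_mulVec_pos ?_ ?_
    · ext i j
      exact h.1 _ _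
    · intro v hv
      have h1 := hs (Fin.cons 0 v) rfl (fun h0 => hv (funext fun i => by
        simpa using congrFun h0 i.succ))
      simp only [Fin.sum_univ_succ (n := 3), Fin.cons_zero, Fin.cons_succ, mul_zero, zero_mul,
        zero_add, Finset.sum_const_zero] at h1
      simp only [dotProduct, Matrix.mulVec, Finset.mul_sum]
      refine h1.trans_eq (Finset.sum_congr rfl fun i _ => Finset.sum_congr rfl fun j _ => ?_)
      simp
      ring
  rw [inverse, Matrix.inv_def, Matrix.smul_apply, Ring.inverse_eq_inv', smul_eq_mul,
    Matrix.adjugate_fin_succ_eq_det_submatrix]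
  simp only [Fin.val_zero, add_zero, pow_zero, one_mul]
  exact mul_neg_of_neg_of_pos (inv_lt_zero.mpr h.det_neg) hpd.det_pos

/-- Positivity of the energy form of a Lorentzian metric. -/
lemma IsSpacelikeAt.energy_pos {g : Tensor2} {x : Pt} (hs : IsSpacelikeAt g x)
    (h : IsLorentzianAt g x) {ξ : Fin 4 → ℝ} (hξ : ξ ≠ 0) :
    0 < ∑ a, ∑ b, (inverse g 0 a x * inverse g 0 b x - 1 / 2 * inverse g 0 0 x * inverse g a b x)
      * ξ a * ξ b := by
  have h00 := hs.inverse_neg h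
  have hsym := fun a b => inverse_symm h.1 a b
  have hinv : ∀ a c, ∑ b, g a b x * inverse g b c x = if a = c then 1 else 0 := fun a c => by
    have h1 := congrFun (congrFun (Matrix.mul_nonsing_inv (Matrix.of fun a b => g a b x)
      (isUnit_iff_ne_zero.mpr h.det_neg.ne)) a) c
    rwa [Matrix.mul_apply, Matrix.one_apply] at h1
  set k : Fin 4 → Fin 4 → ℝ := fun a b => inverse g a b x with hk
  set v := ∑ a, k 0 a * ξ a with hv
  -- The multiple of `dx⁰` is subtracted which makes the raised vector `w` tangent to the level set
  -- of `x⁰`. The form then equals `v²/2 - g^{00} g(w,w)/2`.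
  set η : Fin 4 → ℝ := fun a => ξ a - (if a = 0 then v / k 0 0 else 0) with hη
  set w : Fin 4 → ℝ := fun a => ∑ b, k a b * η b with hw
  have hgw : ∀ a, ∑ b, g a b x * w b = η a := by
    intro a
    simp only [hw, Finset.mul_sum, ← mul_assoc]
    rw [Finset.sum_comm]
    simp only [← Finset.sum_mul, hk, hinv]
    simp
  have hw0 : w 0 = 0 := by
    simp only [hw, hη, mul_sub, Finset.sum_sub_distrib, ← hv]
    have := h00.ne
    simp only [mul_ite, mul_zero, Finset.sum_ite_eq', Finset.mem_univ, if_true]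
    rw [mul_div_cancel₀ _ this, sub_self]
  have hww : ∑ a, ∑ b, g a b x * w a * w b = ∑ a, ∑ b, k a b * ξ a * ξ b - v ^ 2 / k 0 0 := by
    have e1 : ∑ a, ∑ b, g a b x * w a * w b = ∑ a, w a * η a := by
      refine Finset.sum_congr rfl fun a _ => ?_
      rw [← hgw a, Finset.mul_sum]
      exact Finset.sum_congr rfl fun b _ => by ring
    have e2 : ∑ a, w a * η a = ∑ a, w a * ξ a := by
      simp only [hη, mul_sub, Finset.sum_sub_distrib]
      simp [hw0]
    have e3 : ∀ a, w a = ∑ b, k a b * ξ b - k a 0 * (v / k 0 0) := by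
      intro a
      simp only [hw, hη, mul_sub, Finset.sum_sub_distrib]
      simp
    have e4 : ∑ a, k a 0 * ξ a = v := Finset.sum_congr rfl fun a _ => congrArg (· * ξ a) (hsym a 0)
    rw [e1, e2]
    simp only [e3, sub_mul, Finset.sum_sub_distrib]
    have e5 : ∑ a, k a 0 * (v / k 0 0) * ξ a = v ^ 2 / k 0 0 := by
      rw [sq, ← mul_div_assoc']
      nth_rewrite 2 [← e4]
      rw [Finset.sum_mul]
      exact Finset.sum_congr rfl fun a _ => by ring
    rw [e5]
    congr 1
    refine Finset.sum_congr rfl fun a _ => ?_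
    rw [Finset.sum_mul]
    exact Finset.sum_congr rfl fun b _ => by ring
  have hform : ∑ a, ∑ b, (k 0 a * k 0 b - 1 / 2 * k 0 0 * k a b) * ξ a * ξ b
      = 1 / 2 * v ^ 2 - 1 / 2 * k 0 0 * ∑ a, ∑ b, g a b x * w a * w b := by
    have e1 : ∑ a, ∑ b, (k 0 a * k 0 b - 1 / 2 * k 0 0 * k a b) * ξ a * ξ b
        = v ^ 2 - 1 / 2 * k 0 0 * ∑ a, ∑ b, k a b * ξ a * ξ b := by
      rw [sq, hv, Finset.sum_mul_sum, Finset.mul_sum, ← Finset.sum_sub_distrib]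
      refine Finset.sum_congr rfl fun a _ => ?_
      rw [Finset.mul_sum, ← Finset.sum_sub_distrib]
      exact Finset.sum_congr rfl fun b _ => by ring
    rw [e1, hww]
    have : k 0 0 ≠ 0 := h00.ne
    field_simp
    ring
  rw [hform]
  have h00' : k 0 0 < 0 := h00
  -- If `w = 0` then `ξ` is a multiple of `dx⁰`, and `v²` alone is positive.
  by_cases hw1 : w = 0
  · have hη0 : η = 0 := funext fun a => by rw [← hgw a]; simp [hw1]
    have hv0 : v ≠ 0 := by
      intro hv0
      refine hξ (funext fun a => ?_)
      have := congrFun hη0 a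
      simpa [hη, hv0] using this
    have : 0 < v ^ 2 := by positivity
    simp only [hw1, Pi.zero_apply, mul_zero, Finset.sum_const_zero]
    linarith
  · have h1 := hs w hw0 hw1
    have := mul_pos (neg_pos.mpr h00') h1
    nlinarith [sq_nonneg v]

/-! ### Propagation near a corner point -/

/-- The metric is Lorentzian only on the region, whereas the inverse metric and the lapses must be
smooth on a full neighbourhood of `p`; the open conditions are extended by continuity. -/
lemma exists_regular_patch {U : Set Pt} (hU : IsOpen U) {g : Tensor2}
    (hg : ∀ μ ν, ContDiffOn ℝ ∞ (g μ ν) U) {p : Pt} (hp : p ∈ U)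
    (hdet : (Matrix.of fun a b => g a b p).det ≠ 0) (h00 : inverse g 0 0 p < 0)
    (h11 : 0 < inverse g 1 1 p) :
    ∃ V : Opens Pt, p ∈ V ∧ (V : Set Pt) ⊆ U ∧
      (∀ x ∈ V, (Matrix.of fun a b => g a b x).det ≠ 0) ∧ (∀ x ∈ V, inverse g 0 0 x < 0) ∧
      ∀ x ∈ V, 0 < inverse g 1 1 x := by
  have o1 := (contDiffOn_det hg).continuousOn.isOpen_inter_preimage hU isOpen_compl_singleton
    (t := {(0 : ℝ)}ᶜ)
  set W := U ∩ (fun x => (Matrix.of fun a b => g a b x).det) ⁻¹' {(0 : ℝ)}ᶜ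
  have hi := fun a b => (contDiffOn_inverse (W := W) (fun a b => (hg a b).mono Set.inter_subset_left)
    (fun x hx => hx.2) a b).continuousOn
  refine ⟨⟨_, ((hi 0 0).isOpen_inter_preimage o1 isOpen_Iio).inter
    ((hi 1 1).isOpen_inter_preimage o1 isOpen_Ioi)⟩, ⟨⟨⟨hp, hdet⟩, h00⟩, ⟨⟨hp, hdet⟩, h11⟩⟩,
    fun x hx => hx.1.1.1, fun x hx => hx.1.1.2, fun x hx => hx.1.2, fun x hx => hx.2.2⟩

/-- If the gauge covector vanishes on an open part of the region, then so do the other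
zero-quantities. -/
lemma Represents.zeroQuantities_eq_zero {V : Opens Pt} {G : MetricAlgebra (smoothRing V)}
    {g : Tensor2} (H : Represents G g) {Φ : Tensor2} {φ : Fin 4 → Fin 4 → smoothRing V}
    (hφ : ∀ a b, Rep (Φ a b) (φ a b)) {R : Scalar} {r : smoothRing V} (hr : Rep R r) {F : Tensor1}
    {f : Fin 4 → smoothRing V} (hf : ∀ a, Rep (F a) (f a)) (htr : G.tr φ = 0)
    (hmet : G.MetricEq φ r (G.gaugeQ f)) {B : Set Pt} (hB : IsOpen B) (hBV : B ⊆ V)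
    (hQ : ∀ x ∈ B, x ∈ quadrant → ∀ a, AdSGauge.QDown g F a x = 0) {x : Pt} (hx : x ∈ B)
    (hq : x ∈ quadrant) : QScalar g R x = 0 ∧ ∀ μ ν, QTensor g Φ R μ ν x = 0 := by
  have hD : ∀ μ ν, AdSGauge.cov1 g (AdSGauge.QDown g F) μ ν x = 0 := by
    intro μ ν
    have h1 : AdSGauge.pd μ (AdSGauge.QDown g F ν) x = 0 :=
      pd_eq_zero_of_eqOn hB ((H.QDown hf ν).smooth.mono hBV) hx μ
        (fun t ht => quadrant_add hq μ ht) fun y hy hyq => hQ y hy hyq ν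
    rw [AdSGauge.cov1, h1]
    simp [hQ x hx hq]
  constructor
  · have h1 := H.scalarCurv.eval_eq ((hr.add (H.tr fun m μ => H.cov1 (H.QDown hf) m μ)).congr_eq
      (hmet.Rs_eq htr).symm) (hBV hx) hq
    simp only [hD, mul_zero, Finset.sum_const_zero, add_zero] at h1
    rw [QScalar, h1, sub_self]
  · intro μ ν
    have h1 := ((Rep.ofNat 4).mul (H.ricci μ ν)).eval_eq
      (((((Rep.ofNat 8).mul (hφ μ ν)).add (hr.mul (H.rep_g μ ν))).add ((Rep.ofNat 2).mul
        ((H.cov1 (H.QDown hf) μ ν).add (H.cov1 (H.QDown hf) ν μ)))).congr_eq (hmet μ ν).symm)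
      (hBV hx) hq
    simp only [hD] at h1
    rw [QTensor]
    linarith

section

variable {U : Set Pt} (hU : IsOpen U)
    {g Φ : Tensor2} {R : Scalar} {F : Tensor1} {Ξ : Scalar} {d : Tensor4} {κ : Scalar}
    (hg : ∀ μ ν, ContDiffOn ℝ ∞ (g μ ν) U)
    (hΦ : ∀ μ ν, ContDiffOn ℝ ∞ (Φ μ ν) U)
    (hR : ContDiffOn ℝ ∞ R U)
    (hF : ∀ μ, ContDiffOn ℝ ∞ (F μ) U)
    (hLorentz : ∀ x ∈ region U, IsLorentzianAt g x)
    (hSpacelike : ∀ x ∈ initialSurface U, IsSpacelikeAt g x)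
    (hsol : IsReducedSolution (region U) g Φ R F Ξ d)
    (hGauss : GaussianOnScri U g)
    (hUmbilic : UmbilicScri U g κ)
    (hQ1 : QGauge1 U g F κ)
    (hQ2 : QGauge2 U g F κ)
    (hQ3 : QGauge3 U g F)

include hU hg hΦ hR hF hLorentz hSpacelike hsol hGauss hUmbilic hQ1 hQ2 hQ3

theorem zeroQuantities_eq_zero_near_corner {p : Pt} (hp : p ∈ corner U) :
    ∃ ε > 0, ∀ x, dist x p < ε → x ∈ quadrant →
      QScalar g R x = 0 ∧ (∀ μ, QDown g F μ x = 0) ∧ (∀ μ ν, QTensor g Φ R μ ν x = 0) := by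
  obtain ⟨hpU, hp0, hp1⟩ := hp
  have hpq : p ∈ quadrant := ⟨hp0.ge, hp1.ge⟩
  have hpr : p ∈ region U := ⟨hpU, hpq⟩
  have hL := hLorentz p hpr
  have hS := hSpacelike p ⟨hpr, hp0⟩
  -- At the corner `g^{00} < 0` because the initial surface is spacelike, and `g^{11} = 1` by the
  -- Gaussian gauge.
  obtain ⟨V, hpV, hVU, hdet, h00, h11⟩ := exists_regular_patch hU hg hpU hL.det_neg.ne
    (hS.inverse_neg hL) (by rw [inverse_of_gaussian hGauss ⟨hpr, hp1⟩]; simp)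
  have hVr : ∀ x ∈ V, x ∈ quadrant → x ∈ region U := fun x hx hq => ⟨hVU hx, hq⟩
  have hsym : ∀ x ∈ V, x ∈ quadrant → ∀ a b, g a b x = g b a x :=
    fun x hx hq => (hLorentz x (hVr x hx hq)).1
  have H := represents_metricAlgebra (fun a b => (hg a b).mono hVU) hdet hsym
  set G := metricAlgebra V g (fun a b => (hg a b).mono hVU) hdet hsym
  have hφ : ∀ a b, Rep (V := V) (Φ a b) (mk (Φ a b) ((hΦ a b).mono hVU)) := fun a b => rep_mk _ _
  set φ : Fin 4 → Fin 4 → smoothRing V := fun a b => mk (Φ a b) ((hΦ a b).mono hVU)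
  have hr : Rep (V := V) R (mk R (hR.mono hVU)) := rep_mk _ _
  set r : smoothRing V := mk R (hR.mono hVU)
  have hf : ∀ a, Rep (V := V) (F a) (mk (F a) ((hF a).mono hVU)) := fun a => rep_mk _ _
  set f : Fin 4 → smoothRing V := fun a => mk (F a) ((hF a).mono hVU)
  have hφs : ∀ a b, φ a b = φ b a := fun a b => (hφ a b).ext (hφ b a)
    fun x hx hq => hsol.symm x (hVr x hx hq) a b
  have htr : G.tr φ = 0 := (H.tr hφ).ext Rep.zero fun x hx hq => hsol.tracefree x (hVr x hx hq)
  have hmet := H.metricEq hφ hr hf hsol hVr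
  have hwave := H.waveEq hφ hr hf hsol hVr
  have hunit : IsUnit (G.gi 1 1) := (H.rep_gi 1 1).isUnit fun x hx => (h11 x hx).ne'
  have hJ : ∀ k, k ≠ 0 → ∀ s ∈ hypersurfaceIdeal V 0, G.d k s ∈ hypersurfaceIdeal V 0 :=
    fun k hk s hs => by rw [H.d_eq]; exact d_mem_hypersurfaceIdeal hk hs
  have hjet := MetricAlgebra.gaugeSystem_mem_jet hJ htr hmet
    (H.gaugeQ_mem_jet hf h00 hVr hQ3)
  have hscri := H.gaugeSystem_mem_scri hVr hGauss h11 hdet hUmbilic hf hQ1 hQ2 htr hmet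
  have hu := fun I => rep_rep (G.gaugeSystem φ r f I)
  obtain ⟨ε, hε, hzero⟩ := wave_uniqueness V.isOpen hpV hp0 hp1
    (fun a b => (H.rep_gi a b).smooth)
    (fun x hx hq a b => inverse_symm (hsym x hx hq) a b)
    (fun x hx hq h1 => by
      rw [inverse_symm (hsym x hx hq), inverse_of_gaussian hGauss ⟨hVr x hx hq, h1⟩]; simp)
    (fun ξ hξ => hS.energy_pos hL hξ)
    (fun I => (hu I).smooth)
    (fun I => (hu I).mem_hypersurfaceIdeal_iff.mp (hscri I))
    (fun I x hx hq h0 => ⟨(hu I).mem_hypersurfaceIdeal_iff.mp (hjet I).1 x hx hq h0, fun k =>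
      (H.pd (hu I) k).mem_hypersurfaceIdeal_iff.mp (MetricAlgebra.d_mem_jet hJ k (hjet I))
        x hx hq h0⟩)
    (H.isBigO_waveOp hu fun K h0 h1 I => MetricAlgebra.waveSymbol_gaugeSystem_mem hφs htr hmet
      hwave hunit h0 h1 I)
  -- The ball from the uniqueness theorem need not lie in `V`, and only on `V` do the ring elements
  -- represent the gauge quantities.
  obtain ⟨δ, hδ, hball⟩ := Metric.isOpen_iff.mp V.isOpen p hpV
  have hQ : ∀ x ∈ Metric.ball p (min ε δ), x ∈ quadrant → ∀ a, QDown g F a x = 0 := by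
    intro x hx hq a
    have hxV : x ∈ V := hball (Metric.ball_subset_ball (min_le_right _ _) hx)
    rw [(H.QDown hf a).eval_eq (hu (Sum.inl a)) hxV hq]
    exact hzero x (Metric.ball_subset_ball (min_le_left ε δ) hx) hq _
  refine ⟨min ε δ, lt_min hε hδ, fun x hx hq => ?_⟩
  have h1 := H.zeroQuantities_eq_zero hφ hr hf htr hmet Metric.isOpen_ball
    ((Metric.ball_subset_ball (min_le_right _ _)).trans hball) hQ (x := x) hx hq
  exact ⟨h1.1, hQ x hx hq, h1.2⟩

end

end AdSGauge

end

theorem mainTheorem2 (U : Set Pt) (hU : IsOpen U)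
    (g Φ : Tensor2) (R : Scalar) (F : Tensor1) (Ξ : Scalar) (d : Tensor4) (κ : Scalar)
    (hg : ∀ μ ν, ContDiffOn ℝ ∞ (g μ ν) U)
    (hΦ : ∀ μ ν, ContDiffOn ℝ ∞ (Φ μ ν) U)
    (hR : ContDiffOn ℝ ∞ R U)
    (hF : ∀ μ, ContDiffOn ℝ ∞ (F μ) U)
    (hLorentz : ∀ x ∈ region U, IsLorentzianAt g x)
    (hSpacelike : ∀ x ∈ initialSurface U, IsSpacelikeAt g x)
    (hsol : IsReducedSolution (region U) g Φ R F Ξ d)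
    (hGauss : GaussianOnScri U g)
    (hUmbilic : UmbilicScri U g κ)
    (hQ1 : QGauge1 U g F κ)
    (hQ2 : QGauge2 U g F κ)
    (hQ3 : QGauge3 U g F) :
    ∃ V : Set Pt, IsOpen V ∧ corner U ⊆ V ∧
      ∀ x ∈ V ∩ region U,
        QScalar g R x = 0 ∧ (∀ μ, QDown g F μ x = 0) ∧ (∀ μ ν, QTensor g Φ R μ ν x = 0) := by
  choose! ε hε h using fun p (hp : p ∈ corner U) => zeroQuantities_eq_zero_near_corner hU hg hΦ hR hF
    hLorentz hSpacelike hsol hGauss hUmbilic hQ1 hQ2 hQ3 hp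
  refine ⟨⋃ p ∈ corner U, Metric.ball p (ε p), isOpen_biUnion fun p _ => Metric.isOpen_ball,
    fun p hp => Set.mem_biUnion hp (Metric.mem_ball_self (hε p hp)), ?_⟩
  rintro x ⟨hx, hxr⟩
  obtain ⟨p, hp, hxp⟩ := Set.mem_iUnion₂.mp hx
  exact h p hp x hxp hxr.2
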